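/- **Setting.** A finite quiver consists of finite sets $\mathbf I$ (vertices) and $\Omega$ (edges) with maps $h\mapsto h'$ (source) and $h\mapsto h''$ (target) from $\Omega$ to $\mathbf I$; loops and multiple edges are allowed. Let $a$ be an admissible automorphism of it: bijections of $\mathbf I$ and $\Omega$, compatible with source and target, such that an edge with $h'\ne h''$ never has both ends in one $a$-orbit. Let $e\in\Omega$, let $[i_+]$, $[i_-]$ be the $a$-orbits of $e'$, $e''$ and let $C$ be the $a$-orbit of $e$. Assume: $\#[i_+]=\#[i_-]=\#C$; there are no loops at vertices of $[i_+]\cup[i_-]$; if $h,l$ are edges with all ends in $[i_+]\cup[i_-]$, $h'\neq h''$ and $l'\in\{h',h''\}$, then $l''\in\{h',h''\}$. The contracted quiver has vertex set $\mathbf I\setminus[i_-]$; its edges are the edges of $\Omega$ with no end in $[i_-]$, the symbols $l h$ (from $h'$ to $l''$) with $h\in C$, $h''=l'$, and the symbols $\bar h\, l$ (from $l'$ to $h'$) with $h\in C$, $l\notin C$, $h''=l''$; it carries the automorphism induced by $a$. Let $q=p^r$ ($p$ prime, $r\ge1$), $K=\overline{\mathbb F}_p$, $v\in\mathbb C$ with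 $v^2=q$, $k=\mathbb Q(v)$. For $\nu\in\mathbb N[I]$, that is, $\nu:\mathbf I\to\mathbb N$ constant on $a$-orbits, put $V_i=K^{\nu_i}$, $E_V=\bigoplus_{h\in\Omega}\mathrm{Hom}(V_{h'},V_{h''})$, $G_V=\prod_i GL(V_i)$ acting by $(g\cdot x)_h=g_{h''}x_hg_{h'}^{-1}$. Let $F$ be the twisted Frobenius on $E_V$ and $G_V$: it raises matrix entries to the $q$-th power and permutes components by $a$, $(Fx)_{a(h)}=\mathrm{Fr}(x_h)$, $(Fg)_{a(i)}=\mathrm{Fr}(g_i)$. The Hall algebra is $H=\bigoplus_{\nu\in\mathbb N[I]}H_\nu$, where $H_\nu$ is the space of $G_V^F$-invariant functions $E_V^F\to k$. For $\nu=\tau+\omega$ and $V=T\oplus W$ accordingly, the product $H_\tau\times H_\omega\to H_\nu$ is $$f_1\circ f_2=v^{-m(\tau,\omega)}\,\frac1{\#G_T^F\,\#G_W^F}\,(p_3)_!(p_2)_!p_1^*(f_1\otimes f_2),\qquad m(\tau,\omega)=\sum_{i\in\mathbf I}\tau_i\omega_i+\sum_{h\in\Omega}\tau_{h'}\omega_{h''},$$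 where $S_W\subseteq E_V$ is the set of $x$ leaving $W$ invariant, $Q\subseteq G_V$ is the stabilizer of $W$ with unipotent radical $U$, both acting on $G_V\times S_W$ by $b\cdot(g,x)=(gb^{-1},b\cdot x)$, $E'=U\backslash(G_V\times S_W)$, $E''=Q\backslash(G_V\times S_W)$, and $$E_T^F\times E_W^F\xleftarrow{\;p_1\;}E'^F\xrightarrow{\;p_2\;}E''^F\xrightarrow{\;p_3\;}E_V^F$$ are given by $p_1[g,x]=(x^T,x^W)$ (induced maps on $V/W\cong T$ and on $W$), $p_2$ the projection, $p_3[g,x]=g\cdot x$; $\phi^*$ is composition with $\phi$, and $\phi_!$ is summation over the fibres of $\phi$. The unit is the function $1$ in $H_0$. Let $\mathbb N[\hat I]\subseteq\mathbb N[I]$ be the set of $\nu$ with $\nu_{i_+}=\nu_{i_-}$, and for such $\nu$ let $E_V^\heartsuit\subseteq E_V$ be the set of $x$ with $x_h$ an isomorphism for all $h\in C$. Put $H_{\hat I}=\bigoplus_{\nu\in\mathbb N[\hat I]}H_\nu$; let $H^\heartsuit=\bigoplus_{\nu\in\mathbb N[\hat I]}H^\heartsuit_\nu$ and $H^c=\bigoplus_{\nu\in\mathbb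 N[\hat I]}H^c_\nu$ be formed by the $G_V^F$-invariant functions on $E_V^{\heartsuit,F}$ and on $E_V^F\setminus E_V^{\heartsuit,F}$, the product of $H^\heartsuit$ being given by the same formula for the diagram above restricted to $E^\heartsuit$. Let $\hat H$ be the Hall algebra of the contracted quiver. Extension by zero gives maps $H^c\to H_{\hat I}$ and $j_!:H^\heartsuit\to H_{\hat I}$, and restriction of functions gives $j^*:H_{\hat I}\to H^\heartsuit$. Let $\mu_\nu$ map $x\in E_V^{\heartsuit}$ to the representation $\hat x$ of the contracted quiver with $\hat x_h=x_h$, $\hat x_{lh}=x_lx_h$, $\hat x_{\bar hl}=x_h^{-1}x_l$, and let $\mu^\star:\hat H\to H^\heartsuit$ be given in degree $\nu\in\mathbb N[\hat I]$ by $f\mapsto v^{-\nu_{i_-}^2\#[i_-]}\,f\circ\mu_\nu$. A homomorphism of Hall algebras is a $k$-linear multiplicative map preserving the unit. **Theorem.** $H_{\hat I}$ is a subalgebra of $H$ containing the unit, $H^c$ is a two-sided ideal of $H_{\hat I}$, and $$0\longrightarrow H^c\longrightarrow H_{\hat I}\xrightarrow{\;j^*\;}H^\heartsuit\longrightarrow0$$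 is a short exact sequence, in which $j^*$ is a homomorphism of Hall algebras, split by the homomorphism of Hall algebras $j_!$ (that is, $j^*j_!=\mathrm{id}$). Furthermore $\mu^\star$ is an isomorphism of Hall algebras, and $j_!\mu^\star$ induces an isomorphism of Hall algebras $\hat H\cong H_{\hat I}/H^c$. Thus $\hat H$ is a split subquotient of $H$: there is a surjective homomorphism of Hall algebras $\pi:H_{\hat I}\to\hat H$ with kernel $H^c$, and $j_!\mu^\star$ is a homomorphism of Hall algebras with $\pi\, j_!\mu^\star=\mathrm{id}$. -/

import Mathlib

open scoped DirectSum

noncomputable section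

namespace HallContraction

universe u w

/-! ## Quivers with an automorphism -/

/-- An oriented graph with vertex set `I` and edge set `Ω` (loops and multiple edges allowed),
together with an automorphism `a = (aV, aE)`. -/
structure AutQuiver (I : Type u) (Ω : Type w) where
  src : Ω → I
  tgt : Ω → I
  aV : Equiv.Perm I
  aE : Equiv.Perm Ω
  src_aE : ∀ h, src (aE h) = aV (src h)
  tgt_aE : ∀ h, tgt (aE h) = aV (tgt h)

/-- The algebraic closure of the prime field with `p` elements. -/
abbrev Kbar (p : ℕ) [Fact p.Prime] : Type := AlgebraicClosure (ZMod p)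

/-- The Frobenius map `z ↦ z ^ q` of `Kbar p`, where `q = p ^ r`. -/
def Fr (p r : ℕ) [Fact p.Prime] : Kbar p →+* Kbar p := iterateFrobenius (Kbar p) p r

theorem Fr_apply (p r : ℕ) [Fact p.Prime] (z : Kbar p) : Fr p r z = z ^ p ^ r :=
  iterateFrobenius_def p r z

/-! ## Matrices: change of (equal) sizes and blocks -/

section Matrices

variable {R : Type*}

/-- Regard an `m × n` matrix as an `m' × n'` matrix when `m = m'` and `n = n'`. -/
def recast {m m' n n' : ℕ} (hm : m = m') (hn : n = n') (x : Matrix (Fin m) (Fin n) R) :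
    Matrix (Fin m') (Fin n') R :=
  x.submatrix (Fin.cast hm.symm) (Fin.cast hn.symm)

@[simp] theorem recast_rfl {m n : ℕ} (hm : m = m) (hn : n = n) (x : Matrix (Fin m) (Fin n) R) :
    recast hm hn x = x := rfl

theorem recast_mul [CommRing R] {m m' n n' k k' : ℕ} (hm : m = m') (hn : n = n') (hk : k = k')
    (x : Matrix (Fin m) (Fin n) R) (y : Matrix (Fin n) (Fin k) R) :
    recast hm hk (x * y) = recast hm hn x * recast hn hk y := by
  subst hm hn hk; rfl

theorem recast_recast {m m' m'' n n' n'' : ℕ} (hm : m = m') (hn : n = n') (hm' : m' = m'')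
    (hn' : n' = n'') (x : Matrix (Fin m) (Fin n) R) :
    recast hm' hn' (recast hm hn x) = recast (hm.trans hm') (hn.trans hn') x := rfl

theorem recast_fam {α : Type*} {m n : α → ℕ} (z : ∀ j, Matrix (Fin (m j)) (Fin (n j)) R)
    {i j : α} (h : i = j) (hm : m i = m j) (hn : n i = n j) : recast hm hn (z i) = z j := by
  subst h; rfl

/-- Blocks of a matrix whose rows and columns are split as `m + m'` and `n + n'`
(the first part is the `T`-part, the second part the `W`-part). -/
def blkTT {m m' n n' : ℕ} (x : Matrix (Fin (m + m')) (Fin (n + n')) R) :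
    Matrix (Fin m) (Fin n) R := x.submatrix (Fin.castAdd m') (Fin.castAdd n')

/-- The component from the `W`-part to the `T`-part. -/
def blkTW {m m' n n' : ℕ} (x : Matrix (Fin (m + m')) (Fin (n + n')) R) :
    Matrix (Fin m) (Fin n') R := x.submatrix (Fin.castAdd m') (Fin.natAdd n)

/-- The component from the `T`-part to the `W`-part. -/
def blkWT {m m' n n' : ℕ} (x : Matrix (Fin (m + m')) (Fin (n + n')) R) :
    Matrix (Fin m') (Fin n) R := x.submatrix (Fin.natAdd m) (Fin.castAdd n')

/-- The component from the `W`-part to the `W`-part. -/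
def blkWW {m m' n n' : ℕ} (x : Matrix (Fin (m + m')) (Fin (n + n')) R) :
    Matrix (Fin m') (Fin n') R := x.submatrix (Fin.natAdd m) (Fin.natAdd n)

theorem blk_ext {m m' n n' : ℕ} {x y : Matrix (Fin (m + m')) (Fin (n + n')) R}
    (h1 : blkTT x = blkTT y) (h2 : blkTW x = blkTW y) (h3 : blkWT x = blkWT y)
    (h4 : blkWW x = blkWW y) : x = y := by
  ext i j
  refine Fin.addCases (fun i => ?_) (fun i => ?_) i <;>
    refine Fin.addCases (fun j => ?_) (fun j => ?_) j
  · exact congrFun (congrFun h1 i) j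
  · exact congrFun (congrFun h2 i) j
  · exact congrFun (congrFun h3 i) j
  · exact congrFun (congrFun h4 i) j

variable [CommRing R] {m m' n n' k k' : ℕ}
  (x : Matrix (Fin (m + m')) (Fin (n + n')) R) (y : Matrix (Fin (n + n')) (Fin (k + k')) R)

theorem blkTT_mul : blkTT (x * y) = blkTT x * blkTT y + blkTW x * blkWT y := by
  ext i j; simp [blkTT, blkTW, blkWT, Matrix.mul_apply, Fin.sum_univ_add]

theorem blkTW_mul : blkTW (x * y) = blkTT x * blkTW y + blkTW x * blkWW y := by
  ext i j; simp [blkTT, blkTW, blkWW, Matrix.mul_apply, Fin.sum_univ_add]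

theorem blkWT_mul : blkWT (x * y) = blkWT x * blkTT y + blkWW x * blkWT y := by
  ext i j; simp [blkTT, blkWW, blkWT, Matrix.mul_apply, Fin.sum_univ_add]

theorem blkWW_mul : blkWW (x * y) = blkWT x * blkTW y + blkWW x * blkWW y := by
  ext i j; simp [blkTW, blkWW, blkWT, Matrix.mul_apply, Fin.sum_univ_add]

@[simp] theorem blkTT_one : blkTT (1 : Matrix (Fin (m + m')) (Fin (m + m')) R) = 1 := by
  ext i j; simp [blkTT, Matrix.one_apply]

@[simp] theorem blkTW_one : blkTW (1 : Matrix (Fin (m + m')) (Fin (m + m')) R) = 0 := by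
  ext i j; simp [blkTW, Matrix.one_apply, Fin.ext_iff]; omega

@[simp] theorem blkWW_one : blkWW (1 : Matrix (Fin (m + m')) (Fin (m + m')) R) = 1 := by
  ext i j; simp [blkWW, Matrix.one_apply]

/-- A (rectangular) matrix that defines an isomorphism. -/
def IsIsoMat {m n : ℕ} (x : Matrix (Fin m) (Fin n) R) : Prop :=
  ∃ y : Matrix (Fin n) (Fin m) R, x * y = 1 ∧ y * x = 1

open Classical in
/-- The inverse of an isomorphism (and `0` for other matrices). -/
def isoInv {m n : ℕ} (x : Matrix (Fin m) (Fin n) R) : Matrix (Fin n) (Fin m) R :=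
  if h : IsIsoMat x then h.choose else 0

theorem isoInv_eq {m n : ℕ} {x : Matrix (Fin m) (Fin n) R} {y : Matrix (Fin n) (Fin m) R}
    (h1 : x * y = 1) (h2 : y * x = 1) : isoInv x = y := by
  have h : IsIsoMat x := ⟨y, h1, h2⟩
  rw [isoInv, dif_pos h]
  calc h.choose = h.choose * (x * y) := by rw [h1, Matrix.mul_one]
    _ = y := by rw [← Matrix.mul_assoc, h.choose_spec.2, Matrix.one_mul]

theorem IsIsoMat.mul_isoInv {m n : ℕ} {x : Matrix (Fin m) (Fin n) R} (h : IsIsoMat x) :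
    x * isoInv x = 1 ∧ isoInv x * x = 1 := by
  rw [isoInv, dif_pos h]; exact h.choose_spec

theorem isIsoMat_recast {m m' n n' : ℕ} (hm : m = m') (hn : n = n') {x : Matrix (Fin m) (Fin n) R}
    (h : IsIsoMat x) : IsIsoMat (recast hm hn x) := by
  subst hm hn; exact h

theorem isoInv_recast {m m' n n' : ℕ} (hm : m = m') (hn : n = n') (x : Matrix (Fin m) (Fin n) R) :
    isoInv (recast hm hn x) = recast hn hm (isoInv x) := by
  subst hm hn; rfl

theorem map_mul_map {S : Type*} [CommRing S] (σ : R →+* S) {m n k : ℕ}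
    (x : Matrix (Fin m) (Fin n) R) (y : Matrix (Fin n) (Fin k) R) :
    (x * y).map σ = x.map σ * y.map σ := Matrix.map_mul

theorem one_map' {S : Type*} [CommRing S] (σ : R →+* S) {m : ℕ} :
    (1 : Matrix (Fin m) (Fin m) R).map σ = 1 := Matrix.map_one _ (map_zero σ) (map_one σ)

theorem isIsoMat_map {S : Type*} [CommRing S] (σ : R →+* S) {m n : ℕ}
    {x : Matrix (Fin m) (Fin n) R} (h : IsIsoMat x) : IsIsoMat (x.map σ) := by
  obtain ⟨y, h1, h2⟩ := h
  exact ⟨y.map σ, by rw [← map_mul_map, h1, one_map'], by rw [← map_mul_map, h2, one_map']⟩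

theorem isoInv_map {S : Type*} [CommRing S] (σ : R →+* S) {m n : ℕ}
    {x : Matrix (Fin m) (Fin n) R} (h : IsIsoMat x) : isoInv (x.map σ) = (isoInv x).map σ := by
  obtain ⟨h1, h2⟩ := h.mul_isoInv
  exact isoInv_eq (by rw [← map_mul_map, h1, one_map']) (by rw [← map_mul_map, h2, one_map'])

end Matrices

/-! ## Twisted Frobenius on families of matrices -/

section Fam

variable (p r : ℕ) [Fact p.Prime] {α : Type*} (a : Equiv.Perm α) {m n : α → ℕ}

/-- Families of matrices over `Kbar p`, of sizes `m j × n j`. -/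
abbrev Fam (m n : α → ℕ) : Type _ := ∀ j, Matrix (Fin (m j)) (Fin (n j)) (Kbar p)

theorem eq_symm (hm : ∀ j, m (a j) = m j) (j : α) : m (a.symm j) = m j := by
  conv_rhs => rw [← a.apply_symm_apply j]
  exact (hm _).symm

/-- The twisted Frobenius: permute the members of the family by `a` and raise all entries to
the `q`-th power, that is, `(F z)_{a j} = Fr (z_j)`. -/
def frobFam (hm : ∀ j, m (a j) = m j) (hn : ∀ j, n (a j) = n j) (z : Fam p m n) : Fam p m n :=
  fun j => (recast (eq_symm a hm j) (eq_symm a hn j) (z (a.symm j))).map (Fr p r)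

theorem frobFam_apply (hm : ∀ j, m (a j) = m j) (hn : ∀ j, n (a j) = n j) (z : Fam p m n)
    (j : α) : frobFam p r a hm hn z (a j) =
      (recast (hm j).symm (hn j).symm (z j)).map (Fr p r) := by
  have h : a.symm (a j) = j := a.symm_apply_apply j
  rw [frobFam, ← recast_fam z h (congrArg m h) (congrArg n h)]
  rfl

theorem finite_frobFam [Finite α] [NeZero r] (hm : ∀ j, m (a j) = m j)
    (hn : ∀ j, n (a j) = n j) : Finite {z : Fam p m n // frobFam p r a hm hn z = z} := by
  classical
  have key : ∀ z : Fam p m n, frobFam p r a hm hn z = z → ∀ (k : ℕ) (j : α)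
      (s : Fin (m j)) (t : Fin (n j)) (s' : Fin (m ((a ^ k) j))) (t' : Fin (n ((a ^ k) j))),
      (s : ℕ) = s' → (t : ℕ) = t' → z ((a ^ k) j) s' t' = (z j s t) ^ (p ^ r) ^ k := by
    intro z hz k
    induction k with
    | zero =>
      intro j s t s' t' h1 h2
      have : s' = s := Fin.ext h1.symm
      have : t' = t := Fin.ext h2.symm
      subst s' t'
      change z j s t = z j s t ^ (p ^ r) ^ 0
      rw [pow_zero, pow_one]
    | succ k ih =>
      intro j s t s' t' h1 h2
      have e : (a ^ (k + 1)) j = (a ^ k) (a j) := by rw [pow_succ]; rfl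
      have h3 := ih (a j) (Fin.cast (hm j).symm s) (Fin.cast (hn j).symm t)
        (Fin.cast (congrArg m e) s') (Fin.cast (congrArg n e) t') h1 h2
      have h4 : z ((a ^ (k + 1)) j) s' t' = z ((a ^ k) (a j)) (Fin.cast (congrArg m e) s')
          (Fin.cast (congrArg n e) t') := by
        rw [← recast_fam z e (congrArg m e) (congrArg n e)]
        rfl
      have h5 : z (a j) (Fin.cast (hm j).symm s) (Fin.cast (hn j).symm t) = z j s t ^ p ^ r := by
        conv_lhs => rw [← hz, frobFam_apply]
        rw [Matrix.map_apply, Fr_apply]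
        rfl
      rw [h4, h3, h5, ← pow_mul, ← pow_succ']
  have hp : 1 < p := (Fact.out : p.Prime).one_lt
  set N := orderOf a with hN
  have hN0 : N ≠ 0 := (orderOf_pos a).ne'
  have hq : 1 < (p ^ r) ^ N := Nat.one_lt_pow hN0 (Nat.one_lt_pow (NeZero.ne r) hp)
  let P : Polynomial (Kbar p) := Polynomial.X ^ ((p ^ r) ^ N) - Polynomial.X
  have hP : P ≠ 0 := FiniteField.X_pow_card_sub_X_ne_zero _ hq
  let S : Set (Kbar p) := (P.roots.toFinset : Set _)
  have hS : S.Finite := Finset.finite_toSet _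
  have : {z : Fam p m n | frobFam p r a hm hn z = z} ⊆
      Set.pi Set.univ fun j => {x | ∀ s t, x s t ∈ S} := by
    intro z hz j _ s t
    have e : (a ^ N) j = j := by rw [hN, pow_orderOf_eq_one]; rfl
    have h := key z hz N j s t (Fin.cast (congrArg m e.symm) s) (Fin.cast (congrArg n e.symm) t)
      rfl rfl
    have h4 : z j s t = z ((a ^ N) j) (Fin.cast (congrArg m e.symm) s)
        (Fin.cast (congrArg n e.symm) t) := by
      rw [← recast_fam z e.symm (congrArg m e.symm) (congrArg n e.symm)]
      rfl
    rw [← h4] at h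
    simp only [S, P, Finset.mem_coe, Multiset.mem_toFinset, Polynomial.mem_roots hP,
      Polynomial.IsRoot, Polynomial.eval_sub, Polynomial.eval_pow, Polynomial.eval_X]
    rw [← h, sub_self]
  have hfin : ∀ j, ({x : Matrix (Fin (m j)) (Fin (n j)) (Kbar p) | ∀ s t, x s t ∈ S}).Finite :=
    fun j => Set.Finite.pi' (fun _ : Fin (m j) => Set.Finite.pi' (fun _ : Fin (n j) => hS))
  exact ((Set.Finite.pi' hfin).subset fun z hz j => this hz j trivial).to_subtype

theorem frobFam_mul {k : α → ℕ} (hm : ∀ j, m (a j) = m j) (hn : ∀ j, n (a j) = n j)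
    (hk : ∀ j, k (a j) = k j) (z : Fam p m n) (y : Fam p n k) :
    frobFam p r a hm hk (fun j => z j * y j) =
      fun j => frobFam p r a hm hn z j * frobFam p r a hn hk y j := by
  funext j
  simp only [frobFam]
  rw [recast_mul _ (eq_symm a hn j), map_mul_map]

end Fam

/-! ## Representation spaces -/

namespace AutQuiver

variable {I : Type u} {Ω : Type w} (Q : AutQuiver I Ω)

/-- `ℕ[I/a]`: dimension vectors, that is, functions on the vertices that are constant on the
orbits of the automorphism. -/
def dimVec : AddSubmonoid (I → ℕ) where
  carrier := {ν | ∀ i, ν (Q.aV i) = ν i}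
  zero_mem' := fun _ => rfl
  add_mem' := fun {ν μ} hν hμ i => by
    change ν (Q.aV i) + μ (Q.aV i) = ν i + μ i
    rw [hν i, hμ i]

/-- The type of dimension vectors. -/
abbrev DimVec : Type u := ↥Q.dimVec

variable {Q}

theorem tgt_inv (ν : Q.DimVec) (h : Ω) : ν.1 (Q.tgt (Q.aE h)) = ν.1 (Q.tgt h) := by
  rw [Q.tgt_aE, ν.2]

theorem src_inv (ν : Q.DimVec) (h : Ω) : ν.1 (Q.src (Q.aE h)) = ν.1 (Q.src h) := by
  rw [Q.src_aE, ν.2]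

theorem tgt_symm (h : Ω) : Q.tgt (Q.aE.symm h) = Q.aV.symm (Q.tgt h) := by
  rw [Equiv.eq_symm_apply, ← Q.tgt_aE, Equiv.apply_symm_apply]

theorem src_symm (h : Ω) : Q.src (Q.aE.symm h) = Q.aV.symm (Q.src h) := by
  rw [Equiv.eq_symm_apply, ← Q.src_aE, Equiv.apply_symm_apply]

variable (p r : ℕ) [Fact p.Prime]

/-- The representation space `E_V`, where `V_i = K ^ (ν i)` with its standard basis. -/
abbrev Rep (ν : Q.DimVec) : Type w :=
  Fam p (fun h : Ω => ν.1 (Q.tgt h)) (fun h : Ω => ν.1 (Q.src h))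

/-- The group `G_V`, the product of the groups `GL(V_i)`. -/
abbrev Grp (ν : Q.DimVec) : Type u := ∀ i : I, GL (Fin (ν.1 i)) (Kbar p)

variable {p}

/-- The action `(g • x)_h = g_{h''} x_h g_{h'}⁻¹`. -/
def act {ν : Q.DimVec} (g : Grp p ν) (x : Rep p ν) : Rep p ν := fun h =>
  (g (Q.tgt h)).1 * x h * (g (Q.src h))⁻¹.1

theorem act_one {ν : Q.DimVec} (x : Rep p ν) : act 1 x = x := by
  funext h
  simp [act]

theorem act_mul {ν : Q.DimVec} (g g' : Grp p ν) (x : Rep p ν) :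
    act (g * g') x = act g (act g' x) := by
  funext h
  simp only [act, Pi.mul_apply, mul_inv_rev, Units.val_mul]
  simp only [Matrix.mul_assoc]

/-- The twisted Frobenius on `E_V`. -/
def frobRep {ν : Q.DimVec} (x : Rep p ν) : Rep p ν :=
  frobFam p r Q.aE (tgt_inv ν) (src_inv ν) x

/-- The twisted Frobenius on families of square matrices indexed by the vertices. -/
def frobEnd {ν : Q.DimVec} (z : Fam p ν.1 ν.1) : Fam p ν.1 ν.1 :=
  frobFam p r Q.aV ν.2 ν.2 z

theorem frobEnd_mul {ν : Q.DimVec} (z y : Fam p ν.1 ν.1) (i : I) :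
    frobEnd r (fun i => z i * y i) i = frobEnd r z i * frobEnd r y i :=
  congrFun (frobFam_mul p r Q.aV ν.2 ν.2 ν.2 z y) i

theorem frobEnd_one {ν : Q.DimVec} :
    frobEnd r (fun _ => 1 : Fam p ν.1 ν.1) = fun _ => 1 := by
  funext i
  have h : ∀ {m n : ℕ} (e e' : m = n), recast e e' (1 : Matrix (Fin m) (Fin m) (Kbar p)) = 1 := by
    intro m n e e'; subst e; rfl
  simp only [frobEnd, frobFam]
  rw [h, one_map']

/-- The twisted Frobenius on `G_V`. -/
def frobGrp {ν : Q.DimVec} (g : Grp p ν) : Grp p ν := fun i =>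
  { val := frobEnd r (fun i => (g i).1) i
    inv := frobEnd r (fun i => (g i)⁻¹.1) i
    val_inv := by
      rw [← frobEnd_mul]; simp only [Units.mul_inv]; rw [frobEnd_one]
    inv_val := by
      rw [← frobEnd_mul]; simp only [Units.inv_mul]; rw [frobEnd_one] }

theorem frobGrp_val {ν : Q.DimVec} (g : Grp p ν) (i : I) :
    (frobGrp r g i).1 = frobEnd r (fun i => (g i).1) i := rfl

theorem frobGrp_inv_val {ν : Q.DimVec} (g : Grp p ν) (i : I) :
    (frobGrp r g i)⁻¹.1 = frobEnd r (fun i => (g i)⁻¹.1) i := rfl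

theorem frobGrp_mul {ν : Q.DimVec} (g g' : Grp p ν) :
    frobGrp r (g * g') = frobGrp r g * frobGrp r g' := by
  funext i
  apply Units.ext
  exact frobEnd_mul r (fun i => (g i).1) (fun i => (g' i).1) i

theorem frobGrp_inv {ν : Q.DimVec} (g : Grp p ν) : frobGrp r g⁻¹ = (frobGrp r g)⁻¹ := by
  funext i
  apply Units.ext
  rfl

theorem frobEnd_tgt {ν : Q.DimVec} (z : Fam p ν.1 ν.1) (h : Ω)
    (e : ν.1 (Q.tgt (Q.aE.symm h)) = ν.1 (Q.tgt h)) :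
    frobEnd r z (Q.tgt h) = (recast e e (z (Q.tgt (Q.aE.symm h)))).map (Fr p r) := by
  have h1 := recast_fam z (tgt_symm (Q := Q) h) (congrArg ν.1 (tgt_symm h)) (congrArg ν.1 (tgt_symm h))
  simp only [frobEnd, frobFam]
  rw [← h1, recast_recast]

theorem frobEnd_src {ν : Q.DimVec} (z : Fam p ν.1 ν.1) (h : Ω)
    (e : ν.1 (Q.src (Q.aE.symm h)) = ν.1 (Q.src h)) :
    frobEnd r z (Q.src h) = (recast e e (z (Q.src (Q.aE.symm h)))).map (Fr p r) := by
  have h1 := recast_fam z (src_symm (Q := Q) h) (congrArg ν.1 (src_symm h)) (congrArg ν.1 (src_symm h))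
  simp only [frobEnd, frobFam]
  rw [← h1, recast_recast]

theorem frobRep_act {ν : Q.DimVec} (g : Grp p ν) (x : Rep p ν) :
    frobRep r (act g x) = act (frobGrp r g) (frobRep r x) := by
  funext h
  have e1 := eq_symm Q.aE (m := fun h => ν.1 (Q.tgt h)) (tgt_inv ν) h
  have e2 := eq_symm Q.aE (m := fun h => ν.1 (Q.src h)) (src_inv ν) h
  simp only [act, frobGrp_val, frobGrp_inv_val]
  rw [frobEnd_tgt r _ h e1, frobEnd_src r _ h e2]
  simp only [frobRep, frobFam, act]
  rw [recast_mul e1 e2 e2, recast_mul e1 e1 e2, map_mul_map, map_mul_map]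

/-! ## The decomposition `V = T ⊕ W` and the subgroups `Q` and `U` -/

variable {τ ω : Q.DimVec}

/-- `x` maps `W` into itself. -/
def Stab (x : Rep p (τ + ω)) : Prop :=
  ∀ h, blkTW (m := τ.1 (Q.tgt h)) (m' := ω.1 (Q.tgt h)) (n := τ.1 (Q.src h))
    (n' := ω.1 (Q.src h)) (x h) = 0

/-- The representation induced on the quotient `T` of `V` by `W`. -/
def quotRep (x : Rep p (τ + ω)) : Rep p τ := fun h =>
  blkTT (m := τ.1 (Q.tgt h)) (m' := ω.1 (Q.tgt h)) (n := τ.1 (Q.src h)) (n' := ω.1 (Q.src h)) (x h)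

/-- The representation induced on the subspace `W`. -/
def subRep (x : Rep p (τ + ω)) : Rep p ω := fun h =>
  blkWW (m := τ.1 (Q.tgt h)) (m' := ω.1 (Q.tgt h)) (n := τ.1 (Q.src h)) (n' := ω.1 (Q.src h)) (x h)

/-- The blocks of the `i`-th component of an element of `G_V`. -/
def gTT (g : Grp p (τ + ω)) (i : I) : Matrix (Fin (τ.1 i)) (Fin (τ.1 i)) (Kbar p) :=
  blkTT (m := τ.1 i) (m' := ω.1 i) (n := τ.1 i) (n' := ω.1 i) (g i).1

/-- The component from `W` to `T`. -/
def gTW (g : Grp p (τ + ω)) (i : I) : Matrix (Fin (τ.1 i)) (Fin (ω.1 i)) (Kbar p) :=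
  blkTW (m := τ.1 i) (m' := ω.1 i) (n := τ.1 i) (n' := ω.1 i) (g i).1

/-- The component from `W` to `W`. -/
def gWW (g : Grp p (τ + ω)) (i : I) : Matrix (Fin (ω.1 i)) (Fin (ω.1 i)) (Kbar p) :=
  blkWW (m := τ.1 i) (m' := ω.1 i) (n := τ.1 i) (n' := ω.1 i) (g i).1

theorem gTW_mul {g g' : Grp p (τ + ω)} (h : ∀ i, gTW g i = 0) (h' : ∀ i, gTW g' i = 0) (i : I) :
    gTW (g * g') i = 0 := by
  have := blkTW_mul (m := τ.1 i) (m' := ω.1 i) (n := τ.1 i) (n' := ω.1 i) (k := τ.1 i)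
    (k' := ω.1 i) (g i).1 (g' i).1
  have h1 := h i
  have h2 := h' i
  rw [gTW] at h1 h2 ⊢
  rw [h1, h2] at this
  simpa using this

theorem gTT_mul {g g' : Grp p (τ + ω)} (h : ∀ i, gTW g i = 0) (i : I) :
    gTT (g * g') i = gTT g i * gTT g' i := by
  have := blkTT_mul (m := τ.1 i) (m' := ω.1 i) (n := τ.1 i) (n' := ω.1 i) (k := τ.1 i)
    (k' := ω.1 i) (g i).1 (g' i).1
  have h1 := h i
  rw [gTW] at h1
  rw [h1] at this
  rw [Matrix.zero_mul, add_zero] at this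
  exact this

theorem gWW_mul {g g' : Grp p (τ + ω)} (h' : ∀ i, gTW g' i = 0) (i : I) :
    gWW (g * g') i = gWW g i * gWW g' i := by
  have := blkWW_mul (m := τ.1 i) (m' := ω.1 i) (n := τ.1 i) (n' := ω.1 i) (k := τ.1 i)
    (k' := ω.1 i) (g i).1 (g' i).1
  have h1 := h' i
  rw [gTW] at h1
  rw [h1] at this
  rw [Matrix.mul_zero, zero_add] at this
  exact this

theorem gTT_one (i : I) : gTT (1 : Grp p (τ + ω)) i = 1 := blkTT_one

theorem gTW_one (i : I) : gTW (1 : Grp p (τ + ω)) i = 0 := blkTW_one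

theorem gWW_one (i : I) : gWW (1 : Grp p (τ + ω)) i = 1 := blkWW_one

variable (p τ ω)

/-- The stabilizer of `W` in `G_V`: the elements `g` such that both `g` and its inverse
map `W` into `W`. -/
def parab : Subgroup (Grp p (τ + ω)) where
  carrier := {g | (∀ i, gTW g i = 0) ∧ ∀ i, gTW g⁻¹ i = 0}
  one_mem' := ⟨gTW_one, by rw [inv_one]; exact gTW_one⟩
  mul_mem' := fun {g g'} h h' => ⟨gTW_mul h.1 h'.1, by rw [mul_inv_rev]; exact gTW_mul h'.2 h.2⟩
  inv_mem' := fun {g} h => ⟨h.2, by rw [inv_inv]; exact h.1⟩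

/-- The unipotent radical of `parab`: the kernel of the map to `G_T × G_W`. -/
def unip : Subgroup (Grp p (τ + ω)) where
  carrier := {g | g ∈ parab p τ ω ∧ (∀ i, gTT g i = 1) ∧ ∀ i, gWW g i = 1}
  one_mem' := ⟨one_mem _, gTT_one, gWW_one⟩
  mul_mem' := fun {g g'} h h' => ⟨mul_mem h.1 h'.1,
    fun i => by rw [gTT_mul h.1.1, h.2.1, h'.2.1, Matrix.one_mul],
    fun i => by rw [gWW_mul h'.1.1, h.2.2, h'.2.2, Matrix.one_mul]⟩
  inv_mem' := fun {g} h => ⟨inv_mem h.1,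
    fun i => by
      have := gTT_mul (g' := g⁻¹) h.1.1 i
      rwa [mul_inv_cancel, gTT_one, h.2.1, Matrix.one_mul, eq_comm] at this,
    fun i => by
      have := gWW_mul (g' := g) (g := g⁻¹) h.1.1 i
      rwa [inv_mul_cancel, gWW_one, h.2.2, Matrix.mul_one, eq_comm] at this⟩

variable {p τ ω}

theorem unip_le : unip p τ ω ≤ parab p τ ω := fun _ h => h.1

theorem recast_blk {m m' n n' k k' l l' : ℕ} (e1 : m = k) (e2 : m' = k') (e3 : n = l)
    (e4 : n' = l') (e5 : m + m' = k + k') (e6 : n + n' = l + l')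
    (x : Matrix (Fin (m + m')) (Fin (n + n')) (Kbar p)) :
    blkTT ((recast e5 e6 x).map (Fr p r)) = (recast e1 e3 (blkTT x)).map (Fr p r) ∧
    blkTW ((recast e5 e6 x).map (Fr p r)) = (recast e1 e4 (blkTW x)).map (Fr p r) ∧
    blkWW ((recast e5 e6 x).map (Fr p r)) = (recast e2 e4 (blkWW x)).map (Fr p r) := by
  subst e1 e2 e3 e4
  exact ⟨rfl, rfl, rfl⟩

theorem recast_zero_map {m m' n n' : ℕ} (hm : m = m') (hn : n = n') :
    (recast hm hn (0 : Matrix (Fin m) (Fin n) (Kbar p))).map (Fr p r) = 0 := by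
  subst hm hn
  ext; simp

theorem recast_one_map {m m' : ℕ} (hm hm' : m = m') :
    (recast hm hm' (1 : Matrix (Fin m) (Fin m) (Kbar p))).map (Fr p r) = 1 := by
  subst hm
  exact one_map' _

theorem frobGrp_blk (g : Grp p (τ + ω)) (i : I) :
    gTT (frobGrp r g) i = (recast (eq_symm Q.aV τ.2 i) (eq_symm Q.aV τ.2 i)
      (gTT g (Q.aV.symm i))).map (Fr p r) ∧
    gTW (frobGrp r g) i = (recast (eq_symm Q.aV τ.2 i) (eq_symm Q.aV ω.2 i)
      (gTW g (Q.aV.symm i))).map (Fr p r) ∧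
    gWW (frobGrp r g) i = (recast (eq_symm Q.aV ω.2 i) (eq_symm Q.aV ω.2 i)
      (gWW g (Q.aV.symm i))).map (Fr p r) :=
  recast_blk r (eq_symm Q.aV τ.2 i) (eq_symm Q.aV ω.2 i) (eq_symm Q.aV τ.2 i)
    (eq_symm Q.aV ω.2 i) _ _ _

theorem frobGrp_parab {g : Grp p (τ + ω)} (h : g ∈ parab p τ ω) :
    frobGrp r g ∈ parab p τ ω := by
  refine ⟨fun i => ?_, fun i => ?_⟩
  · rw [(frobGrp_blk r g i).2.1, h.1, recast_zero_map]
  · rw [← frobGrp_inv, (frobGrp_blk r g⁻¹ i).2.1, h.2, recast_zero_map]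

theorem frobGrp_unip {g : Grp p (τ + ω)} (h : g ∈ unip p τ ω) :
    frobGrp r g ∈ unip p τ ω := by
  refine ⟨frobGrp_parab r h.1, fun i => ?_, fun i => ?_⟩
  · rw [(frobGrp_blk r g i).1, h.2.1, recast_one_map]
  · rw [(frobGrp_blk r g i).2.2, h.2.2, recast_one_map]

theorem frobRep_blk (x : Rep p (τ + ω)) (h : Ω) :
    quotRep (frobRep r x) h = frobRep r (quotRep x) h ∧
    (blkTW (m := τ.1 (Q.tgt h)) (m' := ω.1 (Q.tgt h)) (n := τ.1 (Q.src h))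
      (n' := ω.1 (Q.src h)) (frobRep r x h) =
        (recast (eq_symm Q.aE (m := fun h => τ.1 (Q.tgt h)) (tgt_inv τ) h)
          (eq_symm Q.aE (m := fun h => ω.1 (Q.src h)) (src_inv ω) h)
          (blkTW (m := τ.1 (Q.tgt (Q.aE.symm h))) (m' := ω.1 (Q.tgt (Q.aE.symm h)))
            (n := τ.1 (Q.src (Q.aE.symm h))) (n' := ω.1 (Q.src (Q.aE.symm h)))
            (x (Q.aE.symm h)))).map (Fr p r)) ∧
    subRep (frobRep r x) h = frobRep r (subRep x) h :=
  recast_blk r (eq_symm Q.aE (m := fun h => τ.1 (Q.tgt h)) (tgt_inv τ) h)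
    (eq_symm Q.aE (m := fun h => ω.1 (Q.tgt h)) (tgt_inv ω) h)
    (eq_symm Q.aE (m := fun h => τ.1 (Q.src h)) (src_inv τ) h)
    (eq_symm Q.aE (m := fun h => ω.1 (Q.src h)) (src_inv ω) h) _ _ _

theorem frobRep_stab {x : Rep p (τ + ω)} (hx : Stab x) : Stab (frobRep r x) := by
  intro h
  rw [(frobRep_blk r x h).2.1, hx, recast_zero_map]

theorem quotRep_frob (x : Rep p (τ + ω)) : quotRep (frobRep r x) = frobRep r (quotRep x) :=
  funext fun h => (frobRep_blk r x h).1

theorem subRep_frob (x : Rep p (τ + ω)) : subRep (frobRep r x) = frobRep r (subRep x) :=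
  funext fun h => (frobRep_blk r x h).2.2

/-- Elements of `U` change neither the sub- nor the quotient representation. -/
theorem act_unip {b : Grp p (τ + ω)} (hb : b ∈ unip p τ ω) {x : Rep p (τ + ω)} (hx : Stab x) :
    quotRep (act b x) = quotRep x ∧ subRep (act b x) = subRep x := by
  have hb' := inv_mem hb
  constructor
  · funext h
    have e1 := blkTT_mul (m := τ.1 (Q.tgt h)) (m' := ω.1 (Q.tgt h)) (n := τ.1 (Q.src h))
      (n' := ω.1 (Q.src h)) (k := τ.1 (Q.src h)) (k' := ω.1 (Q.src h))
      ((b (Q.tgt h)).1 * x h) (b (Q.src h))⁻¹.1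
    have e2 := blkTT_mul (m := τ.1 (Q.tgt h)) (m' := ω.1 (Q.tgt h)) (n := τ.1 (Q.tgt h))
      (n' := ω.1 (Q.tgt h)) (k := τ.1 (Q.src h)) (k' := ω.1 (Q.src h)) (b (Q.tgt h)).1 (x h)
    have e3 := blkTW_mul (m := τ.1 (Q.tgt h)) (m' := ω.1 (Q.tgt h)) (n := τ.1 (Q.tgt h))
      (n' := ω.1 (Q.tgt h)) (k := τ.1 (Q.src h)) (k' := ω.1 (Q.src h)) (b (Q.tgt h)).1 (x h)
    have a1 := hb.1.1 (Q.tgt h)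
    have a2 := hb.2.1 (Q.tgt h)
    have a3 := hb'.2.1 (Q.src h)
    have a4 := hx h
    rw [gTW] at a1
    rw [gTT] at a2 a3
    rw [a1, a2, Matrix.one_mul, Matrix.zero_mul, add_zero] at e2
    rw [a1, a4, Matrix.mul_zero, Matrix.zero_mul, add_zero] at e3
    refine e1.trans ?_
    rw [e2, e3, Matrix.zero_mul, add_zero]
    refine (congrArg _ a3).trans (Matrix.mul_one _)
  · funext h
    have e1 := blkWW_mul (m := τ.1 (Q.tgt h)) (m' := ω.1 (Q.tgt h)) (n := τ.1 (Q.src h))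
      (n' := ω.1 (Q.src h)) (k := τ.1 (Q.src h)) (k' := ω.1 (Q.src h))
      ((b (Q.tgt h)).1 * x h) (b (Q.src h))⁻¹.1
    have e2 := blkWW_mul (m := τ.1 (Q.tgt h)) (m' := ω.1 (Q.tgt h)) (n := τ.1 (Q.tgt h))
      (n' := ω.1 (Q.tgt h)) (k := τ.1 (Q.src h)) (k' := ω.1 (Q.src h)) (b (Q.tgt h)).1 (x h)
    have a1 := hb'.1.1 (Q.src h)
    have a2 := hb.2.2 (Q.tgt h)
    have a3 := hb'.2.2 (Q.src h)
    have a4 := hx h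
    rw [gTW] at a1
    rw [gWW] at a2 a3
    rw [a4, a2, Matrix.mul_zero, Matrix.one_mul, zero_add] at e2
    refine e1.trans ?_
    rw [e2]
    refine (congrArg₂ (· + ·) ((congrArg _ a1).trans (Matrix.mul_zero _))
      ((congrArg _ a3).trans (Matrix.mul_one _))).trans (zero_add _)

/-! ## Functions on the rational points of invariant loci -/

/-- The points of `X ⊆ E_V` that are fixed by the twisted Frobenius. -/
abbrev Pts {ν : Q.DimVec} (X : Set (Rep p ν)) : Type w := {x : Rep p ν // x ∈ X ∧ frobRep r x = x}

/-- The functions on the rational points of `X` that are invariant under the rational points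
of `G_V`. -/
def InvFun (k : Type*) [Field k] {ν : Q.DimVec} (X : Set (Rep p ν)) :
    Submodule k (Pts r X → k) where
  carrier := {f | ∀ g : Grp p ν, frobGrp r g = g → ∀ x y : Pts r X, y.1 = act g x.1 → f y = f x}
  zero_mem' := fun _ _ _ _ _ => rfl
  add_mem' := fun {f f'} hf hf' g hg x y h => by
    simp only [Pi.add_apply]; rw [hf g hg x y h, hf' g hg x y h]
  smul_mem' := fun c f hf g hg x y h => by
    simp only [Pi.smul_apply]; rw [hf g hg x y h]

/-- A locus: for each dimension vector in `D`, a subset of `E_V` that is stable under `G_V` and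
the twisted Frobenius, and such that the diagram of the induction restricts to it. -/
structure Locus (Q : AutQuiver I Ω) (p r : ℕ) [Fact p.Prime] (D : AddSubmonoid Q.DimVec) where
  carrier : ∀ ν : D, Set (Rep p ν.1)
  act_mem : ∀ (ν : D) (g : Grp p ν.1) (x : Rep p ν.1), x ∈ carrier ν → act g x ∈ carrier ν
  frob_mem : ∀ (ν : D) (x : Rep p ν.1), x ∈ carrier ν → frobRep r x ∈ carrier ν
  blk_mem : ∀ (τ ω : D) (x : Rep p (τ.1 + ω.1)), x ∈ carrier (τ + ω) → Stab x →
    quotRep x ∈ carrier τ ∧ subRep x ∈ carrier ω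

/-- The whole representation spaces. -/
def fullLocus (Q : AutQuiver I Ω) (p r : ℕ) [Fact p.Prime] (D : AddSubmonoid Q.DimVec) :
    Locus Q p r D where
  carrier := fun _ => Set.univ
  act_mem := fun _ _ _ _ => trivial
  frob_mem := fun _ _ _ => trivial
  blk_mem := fun _ _ _ _ _ => ⟨trivial, trivial⟩

/-- Push-forward of functions along a map of finite sets. -/
def push {k : Type*} [Field k] {X Y : Type*} (φ : X → Y) (f : X → k) (y : Y) : k :=
  ∑ᶠ x ∈ φ ⁻¹' {y}, f x

section push

variable {k : Type*} [Field k] {X Y : Type*} {φ : X → Y}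

theorem push_add {f f' : X → k} (hf : f.support.Finite) (hf' : f'.support.Finite) :
    push φ (f + f') = push φ f + push φ f' := by
  funext y
  exact finsum_mem_add_distrib' (hf.inter_of_right _) (hf'.inter_of_right _)

theorem push_smul (c : k) (f : X → k) : push φ (c • f) = c • push φ f := by
  funext y
  simp only [push, Pi.smul_apply, smul_eq_mul, mul_finsum_mem]

theorem push_support {f : X → k} (hf : f.support.Finite) : (push φ f).support.Finite := by
  refine (hf.image φ).subset fun y hy => ?_
  obtain ⟨x, hx, hx'⟩ := exists_ne_zero_of_finsum_mem_ne_zero hy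
  exact ⟨x, hx', hx⟩

theorem push_inv {f : X → k} (σ : X → X) (hσ : σ.Bijective) (ρ : Y → Y) (hρ : ρ.Injective)
    (h : ∀ x, φ (σ x) = ρ (φ x)) (hf : ∀ x, f (σ x) = f x) (y : Y) :
    push φ f (ρ y) = push φ f y := by
  refine (finsum_mem_eq_of_bijOn σ ⟨?_, hσ.1.injOn, ?_⟩ fun x _ => (hf x).symm).symm
  · intro x hx
    simp only [Set.mem_preimage, Set.mem_singleton_iff] at hx ⊢
    rw [h, hx]
  · intro x hx
    obtain ⟨x, rfl⟩ := hσ.2 x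
    refine ⟨x, ?_, rfl⟩
    simp only [Set.mem_preimage, Set.mem_singleton_iff] at hx ⊢
    exact hρ ((h x).symm.trans hx)

end push

/-! ## The induction diagram -/

namespace Locus

variable {r}
variable {D : AddSubmonoid Q.DimVec} (L : Locus Q p r D) (τ ω : D)

/-- The elements of the locus that leave `W` invariant. -/
abbrev SW : Type w := {x : Rep p (τ.1 + ω.1) // Stab x ∧ x ∈ L.carrier (τ + ω)}

/-- The set `G_V × S_W`. -/
abbrev Pre : Type (max u w) := Grp p (τ.1 + ω.1) × L.SW τ ω

variable {τ ω}

/-- The equivalence relation of the action `b • (g, x) = (g b⁻¹, b • x)` of a subgroup `B`. -/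
def indSetoid (B : Subgroup (Grp p (τ.1 + ω.1))) : Setoid (L.Pre τ ω) where
  r y z := ∃ b ∈ B, z.1 = y.1 * b⁻¹ ∧ z.2.1 = act b y.2.1
  iseqv :=
    { refl := fun y => ⟨1, one_mem _, by simp, (act_one _).symm⟩
      symm := by
        rintro y z ⟨b, hb, h1, h2⟩
        exact ⟨b⁻¹, inv_mem hb, by rw [h1]; simp, by
          rw [h2, ← act_mul, inv_mul_cancel, act_one]⟩
      trans := by
        rintro y z t ⟨b, hb, h1, h2⟩ ⟨b', hb', h3, h4⟩
        exact ⟨b' * b, mul_mem hb' hb, by rw [h3, h1, mul_inv_rev, mul_assoc], by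
          rw [h4, h2, ← act_mul]⟩ }

/-- The set of orbits of `B` on `G_V × S_W`. -/
abbrev Ind (B : Subgroup (Grp p (τ.1 + ω.1))) : Type (max u w) := Quotient (L.indSetoid B)

/-- The twisted Frobenius on `G_V × S_W`. -/
def frobPre (y : L.Pre τ ω) : L.Pre τ ω :=
  (frobGrp r y.1, ⟨frobRep r y.2.1, frobRep_stab r y.2.2.1, L.frob_mem _ _ y.2.2.2⟩)

/-- The twisted Frobenius on the set of orbits. -/
def frobInd (B : Subgroup (Grp p (τ.1 + ω.1))) (hB : ∀ b ∈ B, frobGrp r b ∈ B) :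
    L.Ind B → L.Ind B :=
  Quotient.map L.frobPre (by
    rintro y z ⟨b, hb, h1, h2⟩
    exact ⟨frobGrp r b, hB b hb, by
      simp only [frobPre]; rw [h1, frobGrp_mul, frobGrp_inv], by
      simp only [frobPre]; rw [h2, frobRep_act]⟩)

/-- Left translation by `g` on the set of orbits. -/
def trInd (B : Subgroup (Grp p (τ.1 + ω.1))) (g : Grp p (τ.1 + ω.1)) : L.Ind B → L.Ind B :=
  Quotient.map (fun y => (g * y.1, y.2)) (by
    rintro y z ⟨b, hb, h1, h2⟩
    exact ⟨b, hb, by simp only; rw [h1, mul_assoc], h2⟩)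

theorem trInd_mul (B : Subgroup (Grp p (τ.1 + ω.1))) (g g' : Grp p (τ.1 + ω.1)) (y : L.Ind B) :
    L.trInd B g (L.trInd B g' y) = L.trInd B (g * g') y := by
  induction y using Quotient.inductionOn with
  | h y => simp only [trInd, Quotient.map_mk]; rw [mul_assoc]

theorem trInd_one (B : Subgroup (Grp p (τ.1 + ω.1))) (y : L.Ind B) :
    L.trInd B 1 y = y := by
  induction y using Quotient.inductionOn with
  | h y => simp only [trInd, Quotient.map_mk, one_mul]

theorem trInd_frob (B : Subgroup (Grp p (τ.1 + ω.1))) (hB : ∀ b ∈ B, frobGrp r b ∈ B)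
    (g : Grp p (τ.1 + ω.1)) (y : L.Ind B) :
    L.frobInd B hB (L.trInd B g y) = L.trInd B (frobGrp r g) (L.frobInd B hB y) := by
  induction y using Quotient.inductionOn with
  | h y => simp only [trInd, frobInd, Quotient.map_mk, frobPre]; rw [frobGrp_mul]

variable (τ ω)

/-- The points of `E' = U \ (G_V × S_W)` fixed by the twisted Frobenius. -/
abbrev E1F : Type (max u w) :=
  {y : L.Ind (unip p τ.1 ω.1) // L.frobInd _ (fun _ => frobGrp_unip r) y = y}

/-- The points of `E'' = Q \ (G_V × S_W)` fixed by the twisted Frobenius. -/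
abbrev E2F : Type (max u w) :=
  {y : L.Ind (parab p τ.1 ω.1) // L.frobInd _ (fun _ => frobGrp_parab r) y = y}

variable {τ ω}

/-- The first component of `p₁`, before passing to fixed points. -/
def preT : L.Ind (unip p τ.1 ω.1) → Rep p τ.1 :=
  Quotient.lift (fun y => quotRep y.2.1) (by
    rintro y z ⟨b, hb, -, h2⟩
    rw [h2, (act_unip hb y.2.2.1).1])

/-- The second component of `p₁`, before passing to fixed points. -/
def preW : L.Ind (unip p τ.1 ω.1) → Rep p ω.1 :=
  Quotient.lift (fun y => subRep y.2.1) (by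
    rintro y z ⟨b, hb, -, h2⟩
    rw [h2, (act_unip hb y.2.2.1).2])

theorem pre_mem (y : L.Ind (unip p τ.1 ω.1)) :
    L.preT y ∈ L.carrier τ ∧ L.preW y ∈ L.carrier ω := by
  induction y using Quotient.inductionOn with
  | h y => exact L.blk_mem τ ω y.2.1 y.2.2.2 y.2.2.1

theorem pre_frob (y : L.Ind (unip p τ.1 ω.1)) :
    L.preT (L.frobInd _ (fun _ => frobGrp_unip r) y) = frobRep r (L.preT y) ∧
    L.preW (L.frobInd _ (fun _ => frobGrp_unip r) y) = frobRep r (L.preW y) := by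
  induction y using Quotient.inductionOn with
  | h y => exact ⟨quotRep_frob r y.2.1, subRep_frob r y.2.1⟩

/-- The map `p₁ : [g, x] ↦ (x^T, x^W)`. -/
def p1 (y : L.E1F τ ω) : Pts r (L.carrier τ) × Pts r (L.carrier ω) :=
  (⟨L.preT y.1, (L.pre_mem y.1).1, by rw [← (L.pre_frob y.1).1, y.2]⟩,
    ⟨L.preW y.1, (L.pre_mem y.1).2, by rw [← (L.pre_frob y.1).2, y.2]⟩)

/-- The projection from the `U`-orbits to the `Q`-orbits. -/
def proj : L.Ind (unip p τ.1 ω.1) → L.Ind (parab p τ.1 ω.1) :=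
  Quotient.map id (by
    rintro y z ⟨b, hb, h⟩
    exact ⟨b, unip_le hb, h⟩)

theorem proj_frob (y : L.Ind (unip p τ.1 ω.1)) :
    L.frobInd _ (fun _ => frobGrp_parab r) (L.proj y) =
      L.proj (L.frobInd _ (fun _ => frobGrp_unip r) y) := by
  induction y using Quotient.inductionOn with
  | h y => rfl

/-- The map `p₂`, sending a `U`-orbit to its `Q`-orbit. -/
def p2 (y : L.E1F τ ω) : L.E2F τ ω := ⟨L.proj y.1, by rw [proj_frob, y.2]⟩

/-- The map `[g, x] ↦ g • x` on the orbits of any subgroup. -/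
def ev (B : Subgroup (Grp p (τ.1 + ω.1))) : L.Ind B → Rep p (τ.1 + ω.1) :=
  Quotient.lift (fun y => act y.1 y.2.1) (by
    rintro y z ⟨b, hb, h1, h2⟩
    rw [h1, h2, ← act_mul, inv_mul_cancel_right])

theorem ev_mem (B : Subgroup (Grp p (τ.1 + ω.1))) (y : L.Ind B) :
    L.ev B y ∈ L.carrier (τ + ω) := by
  induction y using Quotient.inductionOn with
  | h y => exact L.act_mem (τ + ω) y.1 y.2.1 y.2.2.2

theorem ev_frob (B : Subgroup (Grp p (τ.1 + ω.1))) (hB : ∀ b ∈ B, frobGrp r b ∈ B)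
    (y : L.Ind B) : L.ev B (L.frobInd B hB y) = frobRep r (L.ev B y) := by
  induction y using Quotient.inductionOn with
  | h y => exact (frobRep_act r y.1 y.2.1).symm

theorem ev_tr (B : Subgroup (Grp p (τ.1 + ω.1))) (g : Grp p (τ.1 + ω.1)) (y : L.Ind B) :
    L.ev B (L.trInd B g y) = act g (L.ev B y) := by
  induction y using Quotient.inductionOn with
  | h y => exact act_mul g y.1 y.2.1

/-- The map `p₃ : [g, x] ↦ g • x`. -/
def p3 (y : L.E2F τ ω) : Pts r (L.carrier (τ + ω)) :=
  ⟨L.ev _ y.1, L.ev_mem _ y.1, (L.ev_frob _ _ y.1).symm.trans (congrArg (L.ev _) y.2)⟩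

/-- The restriction to `W`. -/
def colW {N m m' : ℕ} (g : Matrix (Fin N) (Fin (m + m')) (Kbar p)) :
    Matrix (Fin N) (Fin m') (Kbar p) := g.submatrix id (Fin.natAdd m)

/-- The composite with the projection to `T`. -/
def rowT {N m m' : ℕ} (g : Matrix (Fin (m + m')) (Fin N) (Kbar p)) :
    Matrix (Fin m) (Fin N) (Kbar p) := g.submatrix (Fin.castAdd m') id

theorem colW_mul {N M m m' : ℕ} (g : Matrix (Fin N) (Fin M) (Kbar p))
    (c : Matrix (Fin M) (Fin (m + m')) (Kbar p)) : colW (g * c) = g * colW c := rfl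

theorem rowT_mul {N M m m' : ℕ} (c : Matrix (Fin (m + m')) (Fin M) (Kbar p))
    (g : Matrix (Fin M) (Fin N) (Kbar p)) : rowT (c * g) = rowT c * g := rfl

theorem colW_eq_one {m m' : ℕ} {c : Matrix (Fin (m + m')) (Fin (m + m')) (Kbar p)} :
    colW c = colW (m := m) (m' := m') 1 ↔ blkTW c = 0 ∧ blkWW c = 1 := by
  constructor
  · intro h
    exact ⟨(congrArg (fun z => z.submatrix (Fin.castAdd m') id) h).trans blkTW_one,
      (congrArg (fun z => z.submatrix (Fin.natAdd m) id) h).trans blkWW_one⟩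
  · rintro ⟨h1, h2⟩
    ext i j
    refine Fin.addCases (fun i => ?_) (fun i => ?_) i
    · exact congrFun (congrFun (h1.trans blkTW_one.symm) i) j
    · exact congrFun (congrFun (h2.trans blkWW_one.symm) i) j

theorem rowT_eq_one {m m' : ℕ} {c : Matrix (Fin (m + m')) (Fin (m + m')) (Kbar p)} :
    rowT c = rowT (m := m) (m' := m') 1 ↔ blkTT c = 1 ∧ blkTW c = 0 := by
  constructor
  · intro h
    exact ⟨(congrArg (fun z => z.submatrix id (Fin.castAdd m')) h).trans blkTT_one,
      (congrArg (fun z => z.submatrix id (Fin.natAdd m)) h).trans blkTW_one⟩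
  · rintro ⟨h1, h2⟩
    ext i j
    refine Fin.addCases (fun j => ?_) (fun j => ?_) j
    · exact congrFun (congrFun (h1.trans blkTT_one.symm) i) j
    · exact congrFun (congrFun (h2.trans blkTW_one.symm) i) j

theorem colW_recast {k k' l l' : ℕ} (e1 : k = l) (e2 : k' = l') (e3 e4 : k + k' = l + l')
    (x : Matrix (Fin (k + k')) (Fin (k + k')) (Kbar p)) :
    colW ((recast e3 e4 x).map (Fr p r)) = (recast e3 e2 (colW x)).map (Fr p r) ∧
    rowT ((recast e3 e4 x).map (Fr p r)) = (recast e1 e4 (rowT x)).map (Fr p r) := by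
  subst e1 e2; exact ⟨rfl, rfl⟩

/-- The restriction of `g` to `W`, as a function of the orbit `[g, x]`. -/
def famA : L.Ind (unip p τ.1 ω.1) → Fam p (τ.1 + ω.1).1 ω.1.1 := Quotient.lift
  (fun y i => colW (m := τ.1.1 i) (m' := ω.1.1 i) (y.1 i).1) (by
    rintro y z ⟨b, hb, h1, -⟩
    have hb' := inv_mem hb
    funext i
    have : colW (m := τ.1.1 i) (m' := ω.1.1 i) ((b⁻¹) i).1 = colW (m := τ.1.1 i) (m' := ω.1.1 i) 1 :=
      colW_eq_one.2 ⟨hb'.1.1 i, hb'.2.2 i⟩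
    have e : (z.1 i).1 = (y.1 i).1 * ((b⁻¹) i).1 := by rw [h1]; rfl
    simp only [e]
    refine Eq.symm ((colW_mul (m := τ.1.1 i) (m' := ω.1.1 i) _ _).trans ?_)
    rw [this, ← colW_mul, Matrix.mul_one])

/-- The composite of `g⁻¹` with the projection to `T`, as a function of the orbit `[g, x]`. -/
def famB : L.Ind (unip p τ.1 ω.1) → Fam p τ.1.1 (τ.1 + ω.1).1 := Quotient.lift
  (fun y i => rowT (m := τ.1.1 i) (m' := ω.1.1 i) (y.1 i)⁻¹.1) (by
    rintro y z ⟨b, hb, h1, -⟩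
    funext i
    have : rowT (m := τ.1.1 i) (m' := ω.1.1 i) (b i).1 = rowT (m := τ.1.1 i) (m' := ω.1.1 i) 1 :=
      rowT_eq_one.2 ⟨hb.2.1 i, hb.1.1 i⟩
    have e : (z.1 i)⁻¹.1 = (b i).1 * (y.1 i)⁻¹.1 := by rw [h1]; simp
    simp only [e]
    refine Eq.symm ((rowT_mul (m := τ.1.1 i) (m' := ω.1.1 i) _ _).trans ?_)
    rw [this, ← rowT_mul, Matrix.one_mul])

theorem fam_frob (y : L.Ind (unip p τ.1 ω.1)) :
    L.famA (L.frobInd _ (fun _ => frobGrp_unip r) y) =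
      frobFam p r Q.aV (τ.1 + ω.1).2 ω.1.2 (L.famA y) ∧
    L.famB (L.frobInd _ (fun _ => frobGrp_unip r) y) =
      frobFam p r Q.aV τ.1.2 (τ.1 + ω.1).2 (L.famB y) := by
  induction y using Quotient.inductionOn with
  | h y =>
    constructor
    · funext i
      exact (colW_recast (eq_symm Q.aV τ.1.2 i) (eq_symm Q.aV ω.1.2 i) _ _ _).1
    · funext i
      exact (colW_recast (eq_symm Q.aV τ.1.2 i) (eq_symm Q.aV ω.1.2 i) _ _ _).2

theorem fam_inj (y z : L.Ind (unip p τ.1 ω.1)) (h1 : L.ev _ y = L.ev _ z)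
    (h2 : L.famA y = L.famA z) (h3 : L.famB y = L.famB z) : y = z := by
  induction y using Quotient.inductionOn with
  | h y =>
  induction z using Quotient.inductionOn with
  | h z =>
  have key : ∀ y z : L.Pre τ ω,
      L.famA (Quotient.mk _ y) = L.famA (Quotient.mk _ z) →
      L.famB (Quotient.mk _ y) = L.famB (Quotient.mk _ z) → ∀ i,
      gTT (z.1⁻¹ * y.1) i = 1 ∧ gTW (z.1⁻¹ * y.1) i = 0 ∧ gWW (z.1⁻¹ * y.1) i = 1 := by
    intro y z h2 h3 i
    have h2' : colW (m := τ.1.1 i) (m' := ω.1.1 i) (y.1 i).1 = colW (z.1 i).1 := congrFun h2 i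
    have h3' : rowT (m := τ.1.1 i) (m' := ω.1.1 i) (y.1 i)⁻¹.1 = rowT (z.1 i)⁻¹.1 :=
      congrFun h3 i
    have e1 : colW (m := τ.1.1 i) (m' := ω.1.1 i) ((z.1 i)⁻¹.1 * (y.1 i).1) = colW (m := τ.1.1 i) (m' := ω.1.1 i) 1 := by
      refine (colW_mul (m := τ.1.1 i) (m' := ω.1.1 i) _ _).trans ?_
      rw [h2', ← colW_mul]
      exact congrArg colW (Units.inv_mul _)
    have e2 : rowT (m := τ.1.1 i) (m' := ω.1.1 i) ((z.1 i)⁻¹.1 * (y.1 i).1) = rowT (m := τ.1.1 i) (m' := ω.1.1 i) 1 := by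
      refine (rowT_mul (m := τ.1.1 i) (m' := ω.1.1 i) _ _).trans ?_
      rw [← h3', ← rowT_mul]
      exact congrArg rowT (Units.inv_mul _)
    exact ⟨(rowT_eq_one.1 e2).1, (colW_eq_one.1 e1).1, (colW_eq_one.1 e1).2⟩
  have k1 := key y z h2 h3
  have k2 := key z y h2.symm h3.symm
  refine Quotient.sound ⟨z.1⁻¹ * y.1, ⟨⟨fun i => (k1 i).2.1, fun i => ?_⟩, fun i => (k1 i).1,
    fun i => (k1 i).2.2⟩, by simp, ?_⟩
  · rw [mul_inv_rev, inv_inv]; exact (k2 i).2.1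
  · have h1' : act y.1 y.2.1 = act z.1 z.2.1 := h1
    rw [act_mul, h1', ← act_mul, inv_mul_cancel, act_one]

/-- There are finitely many rational points in `E'`: an orbit `[g, x]` is determined by
`g • x`, the restriction of `g` to `W` and the composite of `g⁻¹` with the projection to `T`. -/
theorem finite_E1F [Finite I] [Finite Ω] [NeZero r] : Finite (L.E1F τ ω) := by
  have f1 : Finite {z : Rep p (τ.1 + ω.1) // frobRep r z = z} := finite_frobFam p r Q.aE (m := fun h => (τ.1 + ω.1).1 (Q.tgt h))
    (n := fun h => (τ.1 + ω.1).1 (Q.src h)) (tgt_inv (τ.1 + ω.1)) (src_inv (τ.1 + ω.1))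
  have f2 := finite_frobFam p r Q.aV (τ.1 + ω.1).2 ω.1.2
  have f3 := finite_frobFam p r Q.aV τ.1.2 (τ.1 + ω.1).2
  refine Finite.of_injective (fun y : L.E1F τ ω =>
    ((⟨L.ev _ y.1, (L.ev_frob _ _ y.1).symm.trans (congrArg (L.ev _) y.2)⟩,
      ⟨L.famA y.1, (L.fam_frob y.1).1.symm.trans (congrArg L.famA y.2)⟩,
      ⟨L.famB y.1, (L.fam_frob y.1).2.symm.trans (congrArg L.famB y.2)⟩) :
      {z : Rep p (τ.1 + ω.1) // frobRep r z = z} ×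
      {z // frobFam p r Q.aV (τ.1 + ω.1).2 ω.1.2 z = z} ×
      {z // frobFam p r Q.aV τ.1.2 (τ.1 + ω.1).2 z = z})) ?_
  intro y z h
  simp only [Prod.mk.injEq, Subtype.mk.injEq] at h
  exact Subtype.ext (L.fam_inj _ _ h.1 h.2.1 h.2.2)

theorem pre_tr (g : Grp p (τ.1 + ω.1)) (y : L.Ind (unip p τ.1 ω.1)) :
    L.preT (L.trInd _ g y) = L.preT y ∧ L.preW (L.trInd _ g y) = L.preW y := by
  induction y using Quotient.inductionOn with
  | h y => exact ⟨rfl, rfl⟩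

theorem proj_tr (g : Grp p (τ.1 + ω.1)) (y : L.Ind (unip p τ.1 ω.1)) :
    L.proj (L.trInd _ g y) = L.trInd _ g (L.proj y) := by
  induction y using Quotient.inductionOn with
  | h y => rfl

theorem trInd_bij (B : Subgroup (Grp p (τ.1 + ω.1))) (hB : ∀ b ∈ B, frobGrp r b ∈ B)
    (g : Grp p (τ.1 + ω.1)) (hg : frobGrp r g = g) :
    Function.Bijective (fun y : {y : L.Ind B // L.frobInd B hB y = y} =>
      (⟨L.trInd B g y.1, by rw [trInd_frob, hg, y.2]⟩ : {y : L.Ind B // L.frobInd B hB y = y})) := by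
  constructor
  · intro y z h
    have h' : L.trInd B g y.1 = L.trInd B g z.1 := congrArg Subtype.val h
    have := congrArg (L.trInd B g⁻¹) h'
    rw [trInd_mul, trInd_mul, inv_mul_cancel, trInd_one, trInd_one] at this
    exact Subtype.ext this
  · intro y
    refine ⟨⟨L.trInd B g⁻¹ y.1, by rw [trInd_frob, frobGrp_inv, hg, y.2]⟩, Subtype.ext ?_⟩
    change L.trInd B g (L.trInd B g⁻¹ y.1) = y.1
    rw [trInd_mul, mul_inv_cancel, trInd_one]

end Locus

/-! ## Hall algebras -/

/-- The exponent `m_Ω(τ, ω)`. -/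
def mExp [Fintype I] [Fintype Ω] (τ ω : Q.DimVec) : ℕ :=
  ∑ i, τ.1 i * ω.1 i + ∑ h, τ.1 (Q.src h) * ω.1 (Q.tgt h)

variable (p) in
/-- The number of rational points of `G_V`. -/
def cardG (ν : Q.DimVec) : ℕ := Nat.card {g : Grp p ν // frobGrp r g = g}

variable {r} {k : Type*} [Field k] {D : AddSubmonoid Q.DimVec}

/-- The homogeneous component of the Hall algebra of a locus. (The square root `v` of `q` is
recorded since the multiplication depends on it.) -/
def HallPart (_v : k) (L : Locus Q p r D) (ν : D) : Type _ := ↥(InvFun r k (L.carrier ν))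

instance (v : k) (L : Locus Q p r D) (ν : D) : AddCommGroup (HallPart v L ν) :=
  inferInstanceAs (AddCommGroup ↥(InvFun r k (L.carrier ν)))

instance (v : k) (L : Locus Q p r D) (ν : D) : Module k (HallPart v L ν) :=
  inferInstanceAs (Module k ↥(InvFun r k (L.carrier ν)))

/-- `(p₃)_! (p₂)_! (p₁)^* (f₁ ⊗ f₂)` as a function on the rational points of `E_V`. -/
def indFun (L : Locus Q p r D) {τ ω : D} (f₁ : Pts r (L.carrier τ) → k)
    (f₂ : Pts r (L.carrier ω) → k) : Pts r (L.carrier (τ + ω)) → k :=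
  push L.p3 (push L.p2 (fun y => f₁ (L.p1 y).1 * f₂ (L.p1 y).2))

theorem indFun_inv (L : Locus Q p r D) {τ ω : D} (f₁ : Pts r (L.carrier τ) → k)
    (f₂ : Pts r (L.carrier ω) → k) : indFun L f₁ f₂ ∈ InvFun r k (L.carrier (τ + ω)) := by
  intro g hg x y hxy
  have b1 := L.trInd_bij (unip p τ.1 ω.1) (fun _ => frobGrp_unip r) g hg
  have b2 := L.trInd_bij (parab p τ.1 ω.1) (fun _ => frobGrp_parab r) g hg
  let ρ : Pts r (L.carrier (τ + ω)) → Pts r (L.carrier (τ + ω)) := fun z =>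
    ⟨act g z.1, L.act_mem _ _ _ z.2.1, by rw [frobRep_act, hg, z.2.2]⟩
  have hρ : ρ.Injective := by
    intro z t h
    have h' : act g z.1 = act g t.1 := congrArg Subtype.val h
    have := congrArg (act g⁻¹) h'
    rw [← act_mul, ← act_mul, inv_mul_cancel, act_one, act_one] at this
    exact Subtype.ext this
  have e : y = ρ x := Subtype.ext hxy
  rw [e]
  refine push_inv _ b2 ρ hρ (fun z => Subtype.ext (L.ev_tr _ g z.1)) (fun z => ?_) x
  refine push_inv _ b1 _ b2.1 (fun t => Subtype.ext (L.proj_tr g t.1)) (fun t => ?_) z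
  have h1 : (L.p1 ⟨L.trInd _ g t.1, by rw [L.trInd_frob, hg, t.2]⟩) = L.p1 t :=
    Prod.ext (Subtype.ext (L.pre_tr g t.1).1) (Subtype.ext (L.pre_tr g t.1).2)
  simp only [h1]

section

variable [Finite I] [Finite Ω] [NeZero r]

theorem indFun_add_left (L : Locus Q p r D) {τ ω : D} (f₁ f₁' : Pts r (L.carrier τ) → k)
    (f₂ : Pts r (L.carrier ω) → k) :
    indFun L (f₁ + f₁') f₂ = indFun L f₁ f₂ + indFun L f₁' f₂ := by
  have := L.finite_E1F (τ := τ) (ω := ω)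
  simp only [indFun, Pi.add_apply, add_mul]
  rw [← push_add (push_support (Set.toFinite _)) (push_support (Set.toFinite _)),
    ← push_add (Set.toFinite _) (Set.toFinite _)]
  rfl

theorem indFun_add_right (L : Locus Q p r D) {τ ω : D} (f₁ : Pts r (L.carrier τ) → k)
    (f₂ f₂' : Pts r (L.carrier ω) → k) :
    indFun L f₁ (f₂ + f₂') = indFun L f₁ f₂ + indFun L f₁ f₂' := by
  have := L.finite_E1F (τ := τ) (ω := ω)
  simp only [indFun, Pi.add_apply, mul_add]
  rw [← push_add (push_support (Set.toFinite _)) (push_support (Set.toFinite _)),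
    ← push_add (Set.toFinite _) (Set.toFinite _)]
  rfl

end

theorem indFun_smul_left (L : Locus Q p r D) {τ ω : D} (c : k) (f₁ : Pts r (L.carrier τ) → k)
    (f₂ : Pts r (L.carrier ω) → k) : indFun L (c • f₁) f₂ = c • indFun L f₁ f₂ := by
  rw [indFun, indFun, ← push_smul, ← push_smul]
  simp only [Pi.smul_apply, smul_eq_mul, mul_assoc]
  rfl

theorem indFun_smul_right (L : Locus Q p r D) {τ ω : D} (c : k) (f₁ : Pts r (L.carrier τ) → k)
    (f₂ : Pts r (L.carrier ω) → k) : indFun L f₁ (c • f₂) = c • indFun L f₁ f₂ := by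
  rw [indFun, indFun, ← push_smul, ← push_smul]
  simp only [Pi.smul_apply, smul_eq_mul, mul_left_comm _ c]
  rfl

section

variable [Fintype I] [Fintype Ω]

/-- The multiplication `Ind = v ^ (- m_Ω(τ, ω)) (#G_T #G_W)⁻¹ (p₃)_! (p₂)_! (p₁)^*`. -/
def hallMul (v : k) (L : Locus Q p r D) {τ ω : D} (f₁ : HallPart v L τ) (f₂ : HallPart v L ω) :
    HallPart v L (τ + ω) :=
  ⟨(v⁻¹ ^ mExp τ.1 ω.1 * ((cardG p r τ.1 * cardG p r ω.1 : ℕ) : k)⁻¹) • indFun L f₁.1 f₂.1,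
    Submodule.smul_mem _ _ (indFun_inv L f₁.1 f₂.1)⟩

instance [NeZero r] (v : k) (L : Locus Q p r D) :
    DirectSum.GNonUnitalNonAssocSemiring (HallPart v L) where
  mul := hallMul v L
  mul_zero := fun {τ ω} a => by
    have h := indFun_smul_right L (0 : k) a.1 (0 : HallPart v L ω).1
    rw [zero_smul, zero_smul] at h
    refine Subtype.ext ?_
    change _ • indFun L a.1 0 = 0
    rw [h, smul_zero]
  zero_mul := fun {τ ω} a => by
    have h := indFun_smul_left L (0 : k) (0 : HallPart v L τ).1 a.1
    rw [zero_smul, zero_smul] at h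
    refine Subtype.ext ?_
    change _ • indFun L 0 a.1 = 0
    rw [h, smul_zero]
  mul_add := fun {τ ω} a b c => by
    refine Subtype.ext ?_
    change _ • indFun L a.1 (b.1 + c.1) = _ • indFun L a.1 b.1 + _ • indFun L a.1 c.1
    rw [indFun_add_right, smul_add]
  add_mul := fun {τ ω} a b c => by
    refine Subtype.ext ?_
    change _ • indFun L (a.1 + b.1) c.1 = _ • indFun L a.1 c.1 + _ • indFun L b.1 c.1
    rw [indFun_add_left, smul_add]

/-- The unit: the function with value `1` in dimension `0`. -/
instance (v : k) (L : Locus Q p r D) : GradedMonoid.GOne (HallPart v L) where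
  one := ⟨fun _ => 1, fun _ _ _ _ _ => rfl⟩

/-- The Hall algebra of a locus. -/
abbrev Hall (v : k) (L : Locus Q p r D) : Type _ := ⨁ ν : D, HallPart v L ν

theorem hall_smul_mul [NeZero r] (v : k) (L : Locus Q p r D) (c : k) (x y : Hall v L) :
    (c • x) * y = c • (x * y) := by
  induction x using DirectSum.induction_on with
  | zero => simp
  | add x x' h h' => rw [smul_add, add_mul, add_mul, smul_add, h, h']
  | of τ a =>
    induction y using DirectSum.induction_on with
    | zero => simp
    | add x x' h h' => rw [mul_add, mul_add, smul_add, h, h']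
    | of ω b =>
      rw [← DirectSum.lof_eq_of k, ← map_smul, DirectSum.lof_eq_of, DirectSum.lof_eq_of,
        DirectSum.of_mul_of, DirectSum.of_mul_of, ← DirectSum.lof_eq_of k,
        ← DirectSum.lof_eq_of k, ← map_smul]
      congr 1
      refine Subtype.ext ?_
      change _ • indFun L (c • a.1) b.1 = c • _ • indFun L a.1 b.1
      rw [indFun_smul_left, smul_comm]

theorem hall_mul_smul [NeZero r] (v : k) (L : Locus Q p r D) (c : k) (x y : Hall v L) :
    x * (c • y) = c • (x * y) := by
  induction x using DirectSum.induction_on with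
  | zero => simp
  | add x x' h h' => rw [add_mul, add_mul, smul_add, h, h']
  | of τ a =>
    induction y using DirectSum.induction_on with
    | zero => simp
    | add x x' h h' => rw [smul_add, mul_add, mul_add, smul_add, h, h']
    | of ω b =>
      rw [← DirectSum.lof_eq_of k _ _ ω, ← map_smul, DirectSum.lof_eq_of, DirectSum.lof_eq_of,
        DirectSum.of_mul_of, DirectSum.of_mul_of, ← DirectSum.lof_eq_of k,
        ← DirectSum.lof_eq_of k, ← map_smul]
      congr 1
      refine Subtype.ext ?_
      change _ • indFun L a.1 (c • b.1) = c • _ • indFun L a.1 b.1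
      rw [indFun_smul_right, smul_comm]

instance [NeZero r] (v : k) (L : Locus Q p r D) : IsScalarTower k (Hall v L) (Hall v L) :=
  ⟨fun c x y => hall_smul_mul v L c x y⟩

instance [NeZero r] (v : k) (L : Locus Q p r D) : SMulCommClass k (Hall v L) (Hall v L) :=
  ⟨fun c x y => (hall_mul_smul v L c x y).symm⟩

end

/-! ## Restriction and extension by zero -/

/-- Extension by zero of invariant functions from a `G_V`-stable subset `X` to `E_V`. -/
def extZero {ν : Q.DimVec} (X : Set (Rep p ν)) (hX : ∀ (g : Grp p ν) x, x ∈ X → act g x ∈ X) :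
    ↥(InvFun r k X) →ₗ[k] ↥(InvFun r k (Set.univ : Set (Rep p ν))) where
  toFun f := by
    classical
    exact ⟨fun x => if h : x.1 ∈ X then f.1 ⟨x.1, h, x.2.2⟩ else 0, by
      intro g hg x y hxy
      by_cases h : x.1 ∈ X
      · have h' : y.1 ∈ X := by rw [hxy]; exact hX g _ h
        simp only [dif_pos h, dif_pos h']
        exact f.2 g hg ⟨x.1, h, x.2.2⟩ ⟨y.1, h', y.2.2⟩ hxy
      · have h' : y.1 ∉ X := by
          intro h'
          apply h
          have := hX g⁻¹ _ h'
          rwa [hxy, ← act_mul, inv_mul_cancel, act_one] at this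
        simp only [dif_neg h, dif_neg h']⟩
  map_add' f f' := by
    refine Subtype.ext (funext fun x => ?_)
    by_cases h : x.1 ∈ X <;> simp [h]
  map_smul' c f := by
    refine Subtype.ext (funext fun x => ?_)
    by_cases h : x.1 ∈ X <;> simp [h]

/-- Restriction of invariant functions on `E_V` to a subset `X`. -/
def restr {ν : Q.DimVec} (X : Set (Rep p ν)) :
    ↥(InvFun r k (Set.univ : Set (Rep p ν))) →ₗ[k] ↥(InvFun r k X) where
  toFun f := ⟨fun x => f.1 ⟨x.1, trivial, x.2.2⟩, fun g hg x y hxy =>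
    f.2 g hg ⟨x.1, trivial, x.2.2⟩ ⟨y.1, trivial, y.2.2⟩ hxy⟩
  map_add' _ _ := rfl
  map_smul' _ _ := rfl

/-- `j^*`: the restriction of functions to a locus. -/
def jStar (v : k) (L : Locus Q p r D) : Hall v (fullLocus Q p r D) →ₗ[k] Hall v L :=
  DirectSum.lmap (M := HallPart v (fullLocus Q p r D)) (N := HallPart v L)
    fun ν => restr (L.carrier ν)

/-- `j_!`: the extension by zero of functions on a locus. -/
def jShriek (v : k) (L : Locus Q p r D) : Hall v L →ₗ[k] Hall v (fullLocus Q p r D) :=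
  DirectSum.lmap (M := HallPart v L) (N := HallPart v (fullLocus Q p r D))
    fun ν => extZero (L.carrier ν) (L.act_mem ν)

variable (k) in
/-- The direct sum of the spaces of invariant functions on the complement of a locus. -/
abbrev HallCompl (L : Locus Q p r D) : Type _ := ⨁ ν : D, ↥(InvFun r k (L.carrier ν)ᶜ)

/-- Extension by zero of functions on the complement of a locus. -/
def iShriek (v : k) (L : Locus Q p r D) : HallCompl k L →ₗ[k] Hall v (fullLocus Q p r D) :=
  DirectSum.lmap (M := fun ν : D => ↥(InvFun r k (L.carrier ν)ᶜ))
    (N := HallPart v (fullLocus Q p r D))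
    fun ν => extZero (L.carrier ν)ᶜ fun g x hx h => hx (by
      have := L.act_mem ν g⁻¹ _ h
      rwa [← act_mul, inv_mul_cancel, act_one] at this)

/-- The inclusion of the part of the Hall algebra with dimension vectors in `D`. -/
def incl [Fintype I] (v : k) (D : AddSubmonoid Q.DimVec) :
    Hall v (fullLocus Q p r D) →ₗ[k] Hall v (fullLocus Q p r ⊤) :=
  DirectSum.toModule k D _ fun ν =>
    DirectSum.lof k _ (HallPart v (fullLocus Q p r ⊤)) ⟨ν.1, trivial⟩

/-! ## Edge contraction -/

/-- The automorphism is admissible: an edge that is not a loop does not have both ends in the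
same orbit. -/
def Admissible (Q : AutQuiver I Ω) : Prop :=
  ∀ h, Q.src h ≠ Q.tgt h → ¬ Q.aV.SameCycle (Q.src h) (Q.tgt h)

/-- The orbit `[i₊]` of the source of the edge `c`. -/
def plus (Q : AutQuiver I Ω) (c : Ω) : Set I := {i | Q.aV.SameCycle (Q.src c) i}

/-- The orbit `[i₋]` of the target of the edge `c`. -/
def minus (Q : AutQuiver I Ω) (c : Ω) : Set I := {i | Q.aV.SameCycle (Q.tgt c) i}

/-- The orbit of the edge `c`: the edges that are contracted. -/
def conE (Q : AutQuiver I Ω) (c : Ω) : Set Ω := {h | Q.aE.SameCycle c h}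

/-- The conditions under which the orbit of the edge `c` can be contracted. -/
structure Contractible (Q : AutQuiver I Ω) (c : Ω) : Prop where
  card_eq : (Q.plus c).ncard = (Q.minus c).ncard
  card_conE : (Q.conE c).ncard = (Q.plus c).ncard
  parallel : ∀ h l : Ω, Q.src h ∈ Q.plus c ∪ Q.minus c → Q.tgt h ∈ Q.plus c ∪ Q.minus c →
    Q.src h ≠ Q.tgt h → Q.src l ∈ Q.plus c ∪ Q.minus c → Q.tgt l ∈ Q.plus c ∪ Q.minus c →
    (Q.src l = Q.src h ∨ Q.src l = Q.tgt h) → (Q.tgt l = Q.src h ∨ Q.tgt l = Q.tgt h)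
  no_loop : ∀ h : Ω, Q.src h = Q.tgt h → Q.src h ∉ Q.plus c ∪ Q.minus c

section Contraction

variable {c : Ω}

theorem aV_minus (i : I) : Q.aV i ∈ Q.minus c ↔ i ∈ Q.minus c :=
  Equiv.Perm.sameCycle_apply_right

theorem aE_conE (h : Ω) : Q.aE h ∈ Q.conE c ↔ h ∈ Q.conE c :=
  Equiv.Perm.sameCycle_apply_right

theorem aE_symm_conE (h : Ω) : Q.aE.symm h ∈ Q.conE c ↔ h ∈ Q.conE c := by
  rw [← aE_conE, Equiv.apply_symm_apply]

theorem src_pow (n : ℤ) (h : Ω) : Q.src ((Q.aE ^ n) h) = (Q.aV ^ n) (Q.src h) := by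
  induction n using Int.induction_on generalizing h with
  | zero => rfl
  | succ n ih => rw [zpow_add_one, zpow_add_one, Equiv.Perm.mul_apply, ih, Q.src_aE]; rfl
  | pred n ih =>
    rw [zpow_sub_one, zpow_sub_one, Equiv.Perm.mul_apply, ih]
    exact congrArg _ (src_symm h)

theorem tgt_pow (n : ℤ) (h : Ω) : Q.tgt ((Q.aE ^ n) h) = (Q.aV ^ n) (Q.tgt h) := by
  induction n using Int.induction_on generalizing h with
  | zero => rfl
  | succ n ih => rw [zpow_add_one, zpow_add_one, Equiv.Perm.mul_apply, ih, Q.tgt_aE]; rfl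
  | pred n ih =>
    rw [zpow_sub_one, zpow_sub_one, Equiv.Perm.mul_apply, ih]
    exact congrArg _ (tgt_symm h)

theorem src_mem_plus {h : Ω} (hh : h ∈ Q.conE c) : Q.src h ∈ Q.plus c := by
  obtain ⟨n, rfl⟩ := hh
  exact ⟨n, (src_pow n c).symm⟩

theorem tgt_mem_minus {h : Ω} (hh : h ∈ Q.conE c) : Q.tgt h ∈ Q.minus c := by
  obtain ⟨n, rfl⟩ := hh
  exact ⟨n, (tgt_pow n c).symm⟩

/-- No edge has both ends in `[i₋]`. -/
theorem not_both (hQ : Q.Admissible) (hc : Q.Contractible c) {h : Ω}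
    (h1 : Q.src h ∈ Q.minus c) : Q.tgt h ∉ Q.minus c := by
  intro h2
  by_cases e : Q.src h = Q.tgt h
  · exact hc.no_loop h e (Or.inr h1)
  · exact hQ h e (Equiv.Perm.SameCycle.trans (Equiv.Perm.SameCycle.symm h1) h2)

theorem src_notMem (hQ : Q.Admissible) (hc : Q.Contractible c) {h : Ω} (hh : h ∈ Q.conE c) :
    Q.src h ∉ Q.minus c :=
  fun h1 => not_both hQ hc h1 (tgt_mem_minus hh)

/-- The vertices of the contracted quiver. -/
abbrev HatV (Q : AutQuiver I Ω) (c : Ω) : Type u := {i : I // i ∉ Q.minus c}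

/-- The edges of the contracted quiver: the edges of the quiver not meeting `[i₋]`, the paths
`l h` and the paths `h⁻¹ l`, where `h` is a contracted edge and `l` is another edge. -/
inductive HatE (Q : AutQuiver I Ω) (c : Ω) : Type w
  | old (h : Ω) (hs : Q.src h ∉ Q.minus c) (ht : Q.tgt h ∉ Q.minus c)
  | post (l h : Ω) (hh : h ∈ Q.conE c) (e : Q.tgt h = Q.src l)
  | pre (h l : Ω) (hh : h ∈ Q.conE c) (hl : l ∉ Q.conE c) (e : Q.tgt h = Q.tgt l)

instance [Finite Ω] : Finite (HatE Q c) := by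
  refine Finite.of_injective (β := Ω ⊕ (Ω × Ω) ⊕ (Ω × Ω)) (fun x => match x with
    | .old h _ _ => .inl h
    | .post l h _ _ => .inr (.inl (l, h))
    | .pre h l _ _ _ => .inr (.inr (h, l))) ?_
  intro x y h
  cases x <;> cases y <;> simp_all

instance [Fintype I] : Fintype (HatV Q c) := Fintype.ofFinite _

instance [Fintype Ω] : Fintype (HatE Q c) := Fintype.ofFinite _

/-- The map induced on edges by the automorphism. -/
def hatE : HatE Q c → HatE Q c
  | .old h hs ht => .old (Q.aE h) (by rwa [Q.src_aE, aV_minus]) (by rwa [Q.tgt_aE, aV_minus])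
  | .post l h hh e => .post (Q.aE l) (Q.aE h) (by rwa [aE_conE])
      (by rw [Q.src_aE, Q.tgt_aE, e])
  | .pre h l hh hl e => .pre (Q.aE h) (Q.aE l) (by rwa [aE_conE]) (by rwa [aE_conE])
      (by rw [Q.tgt_aE, Q.tgt_aE, e])

theorem aV_symm_minus (i : I) : Q.aV.symm i ∈ Q.minus c ↔ i ∈ Q.minus c := by
  rw [← aV_minus, Equiv.apply_symm_apply]

/-- The inverse of `hatE`. -/
def hatEinv : HatE Q c → HatE Q c
  | .old h hs ht => .old (Q.aE.symm h) (by rwa [src_symm, aV_symm_minus])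
      (by rwa [tgt_symm, aV_symm_minus])
  | .post l h hh e => .post (Q.aE.symm l) (Q.aE.symm h) (by rwa [aE_symm_conE])
      (by rw [src_symm, tgt_symm, e])
  | .pre h l hh hl e => .pre (Q.aE.symm h) (Q.aE.symm l) (by rwa [aE_symm_conE])
      (by rwa [aE_symm_conE]) (by rw [tgt_symm, tgt_symm, e])

/-- The contraction of the quiver along the orbit of the edge `c`. -/
def contract (Q : AutQuiver I Ω) (c : Ω) (hQ : Q.Admissible) (hc : Q.Contractible c) :
    AutQuiver (HatV Q c) (HatE Q c) where
  src
    | .old h hs _ => ⟨Q.src h, hs⟩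
    | .post _ h hh _ => ⟨Q.src h, src_notMem hQ hc hh⟩
    | .pre _ l hh _ e => ⟨Q.src l, fun h1 =>
        not_both hQ hc h1 (by rw [← e]; exact tgt_mem_minus hh)⟩
  tgt
    | .old h _ ht => ⟨Q.tgt h, ht⟩
    | .post l _ hh e => ⟨Q.tgt l, not_both hQ hc (by rw [← e]; exact tgt_mem_minus hh)⟩
    | .pre h _ hh _ _ => ⟨Q.src h, src_notMem hQ hc hh⟩
  aV := Q.aV.subtypePerm fun i => not_congr (aV_minus i)
  aE := ⟨hatE, hatEinv, by rintro (_ | _ | _) <;> simp [hatE, hatEinv],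
    by rintro (_ | _ | _) <;> simp [hatE, hatEinv]⟩
  src_aE := by
    rintro (_ | _ | _) <;> exact Subtype.ext (Q.src_aE _)
  tgt_aE := by
    rintro (_ | _ | _)
    · exact Subtype.ext (Q.tgt_aE _)
    · exact Subtype.ext (Q.tgt_aE _)
    · exact Subtype.ext (Q.src_aE _)

/-- `ℕ[Î]` inside `ℕ[I]`: the dimension vectors with equal values at `i₊` and `i₋`. -/
def balanced (Q : AutQuiver I Ω) (c : Ω) : AddSubmonoid Q.DimVec where
  carrier := {ν | ν.1 (Q.src c) = ν.1 (Q.tgt c)}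
  zero_mem' := rfl
  add_mem' := fun {ν μ} (hν : _ = _) (hμ : _ = _) => by
    change ν.1 (Q.src c) + μ.1 (Q.src c) = ν.1 (Q.tgt c) + μ.1 (Q.tgt c)
    rw [hν, hμ]

theorem dim_sameCycle (ν : Q.DimVec) {i j : I} (h : Q.aV.SameCycle i j) : ν.1 i = ν.1 j := by
  obtain ⟨n, rfl⟩ := h
  induction n using Int.induction_on generalizing i with
  | zero => rfl
  | succ n ih => rw [zpow_add_one, Equiv.Perm.mul_apply, ← ih, ν.2]
  | pred n ih =>
    rw [zpow_sub_one, Equiv.Perm.mul_apply, ← ih]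
    exact (eq_symm Q.aV ν.2 i).symm

theorem dim_conE (ν : Q.balanced c) {h : Ω} (hh : h ∈ Q.conE c) :
    ν.1.1 (Q.tgt h) = ν.1.1 (Q.src h) := by
  have e : ν.1.1 (Q.src c) = ν.1.1 (Q.tgt c) := ν.2
  rw [← dim_sameCycle ν.1 (src_mem_plus hh), ← dim_sameCycle ν.1 (tgt_mem_minus hh), e]

theorem frobRep_apply {ν : Q.DimVec} (x : Rep p ν) (h : Ω) :
    frobRep r x h = (recast (eq_symm Q.aE (m := fun h => ν.1 (Q.tgt h)) (tgt_inv ν) h)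
      (eq_symm Q.aE (m := fun h => ν.1 (Q.src h)) (src_inv ν) h)
      (x (Q.aE.symm h))).map (Fr p r) := rfl

theorem isoInv_act {ν : Q.DimVec} (g : Grp p ν) (x : Rep p ν) (h : Ω) (hx : IsIsoMat (x h)) :
    IsIsoMat (act g x h) ∧ isoInv (act g x h) =
      (g (Q.src h)).1 * isoInv (x h) * (g (Q.tgt h))⁻¹.1 := by
  obtain ⟨h1, h2⟩ := hx.mul_isoInv
  have a1 : (g (Q.src h))⁻¹.1 * (g (Q.src h)).1 = 1 := Units.inv_mul _
  have a2 : (g (Q.tgt h))⁻¹.1 * (g (Q.tgt h)).1 = 1 := Units.inv_mul _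
  have a3 : (g (Q.src h)).1 * (g (Q.src h))⁻¹.1 = 1 := Units.mul_inv _
  have a4 : (g (Q.tgt h)).1 * (g (Q.tgt h))⁻¹.1 = 1 := Units.mul_inv _
  have e1 : act g x h * ((g (Q.src h)).1 * isoInv (x h) * (g (Q.tgt h))⁻¹.1) = 1 := by
    calc _ = (g (Q.tgt h)).1 * (x h * ((g (Q.src h))⁻¹.1 * (g (Q.src h)).1) * isoInv (x h)) *
          (g (Q.tgt h))⁻¹.1 := by simp only [act, Matrix.mul_assoc]
      _ = 1 := by rw [a1, Matrix.mul_one, h1, Matrix.mul_one, a4]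
  have e2 : ((g (Q.src h)).1 * isoInv (x h) * (g (Q.tgt h))⁻¹.1) * act g x h = 1 := by
    calc _ = (g (Q.src h)).1 * (isoInv (x h) * ((g (Q.tgt h))⁻¹.1 * (g (Q.tgt h)).1) * x h) *
          (g (Q.src h))⁻¹.1 := by simp only [act, Matrix.mul_assoc]
      _ = 1 := by rw [a2, Matrix.mul_one, h2, Matrix.mul_one, a3]
  exact ⟨⟨_, e1, e2⟩, isoInv_eq e1 e2⟩

theorem blk_iso {m m' n n' : ℕ} (e : m = n) (e' : m' = n')
    {x : Matrix (Fin (m + m')) (Fin (n + n')) (Kbar p)} (hx : IsIsoMat x) (h0 : blkTW x = 0) :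
    IsIsoMat (blkTT x) ∧ IsIsoMat (blkWW x) := by
  subst e e'
  obtain ⟨y, h1, h2⟩ := hx
  have t := blkTT_mul x y
  rw [h1, h0, Matrix.zero_mul, add_zero, blkTT_one] at t
  have w := blkWW_mul y x
  rw [h2, h0, Matrix.mul_zero, zero_add, blkWW_one] at w
  exact ⟨⟨_, t.symm, mul_eq_one_comm.1 t.symm⟩, ⟨_, mul_eq_one_comm.1 w.symm, w.symm⟩⟩

/-- The locus `E_V^♡` where the contracted edges act by isomorphisms. -/
def heart (Q : AutQuiver I Ω) (p r : ℕ) [Fact p.Prime] (c : Ω) :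
    Locus Q p r (Q.balanced c) where
  carrier := fun ν => {x | ∀ h ∈ Q.conE c, IsIsoMat (x h)}
  act_mem := fun ν g x hx h hh => (isoInv_act g x h (hx h hh)).1
  frob_mem := fun ν x hx h hh => by
    rw [frobRep_apply]
    exact isIsoMat_map _ (isIsoMat_recast _ _ (hx _ ((aE_symm_conE h).2 hh)))
  blk_mem := fun τ ω x hx hs =>
    ⟨fun h hh => (blk_iso (dim_conE τ hh) (dim_conE ω hh) (hx h hh) (hs h)).1,
      fun h hh => (blk_iso (dim_conE τ hh) (dim_conE ω hh) (hx h hh) (hs h)).2⟩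

variable (hQ : Q.Admissible) (hc : Q.Contractible c)

/-- The dimension vector of the contracted quiver obtained by forgetting `[i₋]`. -/
def hatDim (ν : Q.balanced c) : (Q.contract c hQ hc).DimVec :=
  ⟨fun i => ν.1.1 i.1, fun i => ν.1.2 i.1⟩

theorem hatDim_injective : Function.Injective (hatDim hQ hc) := by
  intro ν μ h
  have h' : ∀ i : HatV Q c, ν.1.1 i.1 = μ.1.1 i.1 := fun i =>
    congrFun (congrArg Subtype.val h) i
  refine Subtype.ext (Subtype.ext (funext fun i => ?_))
  by_cases hi : i ∈ Q.minus c
  · have e1 : ν.1.1 (Q.src c) = ν.1.1 (Q.tgt c) := ν.2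
    have e2 : μ.1.1 (Q.src c) = μ.1.1 (Q.tgt c) := μ.2
    rw [← dim_sameCycle ν.1 hi, ← dim_sameCycle μ.1 hi, ← e1, ← e2]
    exact h' ⟨Q.src c, src_notMem hQ hc (Equiv.Perm.SameCycle.refl _ _)⟩
  · exact h' ⟨i, hi⟩

/-- The contraction map `μ_ν`. -/
def contractRep {ν : Q.balanced c} (x : Rep p ν.1) : Rep p (hatDim hQ hc ν)
  | .old h _ _ => x h
  | .post l h _ e => recast rfl (congrArg ν.1.1 e.symm) (x l) * x h
  | .pre h l _ _ e => isoInv (x h) * recast (congrArg ν.1.1 e.symm) rfl (x l)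

/-- The projection from `G_V` to the group of the contracted quiver. -/
def hatGrp {ν : Q.balanced c} (g : Grp p ν.1) : Grp p (hatDim hQ hc ν) := fun i => g i.1

theorem hatGrp_frob {ν : Q.balanced c} (g : Grp p ν.1) :
    frobGrp r (hatGrp hQ hc g) = hatGrp hQ hc (frobGrp r g) := rfl

theorem contractRep_frob {ν : Q.balanced c} (x : Rep p ν.1)
    (hx : x ∈ (heart Q p r c).carrier ν) :
    contractRep hQ hc (frobRep r x) = frobRep r (contractRep hQ hc x) := by
  have et := eq_symm Q.aE (m := fun h => ν.1.1 (Q.tgt h)) (tgt_inv ν.1)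
  have es := eq_symm Q.aE (m := fun h => ν.1.1 (Q.src h)) (src_inv ν.1)
  funext j
  cases j with
  | old h hs ht => rfl
  | post l h hh e =>
    have e' : Q.tgt (Q.aE.symm h) = Q.src (Q.aE.symm l) := by rw [tgt_symm, src_symm, e]
    change recast rfl (congrArg ν.1.1 e.symm) (frobRep r x l) * frobRep r x h =
      (recast (et l) (es h) (recast rfl (congrArg ν.1.1 e'.symm) (x (Q.aE.symm l)) *
        x (Q.aE.symm h))).map (Fr p r)
    rw [recast_mul (et l) (et h) (es h), map_mul_map]
    rfl
  | pre h l hh hl e =>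
    have e' : Q.tgt (Q.aE.symm h) = Q.tgt (Q.aE.symm l) := by rw [tgt_symm, tgt_symm, e]
    have hi := hx _ ((aE_symm_conE h).2 hh)
    change isoInv (frobRep r x h) * recast (congrArg ν.1.1 e.symm) rfl (frobRep r x l) =
      (recast (es h) (es l) (isoInv (x (Q.aE.symm h)) *
        recast (congrArg ν.1.1 e'.symm) rfl (x (Q.aE.symm l)))).map (Fr p r)
    rw [recast_mul (es h) (et h) (es l), map_mul_map, frobRep_apply x h,
      isoInv_map _ (isIsoMat_recast _ _ hi), isoInv_recast]
    rfl

theorem contractRep_act {ν : Q.balanced c} (g : Grp p ν.1) (x : Rep p ν.1)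
    (hx : x ∈ (heart Q p r c).carrier ν) :
    contractRep hQ hc (act g x) = act (hatGrp hQ hc g) (contractRep hQ hc x) := by
  funext j
  cases j with
  | old h hs ht => rfl
  | post l h hh e =>
    have ee := congrArg ν.1.1 e.symm
    have a : recast ee ee (g (Q.src l))⁻¹.1 = (g (Q.tgt h))⁻¹.1 :=
      recast_fam (fun i => (g i)⁻¹.1) e.symm ee ee
    have a2 : (g (Q.tgt h))⁻¹.1 * (g (Q.tgt h)).1 = 1 := Units.inv_mul _
    change recast rfl ee ((g (Q.tgt l)).1 * x l * (g (Q.src l))⁻¹.1) *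
        ((g (Q.tgt h)).1 * x h * (g (Q.src h))⁻¹.1) =
      (g (Q.tgt l)).1 * (recast rfl ee (x l) * x h) * (g (Q.src h))⁻¹.1
    rw [recast_mul rfl ee ee, recast_mul rfl rfl ee, a, recast_rfl]
    calc _ = (g (Q.tgt l)).1 * recast rfl ee (x l) * ((g (Q.tgt h))⁻¹.1 * (g (Q.tgt h)).1) *
          x h * (g (Q.src h))⁻¹.1 := by simp only [Matrix.mul_assoc]
      _ = _ := by rw [a2, Matrix.mul_one]; simp only [Matrix.mul_assoc]
  | pre h l hh hl e =>
    have ee := congrArg ν.1.1 e.symm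
    have a : recast ee ee (g (Q.tgt l)).1 = (g (Q.tgt h)).1 :=
      recast_fam (fun i => (g i).1) e.symm ee ee
    have a2 : (g (Q.tgt h))⁻¹.1 * (g (Q.tgt h)).1 = 1 := Units.inv_mul _
    change isoInv (act g x h) * recast ee rfl ((g (Q.tgt l)).1 * x l * (g (Q.src l))⁻¹.1) =
      (g (Q.src h)).1 * (isoInv (x h) * recast ee rfl (x l)) * (g (Q.src l))⁻¹.1
    rw [(isoInv_act g x h (hx h hh)).2, recast_mul ee rfl rfl, recast_mul ee ee rfl, a,
      recast_rfl]
    calc _ = (g (Q.src h)).1 * isoInv (x h) * ((g (Q.tgt h))⁻¹.1 * (g (Q.tgt h)).1) *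
          recast ee rfl (x l) * (g (Q.src l))⁻¹.1 := by simp only [Matrix.mul_assoc]
      _ = _ := by rw [a2, Matrix.mul_one]; simp only [Matrix.mul_assoc]

/-- The contraction map on rational points. -/
def contractPts {ν : Q.balanced c} (x : Pts r ((heart Q p r c).carrier ν)) :
    Pts r (Set.univ : Set (Rep p (hatDim hQ hc ν))) :=
  ⟨contractRep hQ hc x.1, trivial, by rw [← contractRep_frob hQ hc x.1 x.2.1, x.2.2]⟩

/-- The pull-back `μ_ν^*`. -/
def muPull (v : k) (ν : Q.balanced c) :
    HallPart v (fullLocus (Q.contract c hQ hc) p r ⊤) ⟨hatDim hQ hc ν, trivial⟩ →ₗ[k]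
      HallPart v (heart Q p r c) ν where
  toFun f := ⟨fun x => f.1 (contractPts hQ hc x), fun g hg x y hxy =>
    f.2 (hatGrp hQ hc g) (by rw [hatGrp_frob, hg]) (contractPts hQ hc x) (contractPts hQ hc y)
      ((congrArg (contractRep hQ hc) hxy).trans (contractRep_act hQ hc g x.1 x.2.1))⟩
  map_add' _ _ := rfl
  map_smul' _ _ := rfl

/-- `μ_ν^⋆ = v ^ (- ν_{i₋}² φ₁(i₋)) μ_ν^*`, where `φ₁(i₋)` is the size of `[i₋]`. -/
def muPart (v : k) (ν : Q.balanced c) :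
    HallPart v (fullLocus (Q.contract c hQ hc) p r ⊤) ⟨hatDim hQ hc ν, trivial⟩ →ₗ[k]
      HallPart v (heart Q p r c) ν :=
  v⁻¹ ^ ((ν.1.1 (Q.tgt c)) ^ 2 * (Q.minus c).ncard) • muPull hQ hc v ν

/-- `μ^⋆`, from the Hall algebra of the contracted quiver to the Hall algebra of `E^♡`. -/
def muStar (v : k) :
    Hall v (fullLocus (Q.contract c hQ hc) p r ⊤) →ₗ[k] Hall v (heart Q p r c) :=
  DirectSum.lmap (muPart hQ hc v) ∘ₗ
    { toFun := DFinsupp.comapDomain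
        (fun ν : Q.balanced c => (⟨hatDim hQ hc ν, trivial⟩ :
          (⊤ : AddSubmonoid (Q.contract c hQ hc).DimVec)))
        (fun _ _ h => hatDim_injective hQ hc (congrArg Subtype.val h))
      map_add' := fun f g => DFinsupp.comapDomain_add _ _ f g
      map_smul' := fun a f => DFinsupp.comapDomain_smul _ _ a f }

end Contraction

/-- A linear map between Hall algebras that is multiplicative and preserves the unit. -/
structure IsHallHom {A B : Type*} [NonUnitalNonAssocRing A] [NonUnitalNonAssocRing B] [One A]
    [One B] [Module k A] [Module k B] (f : A →ₗ[k] B) : Prop where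
  map_one : f 1 = 1
  map_mul : ∀ x y, f (x * y) = f x * f y

/-- The field `ℚ(v)` inside `ℂ`. -/
abbrev BaseField (v : ℂ) : Type := ↥(IntermediateField.adjoin ℚ {v})

/-- The generator `v` of `ℚ(v)`. -/
def root (v : ℂ) : BaseField v := IntermediateField.AdjoinSimple.gen ℚ v

section Names

variable [Fintype I] [Fintype Ω] (Q : AutQuiver I Ω) (c : Ω) (p r : ℕ) [Fact p.Prime] (v : ℂ)

/-- The Hall algebra `H` of a quiver with automorphism. -/
abbrev HallQ : Type _ := Hall (root v) (fullLocus Q p r ⊤)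

/-- `H_Î`: the part of `H` with dimension vectors in `ℕ[Î]`. -/
abbrev HallI : Type _ := Hall (root v) (fullLocus Q p r (Q.balanced c))

/-- `H^♡`: the Hall algebra of the locus where the contracted edges are isomorphisms. -/
abbrev HallHeart : Type _ := Hall (root v) (heart Q p r c)

/-- `H^c`: the invariant functions on the complement of that locus. -/
abbrev HallC : Type _ := HallCompl (BaseField v) (heart Q p r c)

/-- The inclusion of `H_Î` into `H`. -/
abbrev inclI : HallI Q c p r v →ₗ[BaseField v] HallQ Q p r v := incl (root v) (Q.balanced c)

/-- The inclusion of `H^c` into `H_Î` (extension by zero). -/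
abbrev iC : HallC Q c p r v →ₗ[BaseField v] HallI Q c p r v := iShriek (root v) (heart Q p r c)

/-- The restriction `j^* : H_Î → H^♡`. -/
abbrev jR : HallI Q c p r v →ₗ[BaseField v] HallHeart Q c p r v :=
  jStar (root v) (heart Q p r c)

/-- The extension by zero `j_! : H^♡ → H_Î`. -/
abbrev jE : HallHeart Q c p r v →ₗ[BaseField v] HallI Q c p r v :=
  jShriek (root v) (heart Q p r c)

/-- `μ^⋆ : Ĥ → H^♡`, where `Ĥ` is the Hall algebra of the contracted quiver. -/
abbrev muH (hQ : Q.Admissible) (hc : Q.Contractible c) :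
    HallQ (Q.contract c hQ hc) p r v →ₗ[BaseField v] HallHeart Q c p r v :=
  muStar hQ hc (root v)

end Names

end AutQuiver

end HallContraction

end

/-
The product `f₁ ∘ f₂` at `x` is a normalized sum over the rational short exact sequences
`0 → W → x → T → 0`, since these are the points of the fibre of `p₃ p₂` over `x`. A representation
with invertible maps at the edges of `C` has only subrepresentations and quotients of this kind, as
the dimensions at `[i₊]` and `[i₋]` agree, and by the five lemma the class is closed under
extensions. Hence the restriction `j^*` and the extension by zero `j_!` are both multiplicative.

A rational point of `E^♡` is, in exactly one way, `X • y`, with `y` obtained from its contraction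
`x̂` by identities at the edges of `C` and `X` a rational element of the group at `[i₋]`. So a short
exact sequence for this point amounts to one for `x̂` and two rational group elements at `[i₋]`, for
`T` and for `W`. Their number cancels against the difference between the orders of `G_T^F`, `G_W^F`
and those of the groups of the contracted quiver. What is left of `m(τ, ω)` is `2 τ_{i₋} ω_{i₋}` for
each vertex of `[i₋]`, and the twist of `μ^⋆` absorbs this, by
`(τ_{i₋} + ω_{i₋})² = τ_{i₋}² + ω_{i₋}² + 2 τ_{i₋} ω_{i₋}`.
-/

noncomputable section

namespace HallContraction

universe u w

section Recast

variable {R : Type*} {m m' m₁ n n' n₁ k k' : ℕ}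

theorem recast_inj {hm hm₁ : m = m'} {hn hn₁ : n = n'} {x y : Matrix (Fin m) (Fin n) R} :
    recast hm hn x = recast hm₁ hn₁ y ↔ x = y := by
  subst hm hn; rfl

section Mul

variable [CommRing R]

theorem recast_mul_recast (hm : m = m') (hn hn₁ : n = n') (hk : k = k')
    (x : Matrix (Fin m) (Fin n) R) (y : Matrix (Fin n) (Fin k) R) :
    recast hm hn x * recast hn₁ hk y = recast hm hk (x * y) := by
  subst hm hn hk; rfl

theorem recast_one_mul (hm : k = m) (hn : k = n) (x : Matrix (Fin n) (Fin n') R) :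
    recast hm hn 1 * x = recast (hn.symm.trans hm) rfl x := by
  subst hm hn; exact Matrix.one_mul x

theorem mul_recast_one (hm : k = n) (hn : k = m) (x : Matrix (Fin n') (Fin n) R) :
    x * recast hm hn 1 = recast rfl (hm.symm.trans hn) x := by
  subst hm hn; exact Matrix.mul_one x

theorem isIsoMat_recast_one (hm : k = m) (hn : k = n) :
    IsIsoMat (recast hm hn (1 : Matrix (Fin k) (Fin k) R)) :=
  isIsoMat_recast _ _ ⟨1, Matrix.one_mul _, Matrix.one_mul _⟩

theorem IsIsoMat.isUnit {x : Matrix (Fin n) (Fin n) R} (hx : IsIsoMat x) : IsUnit x := by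
  obtain ⟨y, hxy, hyx⟩ := hx
  exact ⟨⟨x, y, hxy, hyx⟩, rfl⟩

theorem inv_mul_mul_mul_inv (g : GL (Fin m) R) (h : GL (Fin n) R)
    (x : Matrix (Fin m) (Fin n) R) : (g⁻¹).1 * (g.1 * x * h.1) * (h⁻¹).1 = x := calc
  _ = (g⁻¹).1 * g.1 * x * (h.1 * (h⁻¹).1) := by simp only [Matrix.mul_assoc]
  _ = x := by rw [g.inv_mul, h.mul_inv, Matrix.one_mul, Matrix.mul_one]

end Mul

variable {S : Type*} [CommRing R] [CommRing S] {σ : R →+* S}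

/-- `y` is the image of `x` under the entrywise map `σ`, up to a change of equal sizes. For
`σ = Fr p r` this is the relation between the components at `j` and `a j` of a family fixed by the
twisted Frobenius; unlike an equation, it does not mention the casts. -/
def IsRecastMap (σ : R →+* S) (x : Matrix (Fin m) (Fin n) R) (y : Matrix (Fin m') (Fin n') S) :
    Prop :=
  ∃ (hm : m = m') (hn : n = n'), y = (recast hm hn x).map σ

namespace IsRecastMap

theorem mul {x : Matrix (Fin m) (Fin n) R} {y : Matrix (Fin n) (Fin k) R}
    {x' : Matrix (Fin m') (Fin n') S} {y' : Matrix (Fin n') (Fin k') S}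
    (hx : IsRecastMap σ x x') (hy : IsRecastMap σ y y') : IsRecastMap σ (x * y) (x' * y') := by
  obtain ⟨rfl, rfl, rfl⟩ := hx
  obtain ⟨_, rfl, rfl⟩ := hy
  exact ⟨rfl, rfl, (map_mul_map σ x y).symm⟩

theorem one (h : m = m') :
    IsRecastMap σ (1 : Matrix (Fin m) (Fin m) R) (1 : Matrix (Fin m') (Fin m') S) := by
  subst h
  exact ⟨rfl, rfl, (one_map' σ).symm⟩

theorem unique {x : Matrix (Fin m) (Fin n) R} {y z : Matrix (Fin m') (Fin n') S}
    (hy : IsRecastMap σ x y) (hz : IsRecastMap σ x z) : y = z := by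
  obtain ⟨_, _, rfl⟩ := hy
  obtain ⟨_, _, rfl⟩ := hz
  rfl

theorem recast_left {x : Matrix (Fin m) (Fin n) R} {y : Matrix (Fin m') (Fin n') S}
    (h : IsRecastMap σ x y) (hm : m = m₁) (hn : n = n₁) : IsRecastMap σ (recast hm hn x) y := by
  subst hm hn; exact h

theorem recast_right {x : Matrix (Fin m) (Fin n) R} {y : Matrix (Fin m') (Fin n') S}
    (h : IsRecastMap σ x y) (hm : m' = m₁) (hn : n' = n₁) :
    IsRecastMap σ x (recast hm hn y) := by
  subst hm hn; exact h

theorem congr_index {α : Type*} {s t : α → ℕ} {z : ∀ j, Matrix (Fin (s j)) (Fin (t j)) S}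
    {x : Matrix (Fin m) (Fin n) R} {i j : α} (h : IsRecastMap σ x (z i)) (e : i = j) :
    IsRecastMap σ x (z j) := e ▸ h

end IsRecastMap

theorem frobFam_eq_self_iff {p r : ℕ} [Fact p.Prime] {α : Type*} {a : Equiv.Perm α} {m n : α → ℕ}
    {hm : ∀ j, m (a j) = m j} {hn : ∀ j, n (a j) = n j} {z : Fam p m n} :
    frobFam p r a hm hn z = z ↔ ∀ j, IsRecastMap (Fr p r) (z j) (z (a j)) := by
  constructor
  · intro h j
    exact ⟨(hm j).symm, (hn j).symm, by conv_lhs => rw [← h, frobFam_apply]⟩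
  · intro h
    funext j
    obtain ⟨i, rfl⟩ := a.surjective j
    rw [frobFam_apply]
    obtain ⟨_, _, e⟩ := h i
    exact e.symm

end Recast

/-! ## Split exact pairs of matrices -/

/-- The sequence `0 → W → V → T → 0` given by `A : W → V` and `B : V → T` is split exact. The
condition `B * A = 0` is a consequence, see `SplitExact.mul_eq_zero`. -/
def SplitExact {R : Type*} [CommRing R] {n m m' : ℕ} (A : Matrix (Fin n) (Fin m') R)
    (B : Matrix (Fin m) (Fin n) R) : Prop :=
  ∃ (C : Matrix (Fin n) (Fin m) R) (D : Matrix (Fin m') (Fin n) R),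
    B * C = 1 ∧ D * A = 1 ∧ C * B + A * D = 1

namespace SplitExact

variable {R : Type*} [CommRing R] {n m m' n₁ m₁ m₁' k : ℕ} {A : Matrix (Fin n) (Fin m') R}
  {B : Matrix (Fin m) (Fin n) R}

theorem mul_eq_zero (h : SplitExact A B) : B * A = 0 := by
  obtain ⟨C, D, hBC, hDA, hsum⟩ := h
  have : B * A = B * A + B * A := calc
    B * A = B * (C * B + A * D) * A := by rw [hsum, Matrix.mul_one]
    _ = (B * C) * B * A + B * A * (D * A) := by
      simp only [Matrix.mul_add, Matrix.add_mul, Matrix.mul_assoc]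
    _ = B * A + B * A := by rw [hBC, hDA, Matrix.one_mul, Matrix.mul_one]
  exact left_eq_add.1 this

theorem left_cancel (h : SplitExact A B) {y z : Matrix (Fin m') (Fin k) R}
    (e : A * y = A * z) : y = z := by
  obtain ⟨C, D, -, hDA, -⟩ := h
  rw [← Matrix.one_mul y, ← Matrix.one_mul z, ← hDA, Matrix.mul_assoc, Matrix.mul_assoc, e]

theorem right_cancel (h : SplitExact A B) {y z : Matrix (Fin k) (Fin m) R}
    (e : y * B = z * B) : y = z := by
  obtain ⟨C, D, hBC, -, -⟩ := h
  rw [← Matrix.mul_one y, ← Matrix.mul_one z, ← hBC, ← Matrix.mul_assoc, ← Matrix.mul_assoc, e]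

theorem recast (h : SplitExact A B) (e₁ e₁' : n = n₁) (e₂ : m = m₁) (e₃ : m' = m₁') :
    SplitExact (recast e₁ e₃ A) (recast e₂ e₁' B) := by
  subst e₁ e₂ e₃; exact h

theorem conj (h : SplitExact A B) (g : GL (Fin n) R) (a : GL (Fin m) R) (b : GL (Fin m') R) :
    SplitExact (g.1 * A * (b⁻¹).1) (a.1 * B * (g⁻¹).1) := by
  obtain ⟨C, D, hBC, hDA, hsum⟩ := h
  refine ⟨g.1 * C * (a⁻¹).1, b.1 * D * (g⁻¹).1, ?_, ?_, ?_⟩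
  · calc a.1 * B * (g⁻¹).1 * (g.1 * C * (a⁻¹).1)
        = a.1 * (B * ((g⁻¹).1 * g.1) * C) * (a⁻¹).1 := by simp only [Matrix.mul_assoc]
      _ = 1 := by rw [g.inv_mul, Matrix.mul_one, hBC, Matrix.mul_one, a.mul_inv]
  · calc b.1 * D * (g⁻¹).1 * (g.1 * A * (b⁻¹).1)
        = b.1 * (D * ((g⁻¹).1 * g.1) * A) * (b⁻¹).1 := by simp only [Matrix.mul_assoc]
      _ = 1 := by rw [g.inv_mul, Matrix.mul_one, hDA, Matrix.mul_one, b.mul_inv]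
  · calc g.1 * C * (a⁻¹).1 * (a.1 * B * (g⁻¹).1) + g.1 * A * (b⁻¹).1 * (b.1 * D * (g⁻¹).1)
        = g.1 * (C * ((a⁻¹).1 * a.1) * B + A * ((b⁻¹).1 * b.1) * D) * (g⁻¹).1 := by
          simp only [Matrix.mul_add, Matrix.add_mul, Matrix.mul_assoc]
      _ = 1 := by
          rw [a.inv_mul, b.inv_mul, Matrix.mul_one, Matrix.mul_one, hsum, Matrix.mul_one,
            g.mul_inv]

theorem isIsoMat_of_outer {A₁ : Matrix (Fin n₁) (Fin m₁') R} {B₁ : Matrix (Fin m₁) (Fin n₁) R}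
    (h : SplitExact A B) (h₁ : SplitExact A₁ B₁) {x : Matrix (Fin n₁) (Fin n) R}
    {t : Matrix (Fin m₁) (Fin m) R} {w : Matrix (Fin m₁') (Fin m') R} (hA : x * A = A₁ * w)
    (hB : t * B = B₁ * x) (ht : IsIsoMat t) (hw : IsIsoMat w) : IsIsoMat x := by
  obtain ⟨t', htt', ht't⟩ := ht
  obtain ⟨w', hww', hw'w⟩ := hw
  obtain ⟨C, D, hBC, -, hsum⟩ := h
  obtain ⟨C₁, D₁, -, hDA₁, hsum₁⟩ := h₁
  have hSx : C * t' * B₁ * x = C * B := by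
    rw [Matrix.mul_assoc, ← hB, ← Matrix.mul_assoc, Matrix.mul_assoc C, ht't, Matrix.mul_one]
  have hPx : A * w' * D₁ * (x * (A * D)) = A * D := calc
    _ = A * w' * D₁ * (x * A) * D := by simp only [Matrix.mul_assoc]
    _ = A * (w' * ((D₁ * A₁) * w)) * D := by rw [hA]; simp only [Matrix.mul_assoc]
    _ = A * D := by rw [hDA₁, Matrix.one_mul, hw'w, Matrix.mul_one]
  have hxP : x * (A * w' * D₁) = A₁ * D₁ := by
    rw [← Matrix.mul_assoc, ← Matrix.mul_assoc, hA, Matrix.mul_assoc A₁, hww', Matrix.mul_one]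
  have hBxS : B₁ * (x * (C * t' * B₁)) = B₁ := calc
    _ = t * ((B * C) * t') * B₁ := by rw [← Matrix.mul_assoc, ← hB]; simp only [Matrix.mul_assoc]
    _ = B₁ := by rw [hBC, Matrix.one_mul, htt', Matrix.one_mul]
  refine ⟨A * w' * D₁ * (1 - x * (C * t' * B₁)) + C * t' * B₁, ?_, ?_⟩
  · calc x * (A * w' * D₁ * (1 - x * (C * t' * B₁)) + C * t' * B₁)
        = A₁ * D₁ + (1 - A₁ * D₁) * (x * (C * t' * B₁)) := by
          rw [Matrix.mul_add, ← Matrix.mul_assoc x, hxP, Matrix.mul_sub, Matrix.sub_mul,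
            Matrix.mul_one, Matrix.one_mul]
          abel
      _ = 1 := by
          rw [← eq_sub_of_add_eq hsum₁, Matrix.mul_assoc C₁, hBxS, add_comm, hsum₁]
  · calc (A * w' * D₁ * (1 - x * (C * t' * B₁)) + C * t' * B₁) * x
        = A * w' * D₁ * (x * (1 - C * B)) + C * B := by
          rw [Matrix.add_mul, hSx, Matrix.mul_assoc _ _ x, Matrix.sub_mul, Matrix.one_mul,
            Matrix.mul_assoc x, hSx, Matrix.mul_sub x, Matrix.mul_one]
      _ = 1 := by rw [← eq_sub_of_add_eq' hsum, hPx, add_comm, hsum]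

end SplitExact

section Blocks

open AutQuiver.Locus (rowT colW colW_mul rowT_mul)

variable {p : ℕ} [Fact p.Prime] {N M m m' n n' : ℕ}

theorem mul_eq_blk_add (g : Matrix (Fin N) (Fin (m + m')) (Kbar p))
    (g' : Matrix (Fin (m + m')) (Fin M) (Kbar p)) :
    g * g' = g.submatrix id (Fin.castAdd m') * rowT g' +
      colW g * g'.submatrix (Fin.natAdd m) id := by
  ext i j
  simp [rowT, colW, Matrix.mul_apply, Fin.sum_univ_add]

theorem splitExact_colW_rowT (g : GL (Fin (m + m')) (Kbar p)) :
    SplitExact (colW g.1) (rowT (g⁻¹).1) :=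
  ⟨g.1.submatrix id (Fin.castAdd m'), (g⁻¹).1.submatrix (Fin.natAdd m) id,
    (congrArg blkTT g.inv_mul).trans blkTT_one, (congrArg blkWW g.inv_mul).trans blkWW_one,
    (mul_eq_blk_add _ _).symm.trans g.mul_inv⟩

theorem SplitExact.exists_colW_rowT {A : Matrix (Fin (m + m')) (Fin m') (Kbar p)}
    {B : Matrix (Fin m) (Fin (m + m')) (Kbar p)} (h : SplitExact A B) :
    ∃ g : GL (Fin (m + m')) (Kbar p), colW g.1 = A ∧ rowT (g⁻¹).1 = B := by
  obtain ⟨C, D, -, -, hsum⟩ := h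
  let g : Matrix (Fin (m + m')) (Fin (m + m')) (Kbar p) := Matrix.of fun i j =>
    Fin.addCases (fun j => C i j) (fun j => A i j) j
  let g' : Matrix (Fin (m + m')) (Fin (m + m')) (Kbar p) := Matrix.of fun i j =>
    Fin.addCases (fun i => B i j) (fun i => D i j) i
  have hgA : colW g = A := by ext i j; simp [g, colW]
  have hgB : rowT g' = B := by ext i j; simp [g', rowT]
  have hgC : g.submatrix id (Fin.castAdd m') = C := by ext i j; simp [g]
  have hgD : g'.submatrix (Fin.natAdd m) id = D := by ext i j; simp [g']
  have hgg' : g * g' = 1 := by rw [mul_eq_blk_add, hgA, hgB, hgC, hgD, hsum]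
  exact ⟨⟨g, g', hgg', mul_eq_one_comm.1 hgg'⟩, hgA, hgB⟩

theorem mul_colW_of_blkTW_eq_zero (g : Matrix (Fin N) (Fin (m + m')) (Kbar p))
    {x : Matrix (Fin (m + m')) (Fin (n + n')) (Kbar p)} (hx : blkTW x = 0) :
    g * colW x = colW g * blkWW x := by
  have hTW : rowT (colW x) = 0 := hx
  rw [mul_eq_blk_add g (colW x), hTW, Matrix.mul_zero, zero_add]
  rfl

theorem rowT_mul_of_blkTW_eq_zero {x : Matrix (Fin (m + m')) (Fin (n + n')) (Kbar p)}
    (g : Matrix (Fin (n + n')) (Fin N) (Kbar p)) (hx : blkTW x = 0) :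
    rowT x * g = blkTT x * rowT g := by
  have hTW : colW (rowT x) = 0 := hx
  rw [mul_eq_blk_add (rowT x) g, hTW, Matrix.zero_mul, add_zero]
  rfl

variable (g : GL (Fin (m + m')) (Kbar p)) (k : GL (Fin (n + n')) (Kbar p))
  {x : Matrix (Fin (m + m')) (Fin (n + n')) (Kbar p)}

theorem conj_mul_colW (hx : blkTW x = 0) :
    g.1 * x * (k⁻¹).1 * colW k.1 = colW g.1 * blkWW x := by
  rw [← colW_mul, Matrix.mul_assoc, k.inv_mul, Matrix.mul_one, colW_mul,
    mul_colW_of_blkTW_eq_zero g.1 hx]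

theorem rowT_mul_conj (hx : blkTW x = 0) :
    rowT (g⁻¹).1 * (g.1 * x * (k⁻¹).1) = blkTT x * rowT (k⁻¹).1 := by
  rw [← rowT_mul, Matrix.mul_assoc g.1, ← Matrix.mul_assoc (g⁻¹).1, g.inv_mul, Matrix.one_mul,
    rowT_mul, rowT_mul_of_blkTW_eq_zero (k⁻¹).1 hx]

end Blocks

namespace AutQuiver

variable {I : Type u} {Ω : Type w} {Q : AutQuiver I Ω} {p r : ℕ} [Fact p.Prime] {c : Ω}

theorem frobRep_eq_self_iff {ν : Q.DimVec} {x : Rep p ν} :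
    frobRep r x = x ↔ ∀ h, IsRecastMap (Fr p r) (x h) (x (Q.aE h)) := frobFam_eq_self_iff

variable (r) in
/-- The group `G_V^F` of elements of `G_V` fixed by the twisted Frobenius. -/
def ratGrp (ν : Q.DimVec) : Subgroup (Grp p ν) where
  carrier := {g | frobGrp r g = g}
  one_mem' := by
    funext i
    exact Units.ext (congrFun (frobEnd_one r) i)
  mul_mem' {g g'} hg hg' := by
    change frobGrp r (g * g') = g * g'
    rw [frobGrp_mul, hg, hg']
  inv_mem' {g} hg := by
    change frobGrp r g⁻¹ = g⁻¹
    rw [frobGrp_inv, hg]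

theorem mem_ratGrp_iff {ν : Q.DimVec} {g : Grp p ν} :
    g ∈ ratGrp r ν ↔ ∀ i, IsRecastMap (Fr p r) (g i).1 (g (Q.aV i)).1 := by
  refine Iff.trans ?_ (frobFam_eq_self_iff (hm := ν.2) (hn := ν.2) (z := fun i => (g i).1))
  exact ⟨fun h => funext fun i => congrArg Units.val (congrFun h i),
    fun h => funext fun i => Units.ext (congrFun h i)⟩

theorem frobRep_act_eq_self {ν : Q.DimVec} {g : Grp p ν} {x : Rep p ν} (hg : g ∈ ratGrp r ν)
    (hx : frobRep r x = x) : frobRep r (act g x) = act g x := by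
  rw [frobRep_act, hx, show frobGrp r g = g from hg]

instance finite_ratGrp [Finite I] [NeZero r] (ν : Q.DimVec) : Finite (ratGrp (p := p) r ν) := by
  have := finite_frobFam p r Q.aV ν.2 ν.2
  refine Finite.of_injective (fun g : ratGrp r ν =>
    (⟨fun i => (g.1 i).1, frobFam_eq_self_iff.2 (mem_ratGrp_iff.1 g.2)⟩ :
      {z : Fam p ν.1 ν.1 // frobFam p r Q.aV ν.2 ν.2 z = z})) fun g g' h => ?_
  exact Subtype.ext (funext fun i => Units.ext (congrFun (congrArg Subtype.val h) i))

/-! ## Rational short exact sequences of representations -/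

/-- The family of linear maps `z` is a homomorphism of representations from `y` to `x` that is
fixed by the twisted Frobenius. -/
structure IsRatHom (r : ℕ) {ν μ : Q.DimVec} (z : Fam p μ.1 ν.1) (y : Rep p ν) (x : Rep p μ) :
    Prop where
  comm : ∀ h, x h * z (Q.src h) = z (Q.tgt h) * y h
  frob : ∀ i, IsRecastMap (Fr p r) (z i) (z (Q.aV i))

namespace IsRatHom

variable {ν μ : Q.DimVec} {z : Fam p μ.1 ν.1} {y : Rep p ν} {x : Rep p μ}

theorem act (hz : IsRatHom r z y x) {g : Grp p μ} {g' : Grp p ν} (hg : g ∈ ratGrp r μ)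
    (hg' : g' ∈ ratGrp r ν) :
    IsRatHom r (fun i => (g i).1 * z i * (g'⁻¹ i).1) (act g' y) (act g x) where
  comm h := calc
    (g (Q.tgt h)).1 * x h * (g (Q.src h))⁻¹.1 *
          ((g (Q.src h)).1 * z (Q.src h) * (g' (Q.src h))⁻¹.1)
        = (g (Q.tgt h)).1 * (x h * ((g (Q.src h))⁻¹.1 * (g (Q.src h)).1) * z (Q.src h)) *
          (g' (Q.src h))⁻¹.1 := by simp only [Matrix.mul_assoc]
      _ = (g (Q.tgt h)).1 * (z (Q.tgt h) * ((g' (Q.tgt h))⁻¹.1 * (g' (Q.tgt h)).1) * y h) *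
          (g' (Q.src h))⁻¹.1 := by
        rw [Units.inv_mul, Units.inv_mul, Matrix.mul_one, Matrix.mul_one, hz.comm]
      _ = (g (Q.tgt h)).1 * z (Q.tgt h) * (g' (Q.tgt h))⁻¹.1 *
          ((g' (Q.tgt h)).1 * y h * (g' (Q.src h))⁻¹.1) := by simp only [Matrix.mul_assoc]
  frob i := ((mem_ratGrp_iff.1 hg i).mul (hz.frob i)).mul (mem_ratGrp_iff.1 (inv_mem hg') i)

theorem frob_tgt (hz : IsRatHom r z y x) (h : Ω) :
    IsRecastMap (Fr p r) (z (Q.tgt h)) (z (Q.tgt (Q.aE h))) :=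
  (hz.frob _).congr_index (Q.tgt_aE h).symm

theorem frob_src (hz : IsRatHom r z y x) (h : Ω) :
    IsRecastMap (Fr p r) (z (Q.src h)) (z (Q.src (Q.aE h))) :=
  (hz.frob _).congr_index (Q.src_aE h).symm

end IsRatHom

/-- A short exact sequence `0 → sub → x → quot → 0` of representations, given by maps `ι` and `π`
fixed by the twisted Frobenius. The dimension vectors of `quot` and `sub` are `τ` and `ω`. -/
structure RatSES (r : ℕ) {ν : Q.DimVec} (τ ω : Q.DimVec) (x : Rep p ν) where
  quot : Rep p τ
  sub : Rep p ω
  ι : Fam p ν.1 ω.1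
  π : Fam p τ.1 ν.1
  isRatHom_ι : IsRatHom r ι sub x
  isRatHom_π : IsRatHom r π x quot
  splitExact : ∀ i, SplitExact (ι i) (π i)

namespace RatSES

variable {ν τ ω : Q.DimVec} {x : Rep p ν}

theorem ext_of_maps {s s' : RatSES r τ ω x} (hι : s.ι = s'.ι) (hπ : s.π = s'.π) : s = s' := by
  obtain ⟨quot, sub, ι, π, hι', hπ', h⟩ := s
  obtain ⟨quot', sub', ι', π', hι'', hπ'', _⟩ := s'
  obtain rfl : ι = ι' := hι
  obtain rfl : π = π' := hπ
  obtain rfl : quot = quot' :=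
    funext fun e => (h _).right_cancel ((hπ'.comm e).trans (hπ''.comm e).symm)
  obtain rfl : sub = sub' :=
    funext fun e => (h _).left_cancel ((hι'.comm e).symm.trans (hι''.comm e))
  rfl

instance [Finite I] [NeZero r] : Finite (RatSES r τ ω x) := by
  have := finite_frobFam p r Q.aV ν.2 ω.2
  have := finite_frobFam p r Q.aV τ.2 ν.2
  refine Finite.of_injective (fun s : RatSES r τ ω x =>
    ((⟨s.ι, frobFam_eq_self_iff.2 s.isRatHom_ι.frob⟩,
      ⟨s.π, frobFam_eq_self_iff.2 s.isRatHom_π.frob⟩) :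
      {z // frobFam p r Q.aV ν.2 ω.2 z = z} × {z // frobFam p r Q.aV τ.2 ν.2 z = z})) ?_
  intro s s' h
  simp only [Prod.mk.injEq, Subtype.mk.injEq] at h
  exact ext_of_maps h.1 h.2

theorem frob_sub (s : RatSES r τ ω x) (hx : frobRep r x = x) : frobRep r s.sub = s.sub := by
  rw [frobRep_eq_self_iff] at hx ⊢
  refine fun h => ⟨(tgt_inv ω h).symm, (src_inv ω h).symm, (s.splitExact _).left_cancel ?_⟩
  rw [← s.isRatHom_ι.comm]
  refine ((hx h).mul (s.isRatHom_ι.frob_src h)).unique ?_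
  rw [s.isRatHom_ι.comm]
  exact (s.isRatHom_ι.frob_tgt h).mul ⟨_, _, rfl⟩

theorem frob_quot (s : RatSES r τ ω x) (hx : frobRep r x = x) : frobRep r s.quot = s.quot := by
  rw [frobRep_eq_self_iff] at hx ⊢
  refine fun h => ⟨(tgt_inv τ h).symm, (src_inv τ h).symm, (s.splitExact _).right_cancel ?_⟩
  rw [s.isRatHom_π.comm]
  refine ((s.isRatHom_π.frob_tgt h).mul (hx h)).unique ?_
  rw [← s.isRatHom_π.comm]
  exact IsRecastMap.mul ⟨_, _, rfl⟩ (s.isRatHom_π.frob_src h)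

/-- The short exact sequence with the same maps up to the action of rational group elements on
its three terms. -/
def twist (s : RatSES r τ ω x) {a : Grp p τ} {b : Grp p ω} {g : Grp p ν} (ha : a ∈ ratGrp r τ)
    (hb : b ∈ ratGrp r ω) (hg : g ∈ ratGrp r ν) : RatSES r τ ω (act g x) where
  quot := act a s.quot
  sub := act b s.sub
  ι i := (g i).1 * s.ι i * (b⁻¹ i).1
  π i := (a i).1 * s.π i * (g⁻¹ i).1
  isRatHom_ι := s.isRatHom_ι.act hg hb
  isRatHom_π := s.isRatHom_π.act ha hg
  splitExact i := (s.splitExact i).conj (g i) (a i) (b i)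

end RatSES

/-! ## The product as a sum over short exact sequences -/

variable {D : AddSubmonoid Q.DimVec}

namespace Locus

variable (L : Locus Q p r D) {τ ω : D}

theorem isRatHom_famA (y : L.E1F τ ω) :
    IsRatHom r (L.famA y.1) (L.preW y.1) (L.ev _ y.1) where
  frob := frobFam_eq_self_iff.1 ((L.fam_frob y.1).1.symm.trans (congrArg L.famA y.2))
  comm h := by
    induction y.1 using Quotient.inductionOn with
    | h y =>
      exact conj_mul_colW (m := τ.1.1 (Q.tgt h)) (m' := ω.1.1 (Q.tgt h)) (n := τ.1.1 (Q.src h))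
        (n' := ω.1.1 (Q.src h)) (y.1 (Q.tgt h)) (y.1 (Q.src h)) (y.2.2.1 h)

theorem isRatHom_famB (y : L.E1F τ ω) :
    IsRatHom r (L.famB y.1) (L.ev _ y.1) (L.preT y.1) where
  frob := frobFam_eq_self_iff.1 ((L.fam_frob y.1).2.symm.trans (congrArg L.famB y.2))
  comm h := by
    induction y.1 using Quotient.inductionOn with
    | h y =>
      exact (rowT_mul_conj (m := τ.1.1 (Q.tgt h)) (m' := ω.1.1 (Q.tgt h)) (n := τ.1.1 (Q.src h))
        (n' := ω.1.1 (Q.src h)) (y.1 (Q.tgt h)) (y.1 (Q.src h)) (y.2.2.1 h)).symm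

theorem splitExact_fam (y : L.Ind (unip p τ.1 ω.1)) (i : I) :
    SplitExact (L.famA y i) (L.famB y i) := by
  induction y using Quotient.inductionOn with
  | h y => exact splitExact_colW_rowT (m := τ.1.1 i) (m' := ω.1.1 i) (y.1 i)

/-- The short exact sequence `0 → W → V → T → 0` with the structure of representations given by
a rational point `[g, x]` of `E'`; its middle term is `g • x`. -/
def toRatSES (y : L.E1F τ ω) {x : Rep p (τ.1 + ω.1)} (hy : L.ev _ y.1 = x) :
    RatSES r τ.1 ω.1 x where
  quot := L.preT y.1
  sub := L.preW y.1
  ι := L.famA y.1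
  π := L.famB y.1
  isRatHom_ι := hy ▸ L.isRatHom_famA y
  isRatHom_π := hy ▸ L.isRatHom_famB y
  splitExact := L.splitExact_fam y.1

theorem stab_act_inv {x : Rep p (τ.1 + ω.1)} (s : RatSES r τ.1 ω.1 x) {g : Grp p (τ.1 + ω.1)}
    (hι : ∀ i, colW (m := τ.1.1 i) (m' := ω.1.1 i) (g i).1 = s.ι i)
    (hπ : ∀ i, rowT (m := τ.1.1 i) (m' := ω.1.1 i) (g i)⁻¹.1 = s.π i) : Stab (act g⁻¹ x) := by
  intro h
  change rowT (m := τ.1.1 _) (m' := ω.1.1 _) (g (Q.tgt h))⁻¹.1 * x h *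
    colW (m := τ.1.1 _) (m' := ω.1.1 _) ((g (Q.src h))⁻¹)⁻¹.1 = 0
  rw [inv_inv, hι, hπ, Matrix.mul_assoc, s.isRatHom_ι.comm, ← Matrix.mul_assoc,
    (s.splitExact _).mul_eq_zero, Matrix.zero_mul]

theorem exists_toRatSES_eq {x : Rep p (τ.1 + ω.1)} (hx : x ∈ L.carrier (τ + ω))
    (hF : frobRep r x = x) (s : RatSES r τ.1 ω.1 x) :
    ∃ (y : L.E1F τ ω) (hy : L.ev _ y.1 = x), L.toRatSES y hy = s := by
  choose g hι hπ using fun i =>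
    SplitExact.exists_colW_rowT (m := τ.1.1 i) (m' := ω.1.1 i) (s.splitExact i)
  let g' : Grp p (τ.1 + ω.1) := g
  let y : L.Ind (unip p τ.1 ω.1) :=
    Quotient.mk _ (g', ⟨act g'⁻¹ x, stab_act_inv s hι hπ, L.act_mem _ _ _ hx⟩)
  have hev : L.ev _ y = x := by
    change act g' (act g'⁻¹ x) = x
    rw [← act_mul, mul_inv_cancel, act_one]
  have hA : L.famA y = s.ι := funext hι
  have hB : L.famB y = s.π := funext hπ
  have hy : L.frobInd _ (fun _ => frobGrp_unip r) y = y := by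
    refine L.fam_inj _ _ ?_ ?_ ?_
    · rw [L.ev_frob, hev, hF]
    · rw [(L.fam_frob y).1, hA]
      exact frobFam_eq_self_iff.2 s.isRatHom_ι.frob
    · rw [(L.fam_frob y).2, hB]
      exact frobFam_eq_self_iff.2 s.isRatHom_π.frob
  exact ⟨⟨y, hy⟩, hev, RatSES.ext_of_maps hA hB⟩

theorem mem_of_ratSES {x : Rep p (τ.1 + ω.1)} (hx : x ∈ L.carrier (τ + ω))
    (hF : frobRep r x = x) (s : RatSES r τ.1 ω.1 x) :
    s.quot ∈ L.carrier τ ∧ s.sub ∈ L.carrier ω := by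
  obtain ⟨y, hy, rfl⟩ := L.exists_toRatSES_eq hx hF s
  exact L.pre_mem y.1

theorem ev_eq_p3_p2 (y : L.E1F τ ω) : L.ev _ y.1 = (L.p3 (L.p2 y)).1 := by
  change L.ev _ y.1 = L.ev _ (L.proj y.1)
  induction y.1 using Quotient.inductionOn with
  | h y => rfl

/-- The fibre of `p₃ p₂` over a rational point `x` is the set of rational short exact sequences
with middle term `x`. -/
def fibreEquiv (x : Pts r (L.carrier (τ + ω))) :
    {y : L.E1F τ ω // L.p3 (L.p2 y) = x} ≃ RatSES r (ν := τ.1 + ω.1) τ.1 ω.1 x.1 :=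
  Equiv.ofBijective
    (fun y => L.toRatSES y.1 ((L.ev_eq_p3_p2 y.1).trans (congrArg Subtype.val y.2)))
    (by
      constructor
      · intro y z h
        refine Subtype.ext (Subtype.ext (L.fam_inj _ _ ?_ (congrArg RatSES.ι h)
          (congrArg RatSES.π h)))
        rw [ev_eq_p3_p2, ev_eq_p3_p2, y.2, z.2]
      · intro s
        obtain ⟨y, hy, rfl⟩ := L.exists_toRatSES_eq x.2.1 x.2.2 s
        exact ⟨⟨y, Subtype.ext ((L.ev_eq_p3_p2 y).symm.trans hy)⟩, rfl⟩)

end Locus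

section Product

variable {k : Type*} [Field k]

theorem push_push {X Y Z : Type*} [Finite X] (φ : X → Y) (ψ : Y → Z) (f : X → k) :
    push ψ (push φ f) = push (ψ ∘ φ) f := by
  funext z
  let J : Set Y := ψ ⁻¹' {z} ∩ Set.range φ
  have hJ : ⋃ y ∈ J, φ ⁻¹' {y} = ψ ∘ φ ⁻¹' {z} := by
    ext x
    simp [J]
  have hdisj : J.PairwiseDisjoint fun y => φ ⁻¹' {y} := fun y _ y' _ hne =>
    Set.disjoint_left.2 fun x hx hx' => hne (hx.symm.trans hx')
  rw [push, push, ← hJ, finsum_mem_biUnion hdisj ((Set.finite_range φ).inter_of_right _)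
    fun _ _ => Set.toFinite _]
  refine finsum_mem_inter_support_eq' _ _ _ fun y hy => ⟨fun h => ⟨h, ?_⟩, fun h => h.1⟩
  obtain ⟨x, hx, -⟩ := exists_ne_zero_of_finsum_mem_ne_zero hy
  exact ⟨x, hx⟩

open Classical in
/-- The extension by zero of a function on rational points to the whole representation space. -/
def zeroExt {ν : Q.DimVec} {X : Set (Rep p ν)} (f : Pts r X → k) (x : Rep p ν) : k :=
  if h : x ∈ X ∧ frobRep r x = x then f ⟨x, h⟩ else 0

theorem zeroExt_apply {ν : Q.DimVec} {X : Set (Rep p ν)} (f : Pts r X → k) (x : Pts r X) :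
    zeroExt f x.1 = f x := dif_pos x.2

theorem zeroExt_of_notMem {ν : Q.DimVec} {X : Set (Rep p ν)} (f : Pts r X → k) {x : Rep p ν}
    (hx : x ∉ X) : zeroExt f x = 0 := dif_neg fun h => hx h.1

theorem indFun_eq_finsum_ratSES [Finite I] [Finite Ω] [NeZero r] (L : Locus Q p r D) {τ ω : D}
    (f₁ : Pts r (L.carrier τ) → k) (f₂ : Pts r (L.carrier ω) → k)
    (x : Pts r (L.carrier (τ + ω))) :
    indFun L f₁ f₂ x = ∑ᶠ s : RatSES r (ν := τ.1 + ω.1) τ.1 ω.1 x.1,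
      zeroExt f₁ s.quot * zeroExt f₂ s.sub := by
  have := L.finite_E1F (τ := τ) (ω := ω)
  rw [indFun, push_push, push, ← finsum_set_coe_eq_finsum_mem,
    ← finsum_comp_equiv (L.fibreEquiv x)]
  refine finsum_congr fun y => ?_
  rw [← zeroExt_apply f₁, ← zeroExt_apply f₂]
  rfl

end Product

/-! ## Multiplicativity of restriction and extension by zero -/

section Loci

variable {D : AddSubmonoid Q.DimVec} {k : Type*} [Field k]

theorem zeroExt_extZero {ν : Q.DimVec} (X : Set (Rep p ν))
    (hX : ∀ (g : Grp p ν) x, x ∈ X → act g x ∈ X) (f : InvFun r k X) :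
    zeroExt (extZero X hX f).1 = zeroExt f.1 := by
  funext x
  by_cases hF : frobRep r x = x
  · refine (zeroExt_apply (extZero X hX f).1 ⟨x, trivial, hF⟩).trans ?_
    by_cases hx : x ∈ X
    · exact (dif_pos hx).trans (zeroExt_apply f.1 ⟨x, hx, hF⟩).symm
    · exact (dif_neg hx).trans (zeroExt_of_notMem f.1 hx).symm
  · rw [zeroExt, zeroExt, dif_neg fun h => hF h.2, dif_neg fun h => hF h.2]

theorem zeroExt_restr {ν : Q.DimVec} (X : Set (Rep p ν))
    (f : InvFun r k (Set.univ : Set (Rep p ν))) {x : Rep p ν} (hx : x ∈ X) :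
    zeroExt (restr X f).1 x = zeroExt f.1 x := by
  by_cases hF : frobRep r x = x
  · exact (zeroExt_apply (restr X f).1 ⟨x, hx, hF⟩).trans
      (zeroExt_apply f.1 ⟨x, trivial, hF⟩).symm
  · rw [zeroExt, zeroExt, dif_neg fun h => hF h.2, dif_neg fun h => hF h.2]

/-- A locus is closed under extensions if the middle term of a short exact sequence is in the
locus when the outer terms are. The definition of a locus includes the converse implication. -/
def Locus.ExtClosed (L : Locus Q p r D) : Prop :=
  ∀ (τ ω : D) (x : Rep p (τ.1 + ω.1)) (s : RatSES r τ.1 ω.1 x),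
    s.quot ∈ L.carrier τ → s.sub ∈ L.carrier ω → x ∈ L.carrier (τ + ω)

theorem heart_extClosed : (heart Q p r c).ExtClosed := fun _ _ _ s ht hw h hh =>
  (s.splitExact (Q.src h)).isIsoMat_of_outer (s.splitExact (Q.tgt h)) (s.isRatHom_ι.comm h)
    (s.isRatHom_π.comm h) (ht h hh) (hw h hh)

variable [NeZero r] {L : Locus Q p r D} {τ ω : D}

theorem indFun_extZero [Finite I] [Finite Ω] (hL : L.ExtClosed)
    (f₁ : InvFun r k (L.carrier τ)) (f₂ : InvFun r k (L.carrier ω)) :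
    indFun (fullLocus Q p r D) (extZero (L.carrier τ) (L.act_mem τ) f₁).1
        (extZero (L.carrier ω) (L.act_mem ω) f₂).1 =
      (extZero (L.carrier (τ + ω)) (L.act_mem _) ⟨indFun L f₁.1 f₂.1, indFun_inv L _ _⟩).1 := by
  funext x
  refine (indFun_eq_finsum_ratSES (fullLocus Q p r D) _ _ x).trans ?_
  refine (finsum_congr fun s => congrArg₂ (· * ·)
    (congrFun (zeroExt_extZero _ (L.act_mem τ) f₁) (RatSES.quot s))
    (congrFun (zeroExt_extZero _ (L.act_mem ω) f₂) (RatSES.sub s))).trans ?_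
  by_cases hx : x.1 ∈ L.carrier (τ + ω)
  · refine Eq.trans ?_ (dif_pos hx).symm
    exact (indFun_eq_finsum_ratSES L f₁.1 f₂.1 ⟨x.1, hx, x.2.2⟩).symm
  · refine Eq.trans ?_ (dif_neg hx).symm
    refine finsum_eq_zero_of_forall_eq_zero fun s => ?_
    by_cases hquot : RatSES.quot s ∈ L.carrier τ
    · exact mul_eq_zero_of_right _
        (zeroExt_of_notMem f₂.1 fun hsub => hx (hL _ _ _ s hquot hsub))
    · exact mul_eq_zero_of_left (zeroExt_of_notMem f₁.1 hquot) _

variable [Fintype I] [Fintype Ω] (v : k)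

variable (L) in
theorem restr_hallMul (f₁ : HallPart v (fullLocus Q p r D) τ)
    (f₂ : HallPart v (fullLocus Q p r D) ω) :
    (restr (L.carrier (τ + ω)) (hallMul v (fullLocus Q p r D) f₁ f₂) : HallPart v L (τ + ω)) =
      hallMul v L (restr (L.carrier τ) f₁ : HallPart v L τ)
        (restr (L.carrier ω) f₂ : HallPart v L ω) := by
  refine Subtype.ext (funext fun x => congrArg
    ((v⁻¹ ^ mExp τ.1 ω.1 * ((cardG p r τ.1 * cardG p r ω.1 : ℕ) : k)⁻¹) * ·) ?_)
  refine (indFun_eq_finsum_ratSES (fullLocus Q p r D) f₁.1 f₂.1 ⟨x.1, trivial, x.2.2⟩).trans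
    (Eq.trans ?_ (indFun_eq_finsum_ratSES L _ _ x).symm)
  refine finsum_congr fun s => ?_
  obtain ⟨hquot, hsub⟩ := L.mem_of_ratSES x.2.1 x.2.2 s
  exact (congrArg₂ (· * ·) (zeroExt_restr (L.carrier τ) f₁ hquot)
    (zeroExt_restr (L.carrier ω) f₂ hsub)).symm

theorem extZero_hallMul (hL : L.ExtClosed) (f₁ : HallPart v L τ) (f₂ : HallPart v L ω) :
    (extZero (L.carrier (τ + ω)) (L.act_mem _) (hallMul v L f₁ f₂) :
      HallPart v (fullLocus Q p r D) (τ + ω)) =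
      hallMul v (fullLocus Q p r D)
        (extZero (L.carrier τ) (L.act_mem _) f₁ : HallPart v (fullLocus Q p r D) τ)
        (extZero (L.carrier ω) (L.act_mem _) f₂ : HallPart v (fullLocus Q p r D) ω) := by
  refine Subtype.ext (Eq.trans ?_ (congrArg
    ((v⁻¹ ^ mExp τ.1 ω.1 * ((cardG p r τ.1 * cardG p r ω.1 : ℕ) : k)⁻¹) • ·)
    (indFun_extZero hL f₁ f₂).symm))
  exact congrArg Subtype.val (map_smul (extZero (L.carrier (τ + ω)) (L.act_mem _)) _
    (⟨indFun L f₁.1 f₂.1, indFun_inv L _ _⟩ : InvFun r k (L.carrier (τ + ω))))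

end Loci

/-! ## Vertices and edges of the contracted quiver -/

theorem exists_mem_conE_tgt_eq {i : I} (hi : i ∈ Q.minus c) : ∃ h ∈ Q.conE c, Q.tgt h = i := by
  obtain ⟨n, rfl⟩ := hi
  exact ⟨_, ⟨n, rfl⟩, tgt_pow n c⟩

theorem image_tgt_conE : Q.tgt '' Q.conE c = Q.minus c := by
  ext i
  exact ⟨by rintro ⟨h, hh, rfl⟩; exact tgt_mem_minus hh, exists_mem_conE_tgt_eq⟩

/-- The contracted edge that ends at a given vertex of `[i₋]`. -/
def conEdge {i : I} (hi : i ∈ Q.minus c) : Ω := (exists_mem_conE_tgt_eq hi).choose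

theorem conEdge_mem {i : I} (hi : i ∈ Q.minus c) : conEdge hi ∈ Q.conE c :=
  (exists_mem_conE_tgt_eq hi).choose_spec.1

theorem tgt_conEdge {i : I} (hi : i ∈ Q.minus c) : Q.tgt (conEdge hi) = i :=
  (exists_mem_conE_tgt_eq hi).choose_spec.2

/-- The edge `h` or `l` from which the edge `h`, `l h` or `h̄ l` of the contracted quiver is
made. -/
def HatE.base : HatE Q c → Ω
  | .old h _ _ => h
  | .post l _ _ _ => l
  | .pre _ l _ _ _ => l

open Classical in
/-- The edge of the contracted quiver made from an edge that is not contracted. -/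
def edgeOf (l : Ω) (hl : l ∉ Q.conE c) : HatE Q c :=
  if hs : Q.src l ∈ Q.minus c then .post l (conEdge hs) (conEdge_mem hs) (tgt_conEdge hs)
  else if ht : Q.tgt l ∈ Q.minus c then .pre (conEdge ht) l (conEdge_mem ht) hl (tgt_conEdge ht)
  else .old l hs ht

theorem edgeOf_base (l : Ω) (hl : l ∉ Q.conE c) : (edgeOf l hl).base = l := by
  rw [edgeOf]
  split_ifs <;> rfl

theorem Contractible.injOn_tgt [Finite Ω] (hc : Q.Contractible c) :
    Set.InjOn Q.tgt (Q.conE c) :=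
  Set.injOn_of_ncard_image_eq (by rw [image_tgt_conE, hc.card_conE, hc.card_eq]) (Set.toFinite _)

theorem conEdge_eq [Finite Ω] (hc : Q.Contractible c) {i : I} (hi : i ∈ Q.minus c) {h : Ω}
    (hh : h ∈ Q.conE c) (e : Q.tgt h = i) : conEdge hi = h :=
  hc.injOn_tgt (conEdge_mem hi) hh ((tgt_conEdge hi).trans e.symm)

section

variable (hQ : Q.Admissible) (hc : Q.Contractible c)

open Classical in
/-- The projection to the vertices of the contracted quiver that moves the end of a contracted
edge to its source. -/
def vertexMap (i : I) : HatV Q c :=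
  if hi : i ∈ Q.minus c then ⟨Q.src (conEdge hi), src_notMem hQ hc (conEdge_mem hi)⟩ else ⟨i, hi⟩

theorem vertexMap_of_notMem {i : I} (hi : i ∉ Q.minus c) : vertexMap hQ hc i = ⟨i, hi⟩ :=
  dif_neg hi

theorem vertexMap_coe (i : HatV Q c) : vertexMap hQ hc i.1 = i := dif_neg i.2

include hQ hc in
theorem HatE.base_notMem (e : HatE Q c) : e.base ∉ Q.conE c := by
  cases e with
  | old h hs ht => exact fun hh => ht (tgt_mem_minus hh)
  | post l h hh e => exact fun hl => src_notMem hQ hc hl (e ▸ tgt_mem_minus hh)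
  | pre h l hh hl e => exact hl

theorem base_aE (e : HatE Q c) : ((Q.contract c hQ hc).aE e).base = Q.aE e.base := by
  cases e <;> rfl

variable [Finite Ω]

theorem vertexMap_tgt {h : Ω} (hh : h ∈ Q.conE c) :
    vertexMap hQ hc (Q.tgt h) = ⟨Q.src h, src_notMem hQ hc hh⟩ := by
  rw [vertexMap, dif_pos (tgt_mem_minus hh)]
  exact Subtype.ext (congrArg Q.src (conEdge_eq hc _ hh rfl))

include hQ hc in
theorem HatE.edgeOf_base_eq (e : HatE Q c) (he : e.base ∉ Q.conE c) : edgeOf e.base he = e := by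
  cases e with
  | old h hs ht => exact (dif_neg hs).trans (dif_neg ht)
  | post l h hh e =>
    have hs : Q.src l ∈ Q.minus c := e ▸ tgt_mem_minus hh
    refine (dif_pos hs).trans ?_
    simp only [HatE.base, conEdge_eq hc hs hh e]
  | pre h l hh hl e =>
    have ht : Q.tgt l ∈ Q.minus c := e ▸ tgt_mem_minus hh
    have hs : Q.src l ∉ Q.minus c := fun hs => not_both hQ hc hs ht
    refine (dif_neg hs).trans ((dif_pos ht).trans ?_)
    simp only [HatE.base, conEdge_eq hc ht hh e]

/-- The edges of the contracted quiver correspond to the edges that are not contracted. -/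
def edgeEquiv : HatE Q c ≃ {l : Ω // l ∉ Q.conE c} where
  toFun e := ⟨e.base, e.base_notMem hQ hc⟩
  invFun l := edgeOf l.1 l.2
  left_inv e := e.edgeOf_base_eq hQ hc _
  right_inv l := Subtype.ext (edgeOf_base l.1 l.2)

theorem vertexMap_src_base (e : HatE Q c) :
    vertexMap hQ hc (Q.src e.base) = (Q.contract c hQ hc).src e := by
  cases e with
  | old h hs ht => exact vertexMap_of_notMem hQ hc hs
  | post l h hh e =>
    change vertexMap hQ hc (Q.src l) = _
    rw [← e, vertexMap_tgt hQ hc hh]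
    rfl
  | pre h l hh hl e =>
    exact vertexMap_of_notMem hQ hc fun hs => not_both hQ hc hs (e ▸ tgt_mem_minus hh)

theorem vertexMap_tgt_base (e : HatE Q c) :
    vertexMap hQ hc (Q.tgt e.base) = (Q.contract c hQ hc).tgt e := by
  cases e with
  | old h hs ht => exact vertexMap_of_notMem hQ hc ht
  | post l h hh e => exact vertexMap_of_notMem hQ hc (not_both hQ hc (e ▸ tgt_mem_minus hh))
  | pre h l hh hl e =>
    change vertexMap hQ hc (Q.tgt l) = _
    rw [← e, vertexMap_tgt hQ hc hh]
    rfl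

theorem vertexMap_aV (i : I) :
    vertexMap hQ hc (Q.aV i) = (Q.contract c hQ hc).aV (vertexMap hQ hc i) := by
  by_cases hi : i ∈ Q.minus c
  · obtain ⟨h, hh, rfl⟩ := exists_mem_conE_tgt_eq hi
    rw [← Q.tgt_aE, vertexMap_tgt hQ hc ((aE_conE h).2 hh), vertexMap_tgt hQ hc hh]
    exact Subtype.ext (Q.src_aE h)
  · rw [vertexMap_of_notMem hQ hc hi, vertexMap_of_notMem hQ hc (fun h => hi ((aV_minus i).1 h))]
    rfl

theorem dim_vertexMap (ν : Q.balanced c) (i : I) :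
    (hatDim hQ hc ν).1 (vertexMap hQ hc i) = ν.1.1 i := by
  by_cases hi : i ∈ Q.minus c
  · obtain ⟨h, hh, rfl⟩ := exists_mem_conE_tgt_eq hi
    rw [vertexMap_tgt hQ hc hh]
    exact (dim_conE ν hh).symm
  · rw [vertexMap_of_notMem hQ hc hi]
    rfl

theorem dim_src_base (ν : Q.balanced c) (e : HatE Q c) :
    (hatDim hQ hc ν).1 ((Q.contract c hQ hc).src e) = ν.1.1 (Q.src e.base) := by
  rw [← vertexMap_src_base, dim_vertexMap]

theorem dim_tgt_base (ν : Q.balanced c) (e : HatE Q c) :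
    (hatDim hQ hc ν).1 ((Q.contract c hQ hc).tgt e) = ν.1.1 (Q.tgt e.base) := by
  rw [← vertexMap_tgt_base, dim_vertexMap]

end

/-! ## Extension of representations of the contracted quiver -/

section Extension

variable {ν μ : Q.balanced c}

/-- The matrices of a representation at the contracted edges are identity matrices. -/
def IsIdOnConE (x : Rep p ν.1) : Prop := ∀ h (hh : h ∈ Q.conE c), x h = recast rfl (dim_conE ν hh) 1

theorem IsIdOnConE.mem_heart {x : Rep p ν.1} (hx : IsIdOnConE x) :
    x ∈ (heart Q p r c).carrier ν := fun h hh => hx h hh ▸ isIsoMat_recast_one _ _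

theorem IsIdOnConE.apply_mul {x : Rep p ν.1} (hx : IsIdOnConE x) {h : Ω} (hh : h ∈ Q.conE c)
    {n : ℕ} (y : Matrix (Fin (ν.1.1 (Q.src h))) (Fin n) (Kbar p)) :
    x h * y = recast (dim_conE ν hh).symm rfl y := by
  rw [hx h hh]
  exact recast_one_mul _ _ _

theorem IsIdOnConE.mul_apply {x : Rep p ν.1} (hx : IsIdOnConE x) {h : Ω} (hh : h ∈ Q.conE c)
    {n : ℕ} (y : Matrix (Fin n) (Fin (ν.1.1 (Q.tgt h))) (Kbar p)) :
    y * x h = recast rfl (dim_conE ν hh) y := by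
  rw [hx h hh]
  exact mul_recast_one _ _ _

theorem IsIdOnConE.isoInv_apply_mul {x : Rep p ν.1} (hx : IsIdOnConE x) {h : Ω}
    (hh : h ∈ Q.conE c) {n : ℕ} (y : Matrix (Fin (ν.1.1 (Q.tgt h))) (Fin n) (Kbar p)) :
    isoInv (x h) * y = recast (dim_conE ν hh) rfl y := by
  rw [hx h hh, isoInv_recast, isoInv_eq (Matrix.one_mul 1) (Matrix.one_mul 1)]
  exact recast_one_mul _ _ _

theorem IsIdOnConE.tgt_eq_recast_src {y : Rep p μ.1} {x : Rep p ν.1} {z : Fam p ν.1.1 μ.1.1}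
    (hy : IsIdOnConE y) (hx : IsIdOnConE x) (hz : IsRatHom r z y x) {h : Ω} (hh : h ∈ Q.conE c) :
    z (Q.tgt h) = recast (dim_conE ν hh).symm (dim_conE μ hh).symm (z (Q.src h)) := by
  have hcomm := hz.comm h
  rw [hx.apply_mul hh, hy.mul_apply hh] at hcomm
  rw [← recast_inj (hm := rfl) (hn := dim_conE μ hh) (hm₁ := rfl) (hn₁ := dim_conE μ hh),
    ← hcomm, recast_recast]

variable (hQ : Q.Admissible) (hc : Q.Contractible c)

include hQ hc in
theorem IsIdOnConE.eq_of_act_eq_act {x x' : Rep p ν.1} (hx : IsIdOnConE x)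
    (hx' : IsIdOnConE x') {X X' : Grp p ν.1} (hX : ∀ i ∉ Q.minus c, X i = 1)
    (hX' : ∀ i ∉ Q.minus c, X' i = 1) (h : act X x = act X' x') : X = X' := by
  funext i
  by_cases hi : i ∈ Q.minus c
  · obtain ⟨l, hl, rfl⟩ := exists_mem_conE_tgt_eq hi
    have hs := src_notMem hQ hc hl
    have hl' := congrFun h l
    simp only [act, hX _ hs, hX' _ hs, inv_one, Units.val_one, Matrix.mul_one] at hl'
    rw [hx.mul_apply hl, hx'.mul_apply hl, recast_inj] at hl'
    exact Units.ext hl'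
  · rw [hX i hi, hX' i hi]

theorem IsIdOnConE.recast_contractRep [Finite Ω] {x : Rep p ν.1} (hx : IsIdOnConE x)
    (e : HatE Q c) : recast (dim_tgt_base hQ hc ν e) (dim_src_base hQ hc ν e)
      (contractRep hQ hc x e) = x e.base := by
  cases e with
  | old h hs ht => rfl
  | post l h hh e => exact congrArg (recast _ _) (hx.mul_apply hh (recast rfl _ (x l)))
  | pre h l hh hl e => exact congrArg (recast _ _) (hx.isoInv_apply_mul hh (recast _ rfl (x l)))

variable [Finite Ω]

/-- The extension of a family of matrices to the vertices of `[i₋]` by its values at the sources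
of the contracted edges. -/
def extFam (z : Fam p (hatDim hQ hc ν).1 (hatDim hQ hc μ).1) : Fam p ν.1.1 μ.1.1 := fun i =>
  recast (dim_vertexMap hQ hc ν i) (dim_vertexMap hQ hc μ i) (z (vertexMap hQ hc i))

/-- The restriction of a family of matrices to the vertices of the contracted quiver. -/
def resFam (z : Fam p ν.1.1 μ.1.1) : Fam p (hatDim hQ hc ν).1 (hatDim hQ hc μ).1 := fun i => z i.1

open Classical in
/-- The extension of a representation of the contracted quiver by identity matrices at the
contracted edges. -/
def extRep (x : Rep p (hatDim hQ hc ν)) : Rep p ν.1 := fun l =>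
  if hl : l ∈ Q.conE c then recast rfl (dim_conE ν hl) 1 else
    recast ((dim_tgt_base hQ hc ν _).trans (by rw [edgeOf_base]))
      ((dim_src_base hQ hc ν _).trans (by rw [edgeOf_base])) (x (edgeOf l hl))

variable {hQ hc}

theorem extFam_eq_recast (z : Fam p (hatDim hQ hc ν).1 (hatDim hQ hc μ).1) {i : I} {j : HatV Q c}
    (h : vertexMap hQ hc i = j) :
    extFam hQ hc z i =
      recast (h ▸ dim_vertexMap hQ hc ν i) (h ▸ dim_vertexMap hQ hc μ i) (z j) := by
  subst h; rfl

theorem resFam_extFam (z : Fam p (hatDim hQ hc ν).1 (hatDim hQ hc μ).1) :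
    resFam hQ hc (extFam hQ hc z) = z := funext fun i =>
  extFam_eq_recast z (vertexMap_coe hQ hc i)

theorem extFam_resFam (z : Fam p ν.1.1 μ.1.1)
    (h : ∀ l (hl : l ∈ Q.conE c), z (Q.tgt l) =
      recast (dim_conE ν hl).symm (dim_conE μ hl).symm (z (Q.src l))) :
    extFam hQ hc (resFam hQ hc z) = z := by
  funext i
  by_cases hi : i ∈ Q.minus c
  · obtain ⟨l, hl, rfl⟩ := exists_mem_conE_tgt_eq hi
    rw [extFam_eq_recast _ (vertexMap_tgt hQ hc hl), h l hl]
    rfl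
  · exact extFam_eq_recast _ (vertexMap_of_notMem hQ hc hi)

theorem extFam_tgt (z : Fam p (hatDim hQ hc ν).1 (hatDim hQ hc μ).1) {l : Ω} (hl : l ∈ Q.conE c) :
    extFam hQ hc z (Q.tgt l) =
      recast (dim_conE ν hl).symm (dim_conE μ hl).symm (extFam hQ hc z (Q.src l)) := by
  rw [extFam_eq_recast z (vertexMap_tgt hQ hc hl),
    extFam_eq_recast z (vertexMap_of_notMem hQ hc (src_notMem hQ hc hl))]
  rfl

theorem isIdOnConE_extRep (x : Rep p (hatDim hQ hc ν)) : IsIdOnConE (extRep hQ hc x) :=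
  fun _ hl => dif_pos hl

theorem extRep_base (x : Rep p (hatDim hQ hc ν)) (e : HatE Q c) :
    extRep hQ hc x e.base = recast (dim_tgt_base hQ hc ν e) (dim_src_base hQ hc ν e) (x e) := by
  have h := e.edgeOf_base_eq hQ hc (e.base_notMem hQ hc)
  rw [← recast_fam x h (by rw [h]) (by rw [h])]
  exact dif_neg (e.base_notMem hQ hc)

theorem contractRep_extRep (x : Rep p (hatDim hQ hc ν)) :
    contractRep hQ hc (extRep hQ hc x) = x := funext fun e =>
  recast_inj.1 (((isIdOnConE_extRep x).recast_contractRep hQ hc e).trans (extRep_base x e))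

theorem IsIdOnConE.extRep_contractRep {x : Rep p ν.1} (hx : IsIdOnConE x) :
    extRep hQ hc (contractRep hQ hc x) = x := by
  funext l
  by_cases hl : l ∈ Q.conE c
  · rw [hx l hl, isIdOnConE_extRep _ l hl]
  · rw [← edgeOf_base l hl, extRep_base, hx.recast_contractRep]

theorem frobRep_extRep {x : Rep p (hatDim hQ hc ν)} (hx : frobRep r x = x) :
    frobRep r (extRep hQ hc x) = extRep hQ hc x := by
  rw [frobRep_eq_self_iff] at hx ⊢
  intro l
  by_cases hl : l ∈ Q.conE c
  · rw [isIdOnConE_extRep x l hl, isIdOnConE_extRep x _ ((aE_conE l).2 hl)]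
    exact ((IsRecastMap.one (tgt_inv ν.1 l).symm).recast_left _ _).recast_right _ _
  · rw [← edgeOf_base l hl, ← base_aE hQ hc, extRep_base, extRep_base]
    exact ((hx _).recast_left _ _).recast_right _ _

end Extension

/-! ## The normal form of representations in the heart -/

variable (r c) in
/-- The rational points of the part of `G_V` at the vertices of `[i₋]`. -/
def ratMinusGrp (ν : Q.DimVec) : Subgroup (Grp p ν) :=
  ratGrp r ν ⊓ Subgroup.pi (Q.minus c)ᶜ fun _ => ⊥

instance [Finite I] [NeZero r] (ν : Q.DimVec) : Finite (ratMinusGrp (p := p) r c ν) :=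
  Set.Finite.subset (finite_ratGrp (p := p) (r := r) ν) inf_le_left

section NormalForm

variable {ν : Q.balanced c}

open Classical in
/-- The element of `G_V` with the isomorphisms `x_h`, for contracted edges `h`, as components at
the vertices of `[i₋]`, and `1` elsewhere. -/
def minusPart {x : Rep p ν.1} (hx : x ∈ (heart Q p r c).carrier ν) : Grp p ν.1 := fun i =>
  if hi : i ∈ Q.minus c then
    (isIsoMat_recast (congrArg ν.1.1 (tgt_conEdge hi))
      ((dim_conE ν (conEdge_mem hi)).symm.trans (congrArg ν.1.1 (tgt_conEdge hi)))
      (hx (conEdge hi) (conEdge_mem hi))).isUnit.unit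
  else 1

theorem minusPart_of_notMem {x : Rep p ν.1} (hx : x ∈ (heart Q p r c).carrier ν) {i : I}
    (hi : i ∉ Q.minus c) : minusPart hx i = 1 := dif_neg hi

theorem minusPart_tgt [Finite Ω] (hc : Q.Contractible c) {x : Rep p ν.1}
    (hx : x ∈ (heart Q p r c).carrier ν) {h : Ω} (hh : h ∈ Q.conE c) :
    (minusPart hx (Q.tgt h)).1 = recast rfl (dim_conE ν hh).symm (x h) := by
  have e := conEdge_eq hc (tgt_mem_minus hh) hh rfl
  rw [minusPart, dif_pos (tgt_mem_minus hh), IsUnit.unit_spec,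
    ← recast_fam x e (by rw [e]) (by rw [e]), recast_recast]

variable (hQ : Q.Admissible) (hc : Q.Contractible c)

theorem contractRep_act_of_mem_ratMinusGrp {X : Grp p ν.1} (hX : X ∈ ratMinusGrp r c ν.1)
    {x : Rep p ν.1} (hx : x ∈ (heart Q p r c).carrier ν) :
    contractRep hQ hc (act X x) = contractRep hQ hc x := by
  have : hatGrp hQ hc X = 1 := funext fun i => hX.2 i.1 i.2
  rw [contractRep_act hQ hc X x hx, this, act_one]

variable [Finite Ω]

include hc in
theorem minusPart_mem_ratMinusGrp {x : Rep p ν.1} (hx : x ∈ (heart Q p r c).carrier ν)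
    (hF : frobRep r x = x) : minusPart hx ∈ ratMinusGrp r c ν.1 := by
  refine ⟨mem_ratGrp_iff.2 fun i => ?_, fun i hi => minusPart_of_notMem hx hi⟩
  by_cases hi : i ∈ Q.minus c
  · obtain ⟨h, hh, rfl⟩ := exists_mem_conE_tgt_eq hi
    refine IsRecastMap.congr_index (z := fun i => (minusPart hx i).1) ?_ (Q.tgt_aE h)
    rw [minusPart_tgt hc hx hh, minusPart_tgt hc hx ((aE_conE h).2 hh)]
    exact ((frobRep_eq_self_iff.1 hF h).recast_left _ _).recast_right _ _
  · rw [minusPart_of_notMem hx hi, minusPart_of_notMem hx fun h => hi ((aV_minus i).1 h)]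
    exact IsRecastMap.one (ν.1.2 i).symm

include hQ hc in
theorem isIdOnConE_act_minusPart_inv {x : Rep p ν.1} (hx : x ∈ (heart Q p r c).carrier ν) :
    IsIdOnConE (act (minusPart hx)⁻¹ x) := by
  intro h hh
  have hsrc : (minusPart hx (Q.src h)).1 = 1 :=
    congrArg Units.val (minusPart_of_notMem hx (src_notMem hQ hc hh))
  calc (minusPart hx (Q.tgt h))⁻¹.1 * x h * ((minusPart hx)⁻¹ (Q.src h))⁻¹.1
      = (minusPart hx (Q.tgt h))⁻¹.1 * x h := by
        rw [Pi.inv_apply, inv_inv, hsrc, Matrix.mul_one]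
    _ = recast rfl (dim_conE ν hh)
          ((minusPart hx (Q.tgt h))⁻¹.1 * (minusPart hx (Q.tgt h)).1) := by
        rw [minusPart_tgt hc hx hh, recast_mul rfl rfl, recast_recast]
        rfl
    _ = recast rfl (dim_conE ν hh) 1 := by rw [Units.inv_mul]

theorem exists_act_extRep_contractRep_eq {x : Rep p ν.1} (hx : x ∈ (heart Q p r c).carrier ν)
    (hF : frobRep r x = x) :
    ∃ X ∈ ratMinusGrp r c ν.1, act X (extRep hQ hc (contractRep hQ hc x)) = x := by
  have hX := minusPart_mem_ratMinusGrp hc hx hF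
  refine ⟨minusPart hx, hX, ?_⟩
  rw [← contractRep_act_of_mem_ratMinusGrp hQ hc (inv_mem hX) hx,
    (isIdOnConE_act_minusPart_inv hQ hc hx).extRep_contractRep, ← act_mul, mul_inv_cancel, act_one]

variable {hQ hc}

theorem contractRep_act_extRep {X : Grp p ν.1} (hX : X ∈ ratMinusGrp r c ν.1)
    (x : Rep p (hatDim hQ hc ν)) : contractRep hQ hc (act X (extRep hQ hc x)) = x := by
  rw [contractRep_act_of_mem_ratMinusGrp hQ hc hX (isIdOnConE_extRep x).mem_heart,
    contractRep_extRep]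

theorem act_extRep_inj {X X' : Grp p ν.1} (hX : X ∈ ratMinusGrp r c ν.1)
    (hX' : X' ∈ ratMinusGrp r c ν.1) {x x' : Rep p (hatDim hQ hc ν)} :
    act X (extRep hQ hc x) = act X' (extRep hQ hc x') ↔ X = X' ∧ x = x' := by
  refine ⟨fun h => ⟨?_, ?_⟩, by rintro ⟨rfl, rfl⟩; rfl⟩
  · exact (isIdOnConE_extRep x).eq_of_act_eq_act hQ hc (isIdOnConE_extRep x') hX.2 hX'.2 h
  · rw [← contractRep_act_extRep hX x, h, contractRep_act_extRep hX' x']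

end NormalForm

/-! ## Rational points of the group of the contracted quiver -/

section Groups

variable (hQ : Q.Admissible) (hc : Q.Contractible c) {ν : Q.balanced c}

open Classical in
/-- The element of `G_V` with the components of `a` at `[i₋]` and of `g` elsewhere. -/
def glueGrp (g : Grp p (hatDim hQ hc ν)) (a : Grp p ν.1) : Grp p ν.1 := fun i =>
  if hi : i ∈ Q.minus c then a i else g ⟨i, hi⟩

theorem glueGrp_of_mem (g : Grp p (hatDim hQ hc ν)) (a : Grp p ν.1) {i : I}
    (hi : i ∈ Q.minus c) : glueGrp hQ hc g a i = a i := dif_pos hi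

theorem glueGrp_of_notMem (g : Grp p (hatDim hQ hc ν)) (a : Grp p ν.1) {i : I}
    (hi : i ∉ Q.minus c) : glueGrp hQ hc g a i = g ⟨i, hi⟩ := dif_neg hi

theorem glueGrp_mem_ratGrp {g : Grp p (hatDim hQ hc ν)} {a : Grp p ν.1}
    (hg : g ∈ ratGrp r (hatDim hQ hc ν)) (ha : a ∈ ratGrp r ν.1) :
    glueGrp hQ hc g a ∈ ratGrp r ν.1 := by
  refine mem_ratGrp_iff.2 fun i => ?_
  by_cases hi : i ∈ Q.minus c
  · rw [glueGrp_of_mem hQ hc g a hi, glueGrp_of_mem hQ hc g a ((aV_minus i).2 hi)]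
    exact mem_ratGrp_iff.1 ha i
  · rw [glueGrp_of_notMem hQ hc g a hi,
      glueGrp_of_notMem hQ hc g a fun h => hi ((aV_minus i).1 h)]
    exact mem_ratGrp_iff.1 hg ⟨i, hi⟩

variable (r ν) in
/-- A rational element of `G_V` consists of its components away from `[i₋]`, which are the
components of an element for the contracted quiver, and of its components at `[i₋]`. -/
def ratGrpEquiv :
    ratGrp (p := p) r ν.1 ≃ ratGrp (p := p) r (hatDim hQ hc ν) × ratMinusGrp (p := p) r c ν.1 where
  toFun g :=
    have hg : hatGrp hQ hc g.1 ∈ ratGrp r (hatDim hQ hc ν) :=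
      (hatGrp_frob hQ hc g.1).trans (congrArg _ g.2)
    (⟨hatGrp hQ hc g.1, hg⟩, ⟨glueGrp hQ hc 1 g.1, glueGrp_mem_ratGrp hQ hc (one_mem _) g.2,
      fun _ hi => glueGrp_of_notMem hQ hc _ _ hi⟩)
  invFun y := ⟨glueGrp hQ hc y.1.1 y.2.1, glueGrp_mem_ratGrp hQ hc y.1.2 y.2.2.1⟩
  left_inv g := Subtype.ext <| funext fun i => by
    by_cases hi : i ∈ Q.minus c
    · exact (glueGrp_of_mem hQ hc _ _ hi).trans (glueGrp_of_mem hQ hc _ _ hi)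
    · exact glueGrp_of_notMem hQ hc _ _ hi
  right_inv y := by
    refine Prod.ext (Subtype.ext (funext fun i => glueGrp_of_notMem hQ hc _ _ i.2))
      (Subtype.ext (funext fun i => ?_))
    by_cases hi : i ∈ Q.minus c
    · exact (glueGrp_of_mem hQ hc _ _ hi).trans (glueGrp_of_mem hQ hc _ _ hi)
    · exact (glueGrp_of_notMem hQ hc _ _ hi).trans (y.2.2.2 i hi).symm

theorem cardG_eq (ν : Q.balanced c) :
    cardG p r ν.1 = cardG p r (hatDim hQ hc ν) * Nat.card (ratMinusGrp (p := p) r c ν.1) :=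
  (Nat.card_congr (ratGrpEquiv r hQ hc ν)).trans (Nat.card_prod _ _)

end Groups

/-! ## Short exact sequences of representations of the contracted quiver -/

namespace RatSES

variable {ν τ ω : Q.DimVec} {x : Rep p ν} {g : Grp p ν} {a : Grp p τ} {b : Grp p ω}

theorem twist_injective (ha : a ∈ ratGrp r τ) (hb : b ∈ ratGrp r ω) (hg : g ∈ ratGrp r ν) :
    Function.Injective fun s : RatSES r τ ω x => s.twist ha hb hg := by
  intro s s' h
  refine ext_of_maps (funext fun i => ?_) (funext fun i => ?_)
  · have hi : (g i).1 * s.ι i * (b⁻¹ i).1 = (g i).1 * s'.ι i * (b⁻¹ i).1 :=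
      congrFun (congrArg RatSES.ι h) i
    rw [← inv_mul_mul_mul_inv (g i) (b i)⁻¹ (s.ι i), ← inv_mul_mul_mul_inv (g i) (b i)⁻¹ (s'.ι i)]
    exact congrArg (fun z => (g i)⁻¹.1 * z * (b i)⁻¹⁻¹.1) hi
  · have hi : (a i).1 * s.π i * (g⁻¹ i).1 = (a i).1 * s'.π i * (g⁻¹ i).1 :=
      congrFun (congrArg RatSES.π h) i
    rw [← inv_mul_mul_mul_inv (a i) (g i)⁻¹ (s.π i), ← inv_mul_mul_mul_inv (a i) (g i)⁻¹ (s'.π i)]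
    exact congrArg (fun z => (a i)⁻¹.1 * z * (g i)⁻¹⁻¹.1) hi

theorem exists_twist_eq (ha : a ∈ ratGrp r τ) (hb : b ∈ ratGrp r ω) (hg : g ∈ ratGrp r ν)
    (S : RatSES r τ ω (act g x)) {t : Rep p τ} {w : Rep p ω} (ht : S.quot = act a t)
    (hw : S.sub = act b w) :
    ∃ s : RatSES r τ ω x, s.quot = t ∧ s.sub = w ∧ s.twist ha hb hg = S := by
  have hι := S.isRatHom_ι.act (inv_mem hg) (inv_mem hb)
  have hπ := S.isRatHom_π.act (inv_mem ha) (inv_mem hg)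
  rw [← act_mul, inv_mul_cancel, act_one] at hι hπ
  rw [hw, ← act_mul, inv_mul_cancel, act_one] at hι
  rw [ht, ← act_mul, inv_mul_cancel, act_one] at hπ
  refine ⟨⟨t, w, _, _, hι, hπ, fun i => (S.splitExact i).conj (g i)⁻¹ (a i)⁻¹ (b i)⁻¹⟩, rfl, rfl,
    ext_of_maps (funext fun i => ?_) (funext fun i => ?_)⟩
  · exact inv_mul_mul_mul_inv (g i)⁻¹ (b i) (S.ι i)
  · exact inv_mul_mul_mul_inv (a i)⁻¹ (g i) (S.π i)

end RatSES

section Extension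

variable {hQ : Q.Admissible} {hc : Q.Contractible c} [Finite Ω]

variable {ν μ : Q.balanced c} {y : Rep p (hatDim hQ hc μ)} {x : Rep p (hatDim hQ hc ν)}

theorem comm_base_iff (z : Fam p (hatDim hQ hc ν).1 (hatDim hQ hc μ).1) (e : HatE Q c) :
    extRep hQ hc x e.base * extFam hQ hc z (Q.src e.base) =
        extFam hQ hc z (Q.tgt e.base) * extRep hQ hc y e.base ↔
      x e * z ((Q.contract c hQ hc).src e) = z ((Q.contract c hQ hc).tgt e) * y e := by
  rw [extRep_base, extRep_base, extFam_eq_recast z (vertexMap_src_base hQ hc e),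
    extFam_eq_recast z (vertexMap_tgt_base hQ hc e), recast_mul_recast, recast_mul_recast,
    recast_inj]

namespace IsRatHom

theorem extFam {z : Fam p (hatDim hQ hc ν).1 (hatDim hQ hc μ).1} (hz : IsRatHom r z y x) :
    IsRatHom r (extFam hQ hc z) (extRep hQ hc y) (extRep hQ hc x) where
  comm l := by
    by_cases hl : l ∈ Q.conE c
    · rw [(isIdOnConE_extRep x).apply_mul hl, (isIdOnConE_extRep y).mul_apply hl,
        extFam_tgt z hl, recast_recast]
    · have := (comm_base_iff z (edgeOf l hl)).2 (hz.comm _)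
      rwa [edgeOf_base] at this
  frob i := ((IsRecastMap.congr_index (hz.frob _) (vertexMap_aV hQ hc i).symm).recast_left
    _ _).recast_right _ _

theorem extFam_resFam {z : Fam p ν.1.1 μ.1.1}
    (hz : IsRatHom r z (extRep hQ hc y) (extRep hQ hc x)) :
    AutQuiver.extFam hQ hc (resFam hQ hc z) = z :=
  AutQuiver.extFam_resFam z fun _ hl =>
    (isIdOnConE_extRep y).tgt_eq_recast_src (isIdOnConE_extRep x) hz hl

theorem resFam {z : Fam p ν.1.1 μ.1.1} (hz : IsRatHom r z (extRep hQ hc y) (extRep hQ hc x)) :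
    IsRatHom r (resFam hQ hc z) y x where
  comm e := (comm_base_iff _ e).1 (by
    rw [hz.extFam_resFam]
    exact hz.comm _)
  frob i := hz.frob i.1

end IsRatHom

namespace RatSES

variable {τ ω : Q.balanced c}

/-- The short exact sequence of representations of the quiver obtained from a short exact sequence
of representations of the contracted quiver by extending each term. -/
def extend (s : RatSES r (hatDim hQ hc τ) (hatDim hQ hc ω) x) :
    RatSES r τ.1 ω.1 (extRep hQ hc x) where
  quot := extRep hQ hc s.quot
  sub := extRep hQ hc s.sub
  ι := extFam hQ hc s.ι
  π := extFam hQ hc s.π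
  isRatHom_ι := s.isRatHom_ι.extFam
  isRatHom_π := s.isRatHom_π.extFam
  splitExact i := (s.splitExact (vertexMap hQ hc i)).recast _ _ _ _

theorem extend_injective : Function.Injective
    (extend : RatSES r (hatDim hQ hc τ) (hatDim hQ hc ω) x → RatSES r τ.1 ω.1 _) := by
  intro s s' h
  have hι := congrArg (fun S => resFam hQ hc S.ι) h
  have hπ := congrArg (fun S => resFam hQ hc S.π) h
  exact ext_of_maps (((resFam_extFam _).symm.trans hι).trans (resFam_extFam _))
    (((resFam_extFam _).symm.trans hπ).trans (resFam_extFam _))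

theorem exists_extend_eq (S : RatSES r τ.1 ω.1 (extRep hQ hc x)) {t : Rep p (hatDim hQ hc τ)}
    {w : Rep p (hatDim hQ hc ω)} (ht : S.quot = extRep hQ hc t) (hw : S.sub = extRep hQ hc w) :
    ∃ s : RatSES r (hatDim hQ hc τ) (hatDim hQ hc ω) x, s.extend = S := by
  have hι : IsRatHom r S.ι (extRep hQ hc w) (extRep hQ hc x) := hw ▸ S.isRatHom_ι
  have hπ : IsRatHom r S.π (extRep hQ hc x) (extRep hQ hc t) := ht ▸ S.isRatHom_π
  exact ⟨⟨t, w, _, _, hι.resFam, hπ.resFam, fun i => S.splitExact i.1⟩,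
    ext_of_maps hι.extFam_resFam hπ.extFam_resFam⟩

variable {X : Grp p ν.1}

/-- The short exact sequence with middle term `X • x`, for `x` extended from the contracted quiver,
obtained from a short exact sequence for the contracted quiver and rational elements of the groups
at `[i₋]`. -/
def extendTwist (hX : X ∈ ratGrp r ν.1) (y : RatSES r (hatDim hQ hc τ) (hatDim hQ hc ω) x ×
    ratMinusGrp (p := p) r c τ.1 × ratMinusGrp (p := p) r c ω.1) :
    RatSES r τ.1 ω.1 (act X (extRep hQ hc x)) :=
  y.1.extend.twist y.2.1.2.1 y.2.2.2.1 hX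

theorem extendTwist_injective (hX : X ∈ ratGrp r ν.1) :
    Function.Injective (extendTwist (τ := τ) (ω := ω) (x := x) hX) := by
  rintro ⟨s, a, b⟩ ⟨s', a', b'⟩ h
  obtain rfl : a = a' := Subtype.ext ((act_extRep_inj a.2 a'.2).1 (congrArg RatSES.quot h)).1
  obtain rfl : b = b' := Subtype.ext ((act_extRep_inj b.2 b'.2).1 (congrArg RatSES.sub h)).1
  obtain rfl : s = s' := extend_injective (twist_injective a.2.1 b.2.1 hX h)
  rfl

theorem extendTwist_surjective {x : Rep p (hatDim hQ hc (τ + ω))}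
    {X : Grp p (τ + ω).1} (hX : X ∈ ratGrp r (τ + ω).1) (hx : frobRep r x = x) :
    Function.Surjective (extendTwist (τ := τ) (ω := ω) (x := x) hX) := by
  intro S
  have hF := frobRep_act_eq_self hX (frobRep_extRep hx)
  obtain ⟨ht, hw⟩ := (heart Q p r c).mem_of_ratSES
    ((heart Q p r c).act_mem _ X _ (isIdOnConE_extRep x).mem_heart) hF S
  obtain ⟨a, ha, hat⟩ := exists_act_extRep_contractRep_eq hQ hc ht (S.frob_quot hF)
  obtain ⟨b, hb, hbw⟩ := exists_act_extRep_contractRep_eq hQ hc hw (S.frob_sub hF)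
  obtain ⟨S', ht', hw', rfl⟩ := exists_twist_eq ha.1 hb.1 hX S hat.symm hbw.symm
  obtain ⟨s, rfl⟩ := exists_extend_eq S' ht' hw'
  exact ⟨(s, ⟨a, ha⟩, ⟨b, hb⟩), rfl⟩

end RatSES

end Extension

/-! ## Multiplicativity of the contraction map -/

theorem finsum_prod_fst {k α β : Type*} [Semiring k] [Finite α] [Finite β] (f : α → k) :
    ∑ᶠ y : α × β, f y.1 = Nat.card β * ∑ᶠ x, f x := by
  have := Fintype.ofFinite α
  have := Fintype.ofFinite β
  simp only [finsum_eq_sum_of_fintype, Fintype.sum_prod_type, Finset.sum_const, Finset.card_univ,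
    nsmul_eq_mul, Finset.mul_sum, Nat.card_eq_fintype_card]

theorem sum_eq_sum_notMem_add {α : Type*} [Fintype α] {s : Set α} [Fintype {i // i ∉ s}]
    {f : α → ℕ} {m : ℕ} (hf : ∀ i ∈ s, f i = m) :
    ∑ i, f i = ∑ i : {i // i ∉ s}, f i + s.ncard * m := by
  classical
  have hs : ∑ i : {i // i ∈ s}, f i = s.ncard * m := by
    rw [Finset.sum_congr rfl fun i _ => hf i.1 i.2, Finset.sum_const, Finset.card_univ,
      smul_eq_mul, ← Nat.card_eq_fintype_card]
    rfl
  rw [← Fintype.sum_subtype_add_sum_subtype (· ∈ s), add_comm, hs]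
  congr 1
  exact Finset.sum_congr (by ext; simp) fun _ _ => rfl

section Exponent

variable (hQ : Q.Admissible) (hc : Q.Contractible c) (τ ω : Q.balanced c)

theorem sum_dim_mul_dim_eq [Fintype I] : ∑ i, τ.1.1 i * ω.1.1 i =
    ∑ i, (hatDim hQ hc τ).1 i * (hatDim hQ hc ω).1 i +
      (Q.minus c).ncard * (τ.1.1 (Q.tgt c) * ω.1.1 (Q.tgt c)) :=
  sum_eq_sum_notMem_add fun i hi => by
    rw [dim_sameCycle τ.1 (i := Q.tgt c) hi, dim_sameCycle ω.1 (i := Q.tgt c) hi]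

theorem sum_dim_src_mul_dim_tgt_eq [Fintype Ω] : ∑ h, τ.1.1 (Q.src h) * ω.1.1 (Q.tgt h) =
    ∑ e, (hatDim hQ hc τ).1 ((Q.contract c hQ hc).src e) *
        (hatDim hQ hc ω).1 ((Q.contract c hQ hc).tgt e) +
      (Q.minus c).ncard * (τ.1.1 (Q.tgt c) * ω.1.1 (Q.tgt c)) := by
  classical
  have hconst : ∀ h ∈ Q.conE c,
      τ.1.1 (Q.src h) * ω.1.1 (Q.tgt h) = τ.1.1 (Q.tgt c) * ω.1.1 (Q.tgt c) := fun h hh => by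
    rw [← dim_conE τ hh, dim_sameCycle τ.1 (tgt_mem_minus hh),
      dim_sameCycle ω.1 (tgt_mem_minus hh)]
  rw [sum_eq_sum_notMem_add hconst, hc.card_conE, hc.card_eq]
  refine congrArg (· + _) (Fintype.sum_equiv (edgeEquiv hQ hc) _ _ fun e => ?_).symm
  rw [dim_src_base, dim_tgt_base]
  rfl

theorem mExp_eq [Fintype I] [Fintype Ω] : mExp τ.1 ω.1 = mExp (hatDim hQ hc τ) (hatDim hQ hc ω) +
    2 * (τ.1.1 (Q.tgt c) * ω.1.1 (Q.tgt c)) * (Q.minus c).ncard := by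
  rw [mExp, mExp, sum_dim_mul_dim_eq hQ hc, sum_dim_src_mul_dim_tgt_eq hQ hc]
  ring

end Exponent

section Contraction

variable {k : Type*} [Field k] {hQ : Q.Admissible} {hc : Q.Contractible c} (v : k)
  {τ ω ν : Q.balanced c}

theorem zeroExt_muPull [Finite Ω]
    (f : HallPart v (fullLocus (Q.contract c hQ hc) p r ⊤) ⟨hatDim hQ hc ν, trivial⟩)
    {x : Rep p (hatDim hQ hc ν)} (hx : frobRep r x = x) {a : Grp p ν.1}
    (ha : a ∈ ratMinusGrp r c ν.1) :
    zeroExt (muPull hQ hc v ν f).1 (act a (extRep hQ hc x)) = zeroExt f.1 x := by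
  have hmem : act a (extRep hQ hc x) ∈ (heart Q p r c).carrier ν :=
    (heart Q p r c).act_mem _ _ _ (isIdOnConE_extRep x).mem_heart
  have hF := frobRep_act_eq_self ha.1 (frobRep_extRep hx)
  refine (zeroExt_apply (muPull hQ hc v ν f).1 ⟨_, hmem, hF⟩).trans
    (Eq.trans ?_ (zeroExt_apply f.1 ⟨x, trivial, hx⟩).symm)
  exact congrArg f.1 (Subtype.ext (contractRep_act_extRep ha x))

variable (f₁ : HallPart v (fullLocus (Q.contract c hQ hc) p r ⊤) ⟨hatDim hQ hc τ, trivial⟩)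
  (f₂ : HallPart v (fullLocus (Q.contract c hQ hc) p r ⊤) ⟨hatDim hQ hc ω, trivial⟩)

theorem indFun_muPart (x : Pts r ((heart Q p r c).carrier (τ + ω))) :
    indFun (heart Q p r c) (muPart hQ hc v τ f₁).1 (muPart hQ hc v ω f₂).1 x =
      v⁻¹ ^ ((τ.1.1 (Q.tgt c) ^ 2 + ω.1.1 (Q.tgt c) ^ 2) * (Q.minus c).ncard) *
        indFun (heart Q p r c) (muPull hQ hc v τ f₁).1 (muPull hQ hc v ω f₂).1 x := by
  have h : indFun (heart Q p r c) (muPart hQ hc v τ f₁).1 (muPart hQ hc v ω f₂).1 =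
      v⁻¹ ^ (τ.1.1 (Q.tgt c) ^ 2 * (Q.minus c).ncard) •
        v⁻¹ ^ (ω.1.1 (Q.tgt c) ^ 2 * (Q.minus c).ncard) •
          indFun (heart Q p r c) (muPull hQ hc v τ f₁).1 (muPull hQ hc v ω f₂).1 := by
    rw [← indFun_smul_right, ← indFun_smul_left]
    rfl
  rw [h, smul_smul, ← pow_add, ← add_mul]
  rfl

variable [NeZero r]

theorem finsum_ratSES_muPull [Finite I] [Finite Ω] {x : Rep p (hatDim hQ hc (τ + ω))}
    (hx : frobRep r x = x) {X : Grp p (τ + ω).1} (hX : X ∈ ratGrp r (τ + ω).1) :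
    ∑ᶠ S : RatSES r τ.1 ω.1 (act X (extRep hQ hc x)),
        zeroExt (muPull hQ hc v τ f₁).1 S.quot * zeroExt (muPull hQ hc v ω f₂).1 S.sub =
      (Nat.card (ratMinusGrp (p := p) r c τ.1) * Nat.card (ratMinusGrp (p := p) r c ω.1) : k) *
        ∑ᶠ s : RatSES r (hatDim hQ hc τ) (hatDim hQ hc ω) x,
          zeroExt f₁.1 s.quot * zeroExt f₂.1 s.sub := by
  rw [← Nat.cast_mul, ← Nat.card_prod, ← finsum_prod_fst,
    ← finsum_comp_equiv (Equiv.ofBijective _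
      ⟨RatSES.extendTwist_injective hX, RatSES.extendTwist_surjective hX hx⟩)]
  exact finsum_congr fun y => congrArg₂ (· * ·)
    (zeroExt_muPull v f₁ (y.1.frob_quot hx) y.2.1.2) (zeroExt_muPull v f₂ (y.1.frob_sub hx) y.2.2.2)

theorem indFun_muPull [Finite I] [Finite Ω] (x : Pts r ((heart Q p r c).carrier (τ + ω))) :
    indFun (heart Q p r c) (muPull hQ hc v τ f₁).1 (muPull hQ hc v ω f₂).1 x =
      (Nat.card (ratMinusGrp (p := p) r c τ.1) * Nat.card (ratMinusGrp (p := p) r c ω.1) : k) *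
        indFun (fullLocus (Q.contract c hQ hc) p r ⊤) f₁.1 f₂.1 (contractPts hQ hc x) := by
  obtain ⟨X, hX, hxX⟩ := exists_act_extRep_contractRep_eq hQ hc x.2.1 x.2.2
  have hF : frobRep r (contractRep hQ hc x.1) = contractRep hQ hc x.1 := (contractPts hQ hc x).2.2
  have key := finsum_ratSES_muPull v f₁ f₂ hF hX.1
  rw [hxX] at key
  exact (indFun_eq_finsum_ratSES _ _ _ x).trans (key.trans (congrArg (_ * ·)
    (indFun_eq_finsum_ratSES (fullLocus (Q.contract c hQ hc) p r ⊤) f₁.1 f₂.1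
      (contractPts hQ hc x)).symm))

theorem muPart_hallMul [Fintype I] [Fintype Ω] [CharZero k] :
    muPart hQ hc v (τ + ω) (hallMul v (fullLocus (Q.contract c hQ hc) p r ⊤) f₁ f₂) =
      hallMul v (heart Q p r c) (muPart hQ hc v τ f₁) (muPart hQ hc v ω f₂) := by
  refine Subtype.ext (funext fun x => ?_)
  have hτ : (Nat.card (ratMinusGrp (p := p) r c τ.1) : k) ≠ 0 := Nat.cast_ne_zero.2 Nat.card_pos.ne'
  have hω : (Nat.card (ratMinusGrp (p := p) r c ω.1) : k) ≠ 0 := Nat.cast_ne_zero.2 Nat.card_pos.ne'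
  change v⁻¹ ^ ((τ.1.1 (Q.tgt c) + ω.1.1 (Q.tgt c)) ^ 2 * (Q.minus c).ncard) *
      (v⁻¹ ^ mExp (hatDim hQ hc τ) (hatDim hQ hc ω) *
        ((cardG p r (hatDim hQ hc τ) * cardG p r (hatDim hQ hc ω) : ℕ) : k)⁻¹ *
        indFun (fullLocus (Q.contract c hQ hc) p r ⊤) f₁.1 f₂.1 (contractPts hQ hc x)) =
    v⁻¹ ^ mExp τ.1 ω.1 * ((cardG p r τ.1 * cardG p r ω.1 : ℕ) : k)⁻¹ *
      indFun (heart Q p r c) (muPart hQ hc v τ f₁).1 (muPart hQ hc v ω f₂).1 x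
  rw [indFun_muPart, indFun_muPull, cardG_eq hQ hc τ, cardG_eq hQ hc ω, mExp_eq hQ hc τ ω]
  push_cast
  field_simp
  ring

end Contraction

/-! ## Homomorphisms between Hall algebras -/

theorem map_mul_of_map_of_mul_of {ι B F : Type*} {A : ι → Type*} [DecidableEq ι] [Add ι]
    [∀ i, AddCommMonoid (A i)] [DirectSum.GNonUnitalNonAssocSemiring A]
    [NonUnitalNonAssocSemiring B] [FunLike F (⨁ i, A i) B] [AddMonoidHomClass F (⨁ i, A i) B]
    (f : F) (h : ∀ i j (a : A i) (b : A j), f (DirectSum.of A i a * DirectSum.of A j b) =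
      f (DirectSum.of A i a) * f (DirectSum.of A j b)) (x y : ⨁ i, A i) :
    f (x * y) = f x * f y := by
  induction x using DirectSum.induction_on with
  | zero => rw [zero_mul, map_zero, zero_mul]
  | add x x' h h' => rw [add_mul, map_add, map_add, add_mul, h, h']
  | of i a =>
    induction y using DirectSum.induction_on with
    | zero => rw [mul_zero, map_zero, mul_zero]
    | add y y' h h' => rw [mul_add, map_add, map_add, mul_add, h, h']
    | of j b => exact h i j a b

section InvFun

variable {k : Type*} [Field k] {ν : Q.DimVec} (X : Set (Rep p ν))

theorem restr_extZero (hX : ∀ (g : Grp p ν) x, x ∈ X → act g x ∈ X) (f : InvFun r k X) :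
    restr X (extZero X hX f) = f :=
  Subtype.ext (funext fun x => dif_pos x.2.1)

theorem extZero_injective (hX : ∀ (g : Grp p ν) x, x ∈ X → act g x ∈ X) :
    Function.Injective (extZero (r := r) (k := k) X hX) :=
  Function.LeftInverse.injective (restr_extZero X hX)

theorem range_extZero_compl (hX : ∀ (g : Grp p ν) x, x ∈ Xᶜ → act g x ∈ Xᶜ) :
    LinearMap.range (extZero (r := r) (k := k) Xᶜ hX) = LinearMap.ker (restr X) := by
  ext f
  rw [LinearMap.mem_range, LinearMap.mem_ker]
  constructor
  · rintro ⟨f, rfl⟩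
    exact Subtype.ext (funext fun x => dif_neg fun h => h x.2.1)
  · refine fun h => ⟨restr Xᶜ f, Subtype.ext (funext fun x => ?_)⟩
    by_cases hx : x.1 ∈ X
    · refine (dif_neg fun h' => h' hx).trans ?_
      exact (congrFun (congrArg Subtype.val h) ⟨x.1, hx, x.2.2⟩).symm
    · exact dif_pos hx

end InvFun

section Loci

variable {D : AddSubmonoid Q.DimVec} {k : Type*} [Field k] (v : k) (L : Locus Q p r D)

theorem iShriek_injective : Function.Injective (iShriek v L) :=
  (DirectSum.lmap_injective _).2 fun _ => extZero_injective _ _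

theorem jStar_comp_jShriek : jStar v L ∘ₗ jShriek v L = LinearMap.id :=
  LinearMap.ext fun f => DFinsupp.ext fun ν => restr_extZero (L.carrier ν) (L.act_mem ν) (f ν)

theorem jStar_surjective : Function.Surjective (jStar v L) :=
  Function.RightInverse.surjective (LinearMap.congr_fun (jStar_comp_jShriek v L))

theorem exact_iShriek_jStar : Function.Exact (iShriek v L) (jStar v L) := by
  refine LinearMap.exact_iff.2 ((DirectSum.ker_lmap _).trans
    (Eq.trans ?_ (DirectSum.range_lmap _).symm))
  exact congrArg (fun S => Submodule.comap _ (Submodule.pi Set.univ S))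
    (funext fun ν => (range_extZero_compl _ _).symm)

theorem heart_carrier_zero : (heart Q p r c).carrier 0 = Set.univ :=
  Set.eq_univ_of_forall fun _ _ _ =>
    ⟨fun i => i.elim0, funext fun i => i.elim0, funext fun i => i.elim0⟩

variable [Fintype I]

theorem jStar_of (ν : D) (f : HallPart v (fullLocus Q p r D) ν) :
    jStar v L (DirectSum.of (HallPart v (fullLocus Q p r D)) ν f) =
      DirectSum.of (HallPart v L) ν (restr (L.carrier ν) f) :=
  DirectSum.lmap_of _ _ _

theorem jShriek_of (ν : D) (f : HallPart v L ν) :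
    jShriek v L (DirectSum.of (HallPart v L) ν f) =
      DirectSum.of (HallPart v (fullLocus Q p r D)) ν (extZero (L.carrier ν) (L.act_mem ν) f) :=
  DirectSum.lmap_of _ _ _

theorem incl_of (D : AddSubmonoid Q.DimVec) (ν : D)
    (f : HallPart v (fullLocus Q p r D) ν) :
    incl v D (DirectSum.of (HallPart v (fullLocus Q p r D)) ν f) =
      DirectSum.of (HallPart v (fullLocus Q p r ⊤)) ⟨ν.1, trivial⟩ f :=
  DirectSum.toModule_lof k ν f

theorem incl_apply (D : AddSubmonoid Q.DimVec) (f : Hall v (fullLocus Q p r D))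
    (ν : D) : (incl v D f) ⟨ν.1, trivial⟩ = f ν := by
  induction f using DirectSum.induction_on with
  | zero => rw [map_zero]; rfl
  | add f f' h h' => rw [map_add, DirectSum.add_apply, DirectSum.add_apply, h, h']; rfl
  | of μ f =>
    rw [incl_of]
    by_cases e : μ = ν
    · subst e
      exact (DirectSum.of_eq_same _ _).trans (DirectSum.of_eq_same μ f).symm
    · refine (DirectSum.of_eq_of_ne _ _ _ fun h => e ?_).trans
        (DirectSum.of_eq_of_ne μ ν f fun h => e h.symm).symm
      exact Subtype.ext (congrArg Subtype.val h).symm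

theorem incl_injective (D : AddSubmonoid Q.DimVec) :
    Function.Injective (incl (p := p) (r := r) v D) := fun f f' h => DFinsupp.ext fun ν =>
  (incl_apply v D f ν).symm.trans
    ((congrArg (· ⟨ν.1, trivial⟩) h).trans (incl_apply v D f' ν))

variable [Fintype Ω] [NeZero r]

variable {v L} in
theorem of_mul_of_hallMul {τ ω : D} (a : HallPart v L τ) (b : HallPart v L ω) :
    DirectSum.of (HallPart v L) τ a * DirectSum.of (HallPart v L) ω b =
      DirectSum.of (HallPart v L) (τ + ω) (hallMul v L a b) :=
  DirectSum.of_mul_of a b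

theorem isHallHom_jStar : IsHallHom (jStar v L) where
  map_one := jStar_of v L 0 _
  map_mul := map_mul_of_map_of_mul_of _ fun τ ω a b => by
    rw [of_mul_of_hallMul, jStar_of, jStar_of, jStar_of]
    exact (congrArg _ (restr_hallMul L v a b)).trans (of_mul_of_hallMul _ _).symm

variable {L} in
theorem isHallHom_jShriek (hL : L.ExtClosed) (h0 : L.carrier 0 = Set.univ) :
    IsHallHom (jShriek v L) where
  map_one := (jShriek_of v L 0 _).trans (congrArg _ (Subtype.ext (funext fun x =>
    dif_pos (h0.symm ▸ Set.mem_univ x.1))))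
  map_mul := map_mul_of_map_of_mul_of _ fun τ ω a b => by
    rw [of_mul_of_hallMul, jShriek_of, jShriek_of, jShriek_of]
    exact (congrArg _ (extZero_hallMul v hL a b)).trans (of_mul_of_hallMul _ _).symm

theorem isHallHom_incl (D : AddSubmonoid Q.DimVec) :
    IsHallHom (incl (p := p) (r := r) v D) where
  map_one := incl_of v D 0 _
  map_mul := map_mul_of_map_of_mul_of _ fun τ ω a b => by
    rw [of_mul_of_hallMul, incl_of, incl_of, incl_of]
    exact (of_mul_of_hallMul (L := fullLocus Q p r ⊤) (τ := ⟨τ.1, trivial⟩)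
      (ω := ⟨ω.1, trivial⟩) a b).symm

end Loci

/-! ## The contraction isomorphism -/

section Contraction

variable {k : Type*} [Field k] (hQ : Q.Admissible) (hc : Q.Contractible c)

theorem hatDim_surjective [Finite Ω] : Function.Surjective (hatDim hQ hc) := by
  refine fun μ => ⟨⟨⟨fun i => μ.1 (vertexMap hQ hc i), fun i => ?_⟩, ?_⟩, ?_⟩
  · exact (congrArg μ.1 (vertexMap_aV hQ hc i)).trans (μ.2 _)
  · have hcc : c ∈ Q.conE c := Equiv.Perm.SameCycle.refl _ _
    exact congrArg μ.1 ((vertexMap_of_notMem hQ hc (src_notMem hQ hc hcc)).trans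
      (vertexMap_tgt hQ hc hcc).symm)
  · exact Subtype.ext (funext fun i => congrArg μ.1 (vertexMap_coe hQ hc i))

/-- The section of the contraction map on rational points that extends a representation of the
contracted quiver by identities along the contracted edges. -/
def extPts [Finite Ω] {ν : Q.balanced c} (x : Pts r (Set.univ : Set (Rep p (hatDim hQ hc ν)))) :
    Pts r ((heart Q p r c).carrier ν) :=
  ⟨extRep hQ hc x.1, (isIdOnConE_extRep x.1).mem_heart, frobRep_extRep x.2.2⟩

variable {hQ hc} {ν : Q.balanced c}

theorem contractPts_extPts [Finite Ω] (x : Pts r (Set.univ : Set (Rep p (hatDim hQ hc ν)))) :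
    contractPts hQ hc (extPts hQ hc x) = x :=
  Subtype.ext (contractRep_extRep x.1)

theorem apply_extPts_contractPts [Finite Ω] (f : InvFun r k ((heart Q p r c).carrier ν))
    (x : Pts r ((heart Q p r c).carrier ν)) :
    f.1 (extPts hQ hc (contractPts hQ hc x)) = f.1 x := by
  obtain ⟨X, hX, hxX⟩ := exists_act_extRep_contractRep_eq hQ hc x.2.1 x.2.2
  exact (f.2 X hX.1 (extPts hQ hc (contractPts hQ hc x)) x hxX.symm).symm

theorem exists_eq_act_extPts [Finite Ω] {x y : Pts r (Set.univ : Set (Rep p (hatDim hQ hc ν)))}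
    {g : Grp p (hatDim hQ hc ν)} (hg : frobGrp r g = g) (hxy : y.1 = act g x.1) :
    ∃ (g' : Grp p ν.1) (z : Pts r ((heart Q p r c).carrier ν)), frobGrp r g' = g' ∧
      z.1 = act g' (extPts hQ hc x).1 ∧ contractPts hQ hc z = y := by
  have hg' : frobGrp r (glueGrp hQ hc g 1) = glueGrp hQ hc g 1 :=
    glueGrp_mem_ratGrp hQ hc hg (one_mem (ratGrp r ν.1))
  refine ⟨_, ⟨act (glueGrp hQ hc g 1) (extPts hQ hc x).1,
    (heart Q p r c).act_mem _ _ _ (extPts hQ hc x).2.1,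
    frobRep_act_eq_self hg' (extPts hQ hc x).2.2⟩, hg', rfl, Subtype.ext (Eq.trans ?_ hxy.symm)⟩
  exact (contractRep_act hQ hc _ _ (extPts hQ hc x).2.1).trans (congrArg₂ act
    (funext fun i => glueGrp_of_notMem hQ hc g 1 i.2) (contractRep_extRep x.1))

variable (hQ hc ν) (v : k)

theorem muPull_bijective [Finite Ω] :
    Function.Bijective (muPull (p := p) (r := r) hQ hc v ν) := by
  constructor
  · refine fun f f' h => Subtype.ext (funext fun x => ?_)
    have hx := congrFun (congrArg Subtype.val h) (extPts hQ hc x)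
    exact (congrArg f.1 (contractPts_extPts x)).symm.trans
      (hx.trans (congrArg f'.1 (contractPts_extPts x)))
  · refine fun f => ⟨⟨fun x => f.1 (extPts hQ hc x), fun g hg x y hxy => ?_⟩,
      Subtype.ext (funext (apply_extPts_contractPts f))⟩
    obtain ⟨g', z, hg', hz, rfl⟩ := exists_eq_act_extPts hg hxy
    exact (apply_extPts_contractPts f z).trans (f.2 g' hg' (extPts hQ hc x) z hz)

variable {v}

theorem muPart_bijective [Finite Ω] (hv : v ≠ 0) :
    Function.Bijective (muPart (p := p) (r := r) hQ hc v ν) :=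
  (MulAction.bijective₀ (pow_ne_zero _ (inv_ne_zero hv))).comp (muPull_bijective hQ hc ν v)

variable {ν} (v)

theorem muStar_of [Fintype I]
    (f : HallPart v (fullLocus (Q.contract c hQ hc) p r ⊤) ⟨hatDim hQ hc ν, trivial⟩) :
    muStar hQ hc v (DirectSum.of (HallPart v (fullLocus (Q.contract c hQ hc) p r ⊤))
      ⟨hatDim hQ hc ν, trivial⟩ f) =
      DirectSum.of (HallPart v (heart Q p r c)) ν (muPart hQ hc v ν f) := by
  refine DFinsupp.ext fun μ => ?_
  change muPart hQ hc v μ (DirectSum.of _ _ f ⟨hatDim hQ hc μ, trivial⟩) = _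
  by_cases e : μ = ν
  · subst e
    exact (congrArg _ (DirectSum.of_eq_same _ f)).trans (DirectSum.of_eq_same μ _).symm
  · refine (congrArg _ (DirectSum.of_eq_of_ne _ _ _ fun h => e ?_)).trans
      ((map_zero _).trans (DirectSum.of_eq_of_ne _ _ _ e).symm)
    exact hatDim_injective hQ hc (congrArg Subtype.val h)

variable {v} in
theorem muStar_bijective [Finite I] [Finite Ω] (hv : v ≠ 0) :
    Function.Bijective (muStar (p := p) (r := r) hQ hc v) := by
  have := Fintype.ofFinite I
  constructor
  · rintro f f' h
    refine DFinsupp.ext fun ⟨μ, hμ⟩ => ?_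
    obtain ⟨ν, rfl⟩ := hatDim_surjective hQ hc μ
    exact (muPart_bijective hQ hc ν hv).1 (congrArg (· ν) h)
  · intro f
    induction f using DirectSum.induction_on with
    | zero => exact ⟨0, map_zero _⟩
    | add f f' h h' =>
      obtain ⟨g, rfl⟩ := h
      obtain ⟨g', rfl⟩ := h'
      exact ⟨g + g', map_add _ _ _⟩
    | of ν f =>
      obtain ⟨g, rfl⟩ := (muPart_bijective hQ hc ν hv).2 f
      exact ⟨_, muStar_of hQ hc v g⟩

theorem isHallHom_muStar [Fintype I] [Fintype Ω] [NeZero r] [CharZero k] :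
    IsHallHom (muStar (p := p) (r := r) hQ hc v) where
  map_one := by
    refine (muStar_of (ν := 0) hQ hc v _).trans (congrArg _ (Subtype.ext (funext fun x => ?_)))
    change v⁻¹ ^ (0 ^ 2 * (Q.minus c).ncard) * 1 = 1
    rw [mul_one, zero_pow two_ne_zero, zero_mul, pow_zero]
  map_mul := map_mul_of_map_of_mul_of _ fun ⟨τ, hτ⟩ ⟨ω, hω⟩ a b => by
    obtain ⟨τ, rfl⟩ := hatDim_surjective hQ hc τ
    obtain ⟨ω, rfl⟩ := hatDim_surjective hQ hc ω
    rw [of_mul_of_hallMul]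
    refine (muStar_of (ν := τ + ω) hQ hc v _).trans (Eq.trans ?_
      (congrArg₂ (· * ·) (muStar_of hQ hc v a).symm (muStar_of hQ hc v b).symm))
    exact (congrArg _ (muPart_hallMul v a b)).trans (of_mul_of_hallMul _ _).symm

end Contraction

/-! ## Split surjections of Hall algebras -/

namespace IsHallHom

variable {k A B C : Type*} [Field k] [NonUnitalNonAssocRing A] [NonUnitalNonAssocRing B]
  [NonUnitalNonAssocRing C] [One A] [One B] [One C] [Module k A] [Module k B] [Module k C]
  {f : A →ₗ[k] B}

theorem comp {g : B →ₗ[k] C} (hg : IsHallHom g) (hf : IsHallHom f) : IsHallHom (g ∘ₗ f) where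
  map_one := (congrArg g hf.map_one).trans hg.map_one
  map_mul x y := (congrArg g (hf.map_mul x y)).trans (hg.map_mul _ _)

theorem symm {e : A ≃ₗ[k] B} (he : IsHallHom e.toLinearMap) :
    IsHallHom e.symm.toLinearMap where
  map_one := e.symm_apply_eq.2 he.map_one.symm
  map_mul x y := e.symm_apply_eq.2 <| by
    refine Eq.trans ?_ (he.map_mul _ _).symm
    exact congrArg₂ (· * ·) (e.apply_symm_apply x).symm (e.apply_symm_apply y).symm

/-- The kernel of a homomorphism of Hall algebras, as a two-sided ideal. -/
def ker (hf : IsHallHom f) : TwoSidedIdeal A :=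
  TwoSidedIdeal.ker ({ f with map_mul' := hf.map_mul, map_zero' := map_zero f } : A →ₙ+* B)

theorem mem_ker (hf : IsHallHom f) {x : A} : x ∈ hf.ker ↔ f x = 0 :=
  TwoSidedIdeal.mem_ker _

theorem mk_eq_mk (hf : IsHallHom f) {x y : A} :
    (x : hf.ker.ringCon.Quotient) = y ↔ f x = f y :=
  RingCon.eq _

variable {s : B →ₗ[k] A} (hf : IsHallHom f) (hs : IsHallHom s) (hfs : f ∘ₗ s = LinearMap.id)

/-- The isomorphism from the target of a split surjection of Hall algebras to the quotient by the
kernel, induced by the section. -/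
def quotientKerEquiv : B ≃+* hf.ker.ringCon.Quotient where
  toFun b := (s b : A)
  invFun := Quotient.lift f fun _ _ => hf.mk_eq_mk.1 ∘ Quotient.sound
  left_inv := LinearMap.congr_fun hfs
  right_inv y := Quotient.inductionOn y fun x =>
    hf.mk_eq_mk.2 (LinearMap.congr_fun hfs (f x))
  map_mul' x y := congrArg _ (hs.map_mul x y)
  map_add' x y := congrArg _ (map_add s x y)

theorem quotientKerEquiv_smul (a : k) (b : B) (x : A)
    (h : hf.quotientKerEquiv hs hfs b = (x : hf.ker.ringCon.Quotient)) :
    hf.quotientKerEquiv hs hfs (a • b) = ((a • x : A) : hf.ker.ringCon.Quotient) :=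
  hf.mk_eq_mk.2 <| by rw [map_smul, map_smul, map_smul, hf.mk_eq_mk.1 h]

end IsHallHom

theorem root_ne_zero {p r : ℕ} [Fact p.Prime] {v : ℂ} (hv : v ^ 2 = (p : ℂ) ^ r) :
    root v ≠ 0 := by
  intro h
  have h0 : v = 0 := congrArg (algebraMap (BaseField v) ℂ) h
  rw [h0, zero_pow two_ne_zero] at hv
  exact pow_ne_zero r (Nat.cast_ne_zero.2 (Fact.out : p.Prime).ne_zero) hv.symm

end AutQuiver

end HallContraction

end

open HallContraction HallContraction.AutQuiver in
theorem mainTheorem2 {I Ω : Type*} [Fintype I] [Fintype Ω] (Q : AutQuiver I Ω)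
    (hQ : Q.Admissible) (c : Ω) (hc : Q.Contractible c) (p r : ℕ) [Fact p.Prime] [NeZero r]
    (v : ℂ) (hv : v ^ 2 = (p : ℂ) ^ r) :
    -- `H_Î` is a subalgebra of `H`
    (IsHallHom (inclI Q c p r v) ∧ Function.Injective (inclI Q c p r v)) ∧
    -- the split short exact sequence `0 → H^c → H_Î → H^♡ → 0` of Hall algebras
    (IsHallHom (jR Q c p r v) ∧ IsHallHom (jE Q c p r v) ∧
      Function.Injective (iC Q c p r v) ∧ Function.Exact (iC Q c p r v) (jR Q c p r v) ∧
      Function.Surjective (jR Q c p r v) ∧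
      jR Q c p r v ∘ₗ jE Q c p r v = LinearMap.id) ∧
    -- the Hall algebra `Ĥ` of the contracted quiver is isomorphic to `H^♡` by `μ^⋆`
    (IsHallHom (muH Q c p r v hQ hc) ∧ Function.Bijective (muH Q c p r v hQ hc)) ∧
    -- `H^c` is a two-sided ideal `J` of `H_Î`
    ∃ J : TwoSidedIdeal (HallI Q c p r v), (J : Set (HallI Q c p r v)) = Set.range (iC Q c p r v) ∧
      -- `Ĥ` is isomorphic to `H_Î / J` as an algebra, by `j_! μ^⋆`
      (∃ e : HallQ (Q.contract c hQ hc) p r v ≃+* J.ringCon.Quotient,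
        (∀ f, e f = ((jE Q c p r v (muH Q c p r v hQ hc f) : HallI Q c p r v) :
          J.ringCon.Quotient)) ∧
        e 1 = ((1 : HallI Q c p r v) : J.ringCon.Quotient) ∧
        ∀ (a : BaseField v) (f : HallQ (Q.contract c hQ hc) p r v) (x : HallI Q c p r v),
          e f = (x : J.ringCon.Quotient) →
          e (a • f) = ((a • x : HallI Q c p r v) : J.ringCon.Quotient)) ∧
      -- the quotient map `H_Î → Ĥ` with kernel `J` is split by an algebra homomorphism
      ∃ π : HallI Q c p r v →ₗ[BaseField v] HallQ (Q.contract c hQ hc) p r v,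
        IsHallHom π ∧ Function.Surjective π ∧ (∀ x, π x = 0 ↔ x ∈ J) ∧
        IsHallHom (jE Q c p r v ∘ₗ muH Q c p r v hQ hc) ∧
        π ∘ₗ (jE Q c p r v ∘ₗ muH Q c p r v hQ hc) = LinearMap.id := by
  have hjR : IsHallHom (jR Q c p r v) := isHallHom_jStar _ _
  have hjE : IsHallHom (jE Q c p r v) := isHallHom_jShriek _ heart_extClosed heart_carrier_zero
  have hRE : jR Q c p r v ∘ₗ jE Q c p r v = LinearMap.id := jStar_comp_jShriek _ _
  have hex : Function.Exact (iC Q c p r v) (jR Q c p r v) := exact_iShriek_jStar _ _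
  have hmu : IsHallHom (muH Q c p r v hQ hc) := isHallHom_muStar hQ hc _
  have hbij : Function.Bijective (muH Q c p r v hQ hc) := muStar_bijective hQ hc (root_ne_zero hv)
  let m := LinearEquiv.ofBijective (muH Q c p r v hQ hc) hbij
  have hπ : IsHallHom (m.symm.toLinearMap ∘ₗ jR Q c p r v) := (IsHallHom.symm hmu).comp hjR
  have hs : IsHallHom (jE Q c p r v ∘ₗ muH Q c p r v hQ hc) := hjE.comp hmu
  have hπs : (m.symm.toLinearMap ∘ₗ jR Q c p r v) ∘ₗ jE Q c p r v ∘ₗ muH Q c p r v hQ hc =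
      LinearMap.id := LinearMap.ext fun f =>
    (congrArg m.symm (LinearMap.congr_fun hRE _)).trans (m.symm_apply_apply f)
  have hker : ∀ x, x ∈ hπ.ker ↔ jR Q c p r v x = 0 := fun x =>
    hπ.mem_ker.trans m.symm.map_eq_zero_iff
  exact ⟨⟨isHallHom_incl _ _, incl_injective _ _⟩,
    ⟨hjR, hjE, iShriek_injective _ _, hex, jStar_surjective _ _, hRE⟩, ⟨hmu, hbij⟩,
    hπ.ker, Set.ext fun x => (hker x).trans (hex x),
    ⟨hπ.quotientKerEquiv hs hπs, fun _ => rfl, congrArg _ hs.map_one,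
      hπ.quotientKerEquiv_smul hs hπs⟩,
    _, hπ, m.symm.surjective.comp (jStar_surjective _ _), fun _ => hπ.mem_ker.symm, hs, hπs⟩
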